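/- **Setting.** Let $K:[0,\infty)\to\mathbb R$ be a $C^\infty$ function with $K=1$ on $[0,1]$ and $K=0$ on $[4,\infty)$. For masses and a cutoff $0<m\le M\le\Lambda_0$, and for $p\in\mathbb R^4$, $0\le\Lambda\le\Lambda_0$, put $$P_m^\Lambda(p)=\frac{R_m(\Lambda,p)}{p^2+m^2},\quad P_M^\Lambda(p)=\frac{R_M(\Lambda,p)}{p^2+M^2},\quad R_m(\Lambda,p)=\bigl[1-K\bigl((1+\Lambda/m)^2\bigr)\bigr]K(p^2/\Lambda^2),\quad R_M(\Lambda,p)=\bigl[1-K(\Lambda^2/M^2)\bigr]K(p^2/\Lambda^2)$$ (both cutoff functions are $0$ at $\Lambda=0$). For $r=(r_1,r_2,r_3)\in\mathbb N^3$ and $n=(n_1,n_2)\in\mathbb N^2$ with $|n|=n_1+n_2\ge1$ let $\mathcal L^\Lambda_{r,2n}(p_1,\dots,p_{2n_1};p'_1,\dots,p'_{2n_2})$ be the real vertex function with $2n_1$ light ($\phi$) and $2n_2$ heavy ($\psi$) legs at order $g_1^{r_1}g_2^{r_2}g_3^{r_3}$. The momenta have total sum zero; the last one is dependent (it is $p'_{2n_2}$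 if $n_2\ge1$ and $p_{2n_1}$ if $n_2=0$), the others are the independent momenta. The vertex functions are $C^\infty$ in $\Lambda\in[0,\Lambda_0]$ and in the independent momenta, symmetric in the light legs and in the heavy legs, zero for $|n|>|r|+1$ (where $|r|=r_1+r_2+r_3$), and satisfy the following. (1) *Flow equation* (Wilson–Polchinski), for $0\le\Lambda\le\Lambda_0$: $$\begin{aligned}\partial_\Lambda\mathcal L^\Lambda_{r,2n}={}&-\binom{2n_1+2}{2}\int\!\frac{d^4q}{(2\pi)^4}\,\partial_\Lambda P_m^\Lambda(q)\,\mathcal L^\Lambda_{r,2(n_1+1,n_2)}(p_1,\dots,p_{2n_1},q,-q;p')\\&-\binom{2n_2+2}{2}\int\!\frac{d^4q}{(2\pi)^4}\,\partial_\Lambda P_M^\Lambda(q)\,\mathcal L^\Lambda_{r,2(n_1,n_2+1)}(p;p'_1,\dots,p'_{2n_2},q,-q)\\&+2\sum_{\substack{r'+r''=r\\ l_1+l_1'=n_1+1\\ l_2+l_2'=n_2}}l_1l_1'\Bigl[\partial_\Lambda P_m^\Lambda(P)\,\mathcal L^\Lambda_{r',2(l_1,l_2)}(p_1,\dots,p_{2l_1-1},P;p'_1,\dots,p'_{2l_2})\,\mathcal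 L^\Lambda_{r'',2(l_1',l_2')}(p_{2l_1},\dots,p_{2n_1},-P;p'_{2l_2+1},\dots,p'_{2n_2})\Bigr]_{\rm symm}\\&+2\sum_{\substack{r'+r''=r\\ l_1+l_1'=n_1\\ l_2+l_2'=n_2+1}}l_2l_2'\Bigl[\partial_\Lambda P_M^\Lambda(P')\,\mathcal L^\Lambda_{r',2(l_1,l_2)}(p_1,\dots,p_{2l_1};p'_1,\dots,p'_{2l_2-1},P')\,\mathcal L^\Lambda_{r'',2(l_1',l_2')}(p_{2l_1+1},\dots,p_{2n_1};p'_{2l_2},\dots,p'_{2n_2},-P')\Bigr]_{\rm symm},\end{aligned}$$ where $P$, $P'$ are fixed by momentum conservation at the first vertex and $[\cdot]_{\rm symm}$ is the average over all permutations of the external light momenta and of the external heavy momenta. (2) *At $\Lambda=\Lambda_0$* the interaction is the bare one: for some real numbers $\rho_{a,r}$ ($a=1,\dots,7$), $\mathcal L^{\Lambda_0}_{r,(2,0)}=\tfrac12(\rho_{1,r}+\rho_{2,r}p^2)$, $\mathcal L^{\Lambda_0}_{r,(4,0)}=\rho_{3,r}/4!$, $\mathcal L^{\Lambda_0}_{r,(0,2)}=\tfrac12(\rho_{4,r}+\rho_{5,r}p'^2)$,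 $\mathcal L^{\Lambda_0}_{r,(0,4)}=\rho_{6,r}/4!$, $\mathcal L^{\Lambda_0}_{r,(2,2)}=\rho_{7,r}/4$, and all other $\mathcal L^{\Lambda_0}_{r,2n}$ vanish. (3) *At $\Lambda=0$*, for all $r$ and for given $\bar p'_1,\dots,\bar p'_5\in\mathbb R^4$ with $|\bar p'_i|=M$: $\mathcal L^0_{r,(2,0)}(0)=0$, $\partial_\mu\partial_\nu\mathcal L^0_{r,(2,0)}(0)=0$, $\mathcal L^0_{r,(4,0)}(0)=\tfrac1{4!}\delta_{r,(1,0,0)}$, $\mathcal L^0_{r,(0,2)}(\bar p'_1)=0$, $\mathcal L^0_{r,(0,4)}(\bar p'_2,\bar p'_3,\bar p'_4)=\tfrac1{4!}\delta_{r,(0,1,0)}$, $\mathcal L^0_{r,(2,2)}(0,0;\bar p'_5)=\tfrac14\delta_{r,(0,0,1)}$, and the $\delta_{\mu\nu}$ part of $\partial_\mu\partial_\nu\mathcal L^0_{r,(0,2)}(\bar p'_1)$ vanishes, that is, $u_\mu v_\nu\,\partial_\mu\partial_\nu\mathcal L^0_{r,(0,2)}(\bar p'_1)=0$ for all $u,v\perp\bar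 p'_1$. For $z\in\mathbb N$ and $\mu>0$ let $\|\partial^z\mathcal L^\Lambda_{r,2n}\|$ denote the maximum of $|\partial_p^w\mathcal L^\Lambda_{r,2n}|$ over all multi-indices $w$ in the independent momenta with $|w|=z$ and all independent momenta with $|p_i|\le\max\{2\Lambda,\mu\}$, $|p'_i|\le\max\{2\Lambda,M\}$. **Theorem 1.** Fix $K$ and $\kappa>0$. For all $r$, $n$ with $|n|\ge1$, and $z$ there is a real polynomial $\mathcal P$, depending only on $K,\kappa,r,n,z$, such that for all $0<m\le M\le\Lambda_0$, $0<\mu\le\kappa m$, all $\bar p'_i$ with $|\bar p'_i|=M$, all vertex functions as above, and all $0\le\Lambda\le\Lambda_0$: - if $n_2=0$: $\ \|\partial^z\mathcal L^\Lambda_{r,2n}\|\le(\Lambda+m)^{4-2n_1-z}\,\mathcal P\bigl(\log\tfrac{\Lambda+m}{m}\bigr)$; - if $n_2\ge1$ and $2|n|+z>4$: $\ \|\partial^z\mathcal L^\Lambda_{r,2n}\|\le(\Lambda+m)^{4-2|n|-z}\,\mathcal P\bigl(\log\tfrac{\Lambda+M}{m}\bigr)$; - if $n_2\ge1$ and $2|n|+z\le4$: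 $\ \|\partial^z\mathcal L^\Lambda_{r,2n}\|\le(\Lambda+M)^{4-2|n|-z}\,\mathcal P\bigl(\log\tfrac{\Lambda+M}{m}\bigr)$. -/

import Mathlib

open scoped ContDiff ENNReal

/-! Two real scalar fields in four Euclidean dimensions: a light field of mass `m`
and a heavy field of mass `M`, with `Z₂ × Z₂` symmetry. -/

noncomputable section

namespace TwoScalar

/-- Euclidean four-momenta. -/
abbrev Momentum : Type := EuclideanSpace ℝ (Fin 4)

/-- The independent momenta of a vertex with `2 * n₁` light and `2 * n₂` heavy legs.  The legs are
listed light ones first; the momentum of the last leg is minus the sum of all the others. -/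
abbrev Config (n₁ n₂ : ℕ) : Type := Fin (2 * n₁ + 2 * n₂ - 1) → Momentum

/-- A family of vertex functions: `L r n₁ n₂ Λ k` is the coefficient of `g₁^r₁ g₂^r₂ g₃^r₃` of the
vertex with `2 * n₁` light and `2 * n₂` heavy legs at scale `Λ` and independent momenta `k`. -/
abbrev VertexFamily : Type := (Fin 3 → ℕ) → (n₁ n₂ : ℕ) → ℝ → Config n₁ n₂ → ℝ

/-! ### Cutoffs and propagators -/

/-- The profile of the smooth cutoff, a function on `[0, ∞)`. -/
structure IsCutoffProfile (K : ℝ → ℝ) : Prop where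
  smooth : ContDiffOn ℝ ∞ K (Set.Ici 0)
  eq_one : ∀ a : ℝ, 0 ≤ a → a ≤ 1 → K a = 1
  eq_zero : ∀ a : ℝ, 4 ≤ a → K a = 0

/-- `R_m(Λ, p)`.  At `Λ = 0` it vanishes, because its first factor does. -/
def lightCutoff (K : ℝ → ℝ) (m Λ : ℝ) (p : Momentum) : ℝ :=
  (1 - K ((1 + Λ / m) ^ 2)) * K (‖p‖ ^ 2 / Λ ^ 2)

/-- `R_M(Λ, p)`.  It vanishes for `0 ≤ Λ ≤ M`. -/
def heavyCutoff (K : ℝ → ℝ) (M Λ : ℝ) (p : Momentum) : ℝ :=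
  (1 - K (Λ ^ 2 / M ^ 2)) * K (‖p‖ ^ 2 / Λ ^ 2)

/-- The light propagator with ultraviolet cutoff `Λ`. -/
def lightPropagator (K : ℝ → ℝ) (m Λ : ℝ) (p : Momentum) : ℝ :=
  lightCutoff K m Λ p / (‖p‖ ^ 2 + m ^ 2)

/-- The heavy propagator with ultraviolet cutoff `Λ`. -/
def heavyPropagator (K : ℝ → ℝ) (M Λ : ℝ) (p : Momentum) : ℝ :=
  heavyCutoff K M Λ p / (‖p‖ ^ 2 + M ^ 2)

/-- The derivative of the light propagator with respect to the scale. -/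
def lightDot (K : ℝ → ℝ) (m Λ : ℝ) (p : Momentum) : ℝ :=
  deriv (fun l : ℝ => lightPropagator K m l p) Λ

/-- The derivative of the heavy propagator with respect to the scale. -/
def heavyDot (K : ℝ → ℝ) (M Λ : ℝ) (p : Momentum) : ℝ :=
  deriv (fun l : ℝ => heavyPropagator K M l p) Λ

/-! ### Legs

The momenta of all light (heavy) legs are written as a sequence, of which only the first `2 * n₁`
(`2 * n₂`) terms matter; counting starts from `0`. -/

/-- The momentum of leg number `i`, the last leg being determined by momentum conservation. -/
def leg {n₁ n₂ : ℕ} (k : Config n₁ n₂) (i : ℕ) : Momentum :=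
  if h : i < 2 * n₁ + 2 * n₂ - 1 then k ⟨i, h⟩ else -∑ j, k j

/-- The momenta of the light legs. -/
def lightLegs {n₁ n₂ : ℕ} (k : Config n₁ n₂) : ℕ → Momentum := fun i => leg k i

/-- The momenta of the heavy legs. -/
def heavyLegs {n₁ n₂ : ℕ} (k : Config n₁ n₂) : ℕ → Momentum := fun i => leg k (2 * n₁ + i)

/-- The value of a vertex function at light momenta `p` and heavy momenta `q` (of total
momentum zero): the momentum of the last leg is dropped. -/
def atLegs {n₁ n₂ : ℕ} (F : Config n₁ n₂ → ℝ) (p q : ℕ → Momentum) : ℝ :=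
  F fun i => if (i : ℕ) < 2 * n₁ then p i else q (i - 2 * n₁)

/-- The first `N` terms of the sequence `p`, permuted by `σ`. -/
def permute {N : ℕ} (σ : Equiv.Perm (Fin N)) (p : ℕ → Momentum) : ℕ → Momentum :=
  fun i => if h : i < N then p (σ ⟨i, h⟩) else 0

/-- The sequence `p 0, …, p (N - 1), x, y`. -/
def snocTwo (N : ℕ) (p : ℕ → Momentum) (x y : Momentum) : ℕ → Momentum :=
  fun i => if i < N then p i else if i = N then x else y

/-- The sequence `p a, …, p (a + N - 1), x`. -/
def snocFrom (a N : ℕ) (p : ℕ → Momentum) (x : Momentum) : ℕ → Momentum :=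
  fun i => if i < N then p (a + i) else x

/-- Symmetrization in `2 * n₁` light and `2 * n₂` heavy momenta. -/
def symmetrize (n₁ n₂ : ℕ) (F : (ℕ → Momentum) → (ℕ → Momentum) → ℝ) (p q : ℕ → Momentum) : ℝ :=
  (∑ σ : Equiv.Perm (Fin (2 * n₁)), ∑ τ : Equiv.Perm (Fin (2 * n₂)),
      F (permute σ p) (permute τ q)) / ((2 * n₁).factorial * (2 * n₂).factorial)

/-! ### The flow hierarchy -/

/-- Two legs of a vertex joined by a light line: `∫ d⁴ℓ/(2π)⁴ ∂_Λ P_m(ℓ) L(p, ℓ, -ℓ; q)`. -/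
def lightLoop (K : ℝ → ℝ) (m : ℝ) (L : VertexFamily) (r : Fin 3 → ℕ) (n₁ n₂ : ℕ) (Λ : ℝ)
    (p q : ℕ → Momentum) : ℝ :=
  (∫ ℓ : Momentum, lightDot K m Λ ℓ *
    atLegs (L r (n₁ + 1) n₂ Λ) (snocTwo (2 * n₁) p ℓ (-ℓ)) q) / (2 * Real.pi) ^ 4

/-- Two legs of a vertex joined by a heavy line: `∫ d⁴ℓ/(2π)⁴ ∂_Λ P_M(ℓ) L(p; q, ℓ, -ℓ)`. -/
def heavyLoop (K : ℝ → ℝ) (M : ℝ) (L : VertexFamily) (r : Fin 3 → ℕ) (n₁ n₂ : ℕ) (Λ : ℝ)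
    (p q : ℕ → Momentum) : ℝ :=
  (∫ ℓ : Momentum, heavyDot K M Λ ℓ *
    atLegs (L r n₁ (n₂ + 1) Λ) p (snocTwo (2 * n₂) q ℓ (-ℓ))) / (2 * Real.pi) ^ 4

/-- A vertex with `2 * l₁` light and `2 * l₂` heavy legs and one with `2 * l₁'` light and `2 * l₂'`
heavy legs, joined by a light line (before symmetrization); the first vertex is of order `s` and
the second of order `t`.  The line carries the momentum `P` into the first vertex and `-P` into the
second one. -/
def lightTree (K : ℝ → ℝ) (m : ℝ) (L : VertexFamily) (s t : Fin 3 → ℕ) (l₁ l₁' l₂ l₂' : ℕ) (Λ : ℝ)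
    (p q : ℕ → Momentum) : ℝ :=
  let P : Momentum := -(∑ i ∈ Finset.range (2 * l₁ - 1), p i) - ∑ i ∈ Finset.range (2 * l₂), q i
  lightDot K m Λ P *
    atLegs (L s l₁ l₂ Λ) (snocFrom 0 (2 * l₁ - 1) p P) q *
    atLegs (L t l₁' l₂' Λ) (snocFrom (2 * l₁ - 1) (2 * l₁' - 1) p (-P)) (fun i => q (2 * l₂ + i))

/-- The same with a heavy line. -/
def heavyTree (K : ℝ → ℝ) (M : ℝ) (L : VertexFamily) (s t : Fin 3 → ℕ) (l₁ l₁' l₂ l₂' : ℕ) (Λ : ℝ)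
    (p q : ℕ → Momentum) : ℝ :=
  let P : Momentum := -(∑ i ∈ Finset.range (2 * l₁), p i) - ∑ i ∈ Finset.range (2 * l₂ - 1), q i
  heavyDot K M Λ P *
    atLegs (L s l₁ l₂ Λ) p (snocFrom 0 (2 * l₂ - 1) q P) *
    atLegs (L t l₁' l₂' Λ) (fun i => p (2 * l₁ + i)) (snocFrom (2 * l₂ - 1) (2 * l₂' - 1) q (-P))

/-- The right-hand side of the Wilson–Polchinski flow equation for the vertex with `2 * n₁` light
legs of momenta `p` and `2 * n₂` heavy legs of momenta `q`, at order `r`. -/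
def flowRHS (K : ℝ → ℝ) (m M : ℝ) (L : VertexFamily) (r : Fin 3 → ℕ) (n₁ n₂ : ℕ) (Λ : ℝ)
    (p q : ℕ → Momentum) : ℝ :=
  -((2 * n₁ + 2).choose 2 : ℝ) * lightLoop K m L r n₁ n₂ Λ p q
  + 2 * ∑ s ∈ Finset.Iic r, ∑ a ∈ Finset.HasAntidiagonal.antidiagonal (n₁ + 1),
      ∑ b ∈ Finset.HasAntidiagonal.antidiagonal n₂,
      (a.1 : ℝ) * a.2 * symmetrize n₁ n₂ (lightTree K m L s (r - s) a.1 a.2 b.1 b.2 Λ) p q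
  - ((2 * n₂ + 2).choose 2 : ℝ) * heavyLoop K M L r n₁ n₂ Λ p q
  + 2 * ∑ s ∈ Finset.Iic r, ∑ a ∈ Finset.HasAntidiagonal.antidiagonal n₁,
      ∑ b ∈ Finset.HasAntidiagonal.antidiagonal (n₂ + 1),
      (b.1 : ℝ) * b.2 * symmetrize n₁ n₂ (heavyTree K M L s (r - s) a.1 a.2 b.1 b.2 Λ) p q

/-- The vertices of the bare action
`∫ d⁴x [ρ₁/2 φ² + ρ₂/2 (∂φ)² + ρ₃/4! φ⁴ + ρ₄/2 ψ² + ρ₅/2 (∂ψ)² + ρ₆/4! ψ⁴ + ρ₇/4 φ²ψ²]`;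
here `ρ₁, …, ρ₇` are `ρ 0, …, ρ 6`. -/
def bareVertex (ρ : Fin 7 → ℝ) (n₁ n₂ : ℕ) (k : Config n₁ n₂) : ℝ :=
  if n₁ = 1 ∧ n₂ = 0 then ρ 0 / 2 + ρ 1 / 2 * ‖leg k 0‖ ^ 2
  else if n₁ = 2 ∧ n₂ = 0 then ρ 2 / 24
  else if n₁ = 0 ∧ n₂ = 1 then ρ 3 / 2 + ρ 4 / 2 * ‖leg k 0‖ ^ 2
  else if n₁ = 0 ∧ n₂ = 2 then ρ 5 / 24
  else if n₁ = 1 ∧ n₂ = 1 then ρ 6 / 4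
  else 0

/-- The renormalization conditions at `Λ = 0`: the light ones at zero momentum, the heavy ones at
the momenta `pbar 0, …, pbar 4`.  As a function of `p'` the heavy two-point vertex depends on
`‖p'‖ ^ 2` only, so its Hessian at `pbar 0` is a combination of `δ_{μν}` and of
`(pbar 0)_μ (pbar 0)_ν`; the condition is put on the `δ_{μν}` part, that is, on the directions
orthogonal to `pbar 0`. -/
structure RenormalizationConditions (pbar : Fin 5 → Momentum) (L : VertexFamily) : Prop where
  light_two : ∀ r, L r 1 0 0 0 = 0
  light_two_deriv : ∀ r, ∀ u v : Momentum,
    iteratedFDeriv ℝ 2 (L r 1 0 0) 0 ![fun _ => u, fun _ => v] = 0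
  light_four : ∀ r, L r 2 0 0 0 = if r = ![1, 0, 0] then 1 / 24 else 0
  heavy_two : ∀ r, L r 0 1 0 (fun _ => pbar 0) = 0
  heavy_two_deriv : ∀ r, ∀ u v : Momentum, inner ℝ u (pbar 0) = 0 → inner ℝ v (pbar 0) = 0 →
    iteratedFDeriv ℝ 2 (L r 0 1 0) (fun _ => pbar 0) ![fun _ => u, fun _ => v] = 0
  heavy_four : ∀ r, L r 0 2 0 ![pbar 1, pbar 2, pbar 3] = if r = ![0, 1, 0] then 1 / 24 else 0
  mixed_four : ∀ r, L r 1 1 0 ![0, 0, pbar 4] = if r = ![0, 0, 1] then 1 / 4 else 0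

/-- The perturbative vertex functions of the theory with ultraviolet cutoff `Λ₀`. -/
structure IsPerturbativeSolution (K : ℝ → ℝ) (m M Λ₀ : ℝ) (pbar : Fin 5 → Momentum)
    (L : VertexFamily) : Prop where
  /-- Smoothness in the scale and in the momenta. -/
  smooth : ∀ r n₁ n₂, 1 ≤ n₁ + n₂ →
    ContDiffOn ℝ ∞ (fun x : ℝ × Config n₁ n₂ => L r n₁ n₂ x.1 x.2) (Set.Icc 0 Λ₀ ×ˢ Set.univ)
  /-- Bose symmetry: all light legs, and all heavy legs, may be permuted. -/
  bose : ∀ r n₁ n₂, 1 ≤ n₁ + n₂ → ∀ Λ ∈ Set.Icc 0 Λ₀, ∀ k : Config n₁ n₂,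
    ∀ (σ : Equiv.Perm (Fin (2 * n₁))) (τ : Equiv.Perm (Fin (2 * n₂))),
      atLegs (L r n₁ n₂ Λ) (permute σ (lightLegs k)) (permute τ (heavyLegs k)) = L r n₁ n₂ Λ k
  /-- Only connected diagrams contribute at a given order. -/
  connected : ∀ r n₁ n₂, (∑ i, r i) + 1 < n₁ + n₂ → ∀ Λ ∈ Set.Icc 0 Λ₀, ∀ k : Config n₁ n₂,
    L r n₁ n₂ Λ k = 0
  /-- The flow equation. -/
  flow : ∀ r n₁ n₂, 1 ≤ n₁ + n₂ → ∀ Λ ∈ Set.Icc 0 Λ₀, ∀ k : Config n₁ n₂,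
    HasDerivWithinAt (fun l : ℝ => L r n₁ n₂ l k)
      (flowRHS K m M L r n₁ n₂ Λ (lightLegs k) (heavyLegs k)) (Set.Icc 0 Λ₀) Λ
  /-- At the ultraviolet cutoff the interaction is the bare one, for some bare couplings (which are
  formal power series in the renormalized couplings). -/
  bare : ∃ ρ : (Fin 3 → ℕ) → Fin 7 → ℝ, ∀ r n₁ n₂, 1 ≤ n₁ + n₂ → ∀ k : Config n₁ n₂,
    L r n₁ n₂ Λ₀ k = bareVertex (ρ r) n₁ n₂ k
  renormalized : RenormalizationConditions pbar L

/-! ### Norms -/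

/-- The partial derivative of order `z` of `F` with respect to the components
`(j 0).2, …, (j (z - 1)).2` of the independent momenta `(j 0).1, …, (j (z - 1)).1`. -/
def partialDeriv {n₁ n₂ : ℕ} (F : Config n₁ n₂ → ℝ) {z : ℕ}
    (j : Fin z → Fin (2 * n₁ + 2 * n₂ - 1) × Fin 4) (k : Config n₁ n₂) : ℝ :=
  iteratedFDeriv ℝ z F k fun s => Pi.single (j s).1 (EuclideanSpace.single (j s).2 (1 : ℝ))

/-- `‖∂^z F‖_{(a, b, b')}`: the maximum of all partial derivatives of order `z` over the independent
light momenta of norm at most `max a b` and the independent heavy momenta of norm at most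
`max a b'`. -/
def vertexNorm {n₁ n₂ : ℕ} (a b b' : ℝ) (z : ℕ) (F : Config n₁ n₂ → ℝ) : ℝ≥0∞ :=
  ⨆ (k : Config n₁ n₂)
    (_ : ∀ i, ‖k i‖ ≤ if (i : ℕ) < 2 * n₁ then max a b else max a b')
    (j : Fin z → Fin (2 * n₁ + 2 * n₂ - 1) × Fin 4), ENNReal.ofReal |partialDeriv F j k|

end TwoScalar

end

noncomputable section

namespace TwoScalar

open MeasureTheory Set

/-! ### Smooth functions of a parameter and a variable -/

/-! The estimates are power counting in the scale `Λ + m`, proved by induction along the flow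
hierarchy (`vertex_induction`): upwards in the order $|r|$ and, at fixed order, downwards in the
number of legs, connectedness supplying the start. The tree terms fit this scheme only if order-zero
vertices drop out, since the partner of such a vertex carries the full order $r$.
`Theory.free_eq_zero` shows that they vanish: at order zero the two-point functions satisfy a
Riccati equation in `Λ`, and the renormalization conditions force their bare couplings to be zero.

Given bounds for the earlier vertices, the right-hand side of the flow has order $3-2|n|$
(`isSymbol_flowRHS`): a differentiated propagator has order $-3$, and a loop integral runs over a
ball of radius $2\Lambda$, adding four powers. Positive powers of $\Lambda+M$ occur only in the
bound for the heavy two-point function. That vertex can be attached only to heavy lines, which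
vanish for $\Lambda<M$; for $\Lambda\ge M$ the scales $\Lambda+M$ and $\Lambda+m$, and the
logarithms built from them, are comparable.

The flow is then integrated. If $2|n|+z>4$, one starts at $\Lambda_0$, where the derivative of the
bare vertex is zero, and the integrand decays at least like $(\Lambda+m)^{-2}$ up to logarithms. If
$2|n|+z\le4$, one starts at $\Lambda=0$ at a single momentum configuration and spreads the bound
over the momentum region by the mean value theorem, using the derivative of order $z+1$; hence $z$
descends from 3. With heavy legs and $\Lambda<M$ the region can be far larger than $\Lambda+m$, so
this is done for $\Lambda\ge M$ first, and the flow is then integrated down from $M$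
(`HighVertexBound.vertexBound`); this produces the powers of $\Lambda+M$.

Most starting values come directly from the renormalization conditions. First derivatives vanish at
zero momentum by reflection symmetry. For the heavy Hessian, Euclidean invariance
(`Theory.isInvariant`) makes the Hessian at zero a multiple of the identity, so one direction
orthogonal to the renormalization point determines it. -/

theorem continuousOn_slice {X E F : Type*} [TopologicalSpace X] [TopologicalSpace E]
    [TopologicalSpace F] {A : Set X} {h : X → E → F}
    (hh : ContinuousOn (fun y : X × E => h y.1 y.2) (A ×ˢ univ)) (e : E) :
    ContinuousOn (fun x => h x e) A :=
  hh.comp (f := fun x : X => (x, e)) (by fun_prop) (fun _ hx => ⟨hx, mem_univ _⟩)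

/-- Compactness of `A` times a closed unit ball gives a constant dominating `f'`, so dominated
convergence applies. -/
theorem hasFDerivAt_setIntegral {X E F : Type*} [NormedAddCommGroup X]
    [NormedAddCommGroup E] [NormedSpace ℝ E] [NormedAddCommGroup F] [NormedSpace ℝ F]
    [MeasurableSpace X] [BorelSpace X] [ProperSpace E] [SecondCountableTopology X] {μ : Measure X} {A : Set X}
    (hA : IsCompact A)    (hμ : μ A ≠ ⊤) {f : X → E → F} {f' : X → E → E →L[ℝ] F}
    (hf : ContinuousOn (fun y : X × E => f y.1 y.2) (A ×ˢ univ))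
    (hf' : ContinuousOn (fun y : X × E => f' y.1 y.2) (A ×ˢ univ))
    (hd : ∀ x ∈ A, ∀ e, HasFDerivAt (f x) (f' x e) e) (e₀ : E) :
    HasFDerivAt (fun e => ∫ x in A, f x e ∂μ) (∫ x in A, f' x e₀ ∂μ) e₀ := by
  have hAm : MeasurableSet A := hA.isClosed.measurableSet
  obtain ⟨C, hC⟩ := (hA.prod (isCompact_closedBall e₀ 1)).exists_bound_of_continuousOn
    (hf'.mono (prod_mono_right (subset_univ _)))
  have : IsFiniteMeasure (μ.restrict A) := ⟨by simpa using hμ.lt_top⟩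
  obtain ⟨C₁, hC₁⟩ := hA.exists_bound_of_continuousOn (continuousOn_slice hf e₀)
  refine hasFDerivAt_integral_of_dominated_of_fderiv_le (F := fun e x => f x e)
    (F' := fun e x => f' x e) (bound := fun _ => C)
    (Metric.closedBall_mem_nhds e₀ one_pos) ?_ ?_ ?_ ?_ ?_ ?_
  · exact Filter.Eventually.of_forall fun e => (continuousOn_slice hf e).aestronglyMeasurable hAm
  · exact Integrable.of_bound ((continuousOn_slice hf e₀).aestronglyMeasurable hAm) C₁
      ((ae_restrict_iff' hAm).2 (Filter.Eventually.of_forall hC₁))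
  · exact (continuousOn_slice hf' e₀).aestronglyMeasurable hAm
  · exact (ae_restrict_iff' hAm).2 (Filter.Eventually.of_forall fun x hx e he => hC (x, e) ⟨hx, he⟩)
  · exact integrable_const C
  · exact (ae_restrict_iff' hAm).2 (Filter.Eventually.of_forall fun x hx e he => hd x hx e)

section Parametric

variable {X E F : Type*} [NormedAddCommGroup X] [NormedSpace ℝ X] [NormedAddCommGroup E]
  [NormedSpace ℝ E] [NormedAddCommGroup F] [NormedSpace ℝ F]

theorem hasFDerivAt_partial {S : Set X} {g : X → E → F}
    (hg : ContDiffOn ℝ ∞ (fun y : X × E => g y.1 y.2) (S ×ˢ univ)) {x : X} (hx : x ∈ S) (e : E) :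
    HasFDerivAt (g x) ((fderivWithin ℝ (fun y : X × E => g y.1 y.2) (S ×ˢ univ) (x, e)).comp
      (ContinuousLinearMap.inr ℝ X E)) e := by
  have h1 := ((hg.differentiableOn (by simp)) (x, e) ⟨hx, mem_univ _⟩).hasFDerivWithinAt
  have h2 : HasFDerivWithinAt (fun e : E => (x, e)) (ContinuousLinearMap.inr ℝ X E) univ e :=
    (hasFDerivAt_prodMk_right x e).hasFDerivWithinAt
  have h3 := h1.comp e h2 (fun e' _ => ⟨hx, mem_univ _⟩)
  exact h3.hasFDerivAt (by simp)

theorem contDiff_partial {S : Set X} {g : X → E → F}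
    (hg : ContDiffOn ℝ ∞ (fun y : X × E => g y.1 y.2) (S ×ˢ univ)) {x : X} (hx : x ∈ S) :
    ContDiff ℝ ∞ (g x) := by
  have : ContDiffOn ℝ ∞ (fun e : E => g x e) univ :=
    hg.comp (f := fun e : E => (x, e)) (by fun_prop) (fun e _ => ⟨hx, mem_univ _⟩)
  exact contDiffOn_univ.1 this

/-- The partial derivative is the total derivative within `S ×ˢ univ`, restricted to the second
factor; unique differentiability of `S` makes it smooth up to the boundary. -/
theorem contDiffOn_fderiv_partial {S : Set X} (hS : UniqueDiffOn ℝ S) {g : X → E → F}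
    (hg : ContDiffOn ℝ ∞ (fun y : X × E => g y.1 y.2) (S ×ˢ univ)) :
    ContDiffOn ℝ ∞ (fun y : X × E => fderiv ℝ (g y.1) y.2) (S ×ˢ univ) := by
  have h1 : ContDiffOn ℝ ∞ (fderivWithin ℝ (fun y : X × E => g y.1 y.2) (S ×ˢ univ))
      (S ×ˢ univ) := hg.fderivWithin (hS.prod uniqueDiffOn_univ) (by simp)
  have h2 := h1.clm_comp (contDiffOn_const (c := ContinuousLinearMap.inr ℝ X E))
  refine h2.congr ?_
  rintro ⟨x, e⟩ ⟨hx, -⟩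
  exact (hasFDerivAt_partial hg hx e).fderiv

theorem contDiffOn_iteratedFDeriv_partial {S : Set X} (hS : UniqueDiffOn ℝ S) {g : X → E → F}
    (hg : ContDiffOn ℝ ∞ (fun y : X × E => g y.1 y.2) (S ×ˢ univ)) (n : ℕ) :
    ContDiffOn ℝ ∞ (fun y : X × E => iteratedFDeriv ℝ n (g y.1) y.2) (S ×ˢ univ) := by
  induction n with
  | zero =>
    simp only [iteratedFDeriv_zero_eq_comp, Function.comp_def]
    exact (LinearIsometryEquiv.contDiff _).comp_contDiffOn hg
  | succ n ih =>
    simp only [iteratedFDeriv_succ_eq_comp_left, Function.comp_def]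
    exact (LinearIsometryEquiv.contDiff _).comp_contDiffOn
      (contDiffOn_fderiv_partial hS (g := fun x => iteratedFDeriv ℝ n (g x)) ih)

variable [MeasurableSpace X] [BorelSpace X]

/-- The set `S` is kept apart from `A` to serve two uses: loop integrals, where `S` is all of
momentum space, and scale integrals, where smoothness holds only on the closed interval up to the
ultraviolet cutoff. -/
theorem iteratedFDeriv_setIntegral [ProperSpace E] [CompleteSpace F] [SecondCountableTopology X]
    {S : Set X} (hS : UniqueDiffOn ℝ S)
    {μ : Measure X} {A : Set X} (hA : IsCompact A) (hAS : A ⊆ S) (hμ : μ A ≠ ⊤) {f : X → E → F}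
    (hf : ContDiffOn ℝ ∞ (fun y : X × E => f y.1 y.2) (S ×ˢ univ)) :
    ContDiff ℝ ∞ (fun e => ∫ x in A, f x e ∂μ) ∧ ∀ n e,
      iteratedFDeriv ℝ n (fun e => ∫ x in A, f x e ∂μ) e =
        ∫ x in A, iteratedFDeriv ℝ n (f x) e ∂μ := by
  have hc := fun n => ((contDiffOn_iteratedFDeriv_partial hS hf n).continuousOn).mono
    (prod_mono_left (t := univ) hAS)
  have hstep : ∀ n e, HasFDerivAt (fun e => ∫ x in A, iteratedFDeriv ℝ n (f x) e ∂μ)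
      (∫ x in A, fderiv ℝ (iteratedFDeriv ℝ n (f x)) e ∂μ) e := by
    intro n e
    refine hasFDerivAt_setIntegral hA hμ (hc n) (f' := fun x => fderiv ℝ (iteratedFDeriv ℝ n (f x)))
      ((contDiffOn_fderiv_partial hS (g := fun x => iteratedFDeriv ℝ n (f x))
        (contDiffOn_iteratedFDeriv_partial hS hf n)).continuousOn.mono
        (prod_mono_left hAS)) ?_ e
    intro x hx e
    exact (((contDiff_partial hf (hAS hx)).differentiable_iteratedFDeriv
      (m := n) (by exact_mod_cast WithTop.coe_lt_top n)) e).hasFDerivAt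
  have key : ∀ n, iteratedFDeriv ℝ n (fun e => ∫ x in A, f x e ∂μ) =
        fun e => ∫ x in A, iteratedFDeriv ℝ n (f x) e ∂μ := by
    intro n
    induction n with
    | zero =>
      funext e
      simp only [iteratedFDeriv_zero_eq_comp, Function.comp_def]
      exact ((continuousMultilinearCurryFin0 ℝ E F).symm.toContinuousLinearEquiv.integral_comp_comm
        (fun x => f x e)).symm
    | succ n ih =>
      funext e
      simp only [iteratedFDeriv_succ_eq_comp_left, Function.comp_def]
      rw [ih, (hstep n e).fderiv]
      exact (ContinuousLinearEquiv.integral_comp_comm (𝕜 := ℝ) (E := E →L[ℝ] E [×n]→L[ℝ] F)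
        (F := E [×(n + 1)]→L[ℝ] F) (μ := μ.restrict A)
        (continuousMultilinearCurryLeftEquiv ℝ (fun _ : Fin (n + 1) => E)
          F).symm.toContinuousLinearEquiv (fun x => fderiv ℝ (iteratedFDeriv ℝ n (f x)) e)).symm
  refine ⟨contDiff_of_differentiable_iteratedFDeriv fun n _ => ?_, fun n e => by rw [key]⟩
  rw [key]
  exact fun e => (hstep n e).differentiableAt

end Parametric

theorem iteratedFDeriv_const_mul {E : Type*} [NormedAddCommGroup E] [NormedSpace ℝ E] {f : E → ℝ}
    (hf : ContDiff ℝ ∞ f) (s : ℝ) (n : ℕ) (x : E) :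
    iteratedFDeriv ℝ n (fun y => s * f y) x = s • iteratedFDeriv ℝ n f x :=
  iteratedFDeriv_const_smul_apply (a := s) (hf.of_le (by exact_mod_cast le_top)).contDiffAt

theorem norm_iteratedFDeriv_comp_clm_add_le {E E' F : Type*} [NormedAddCommGroup E]
    [NormedSpace ℝ E] [NormedAddCommGroup E'] [NormedSpace ℝ E'] [NormedAddCommGroup F]
    [NormedSpace ℝ F] {f : E' → F} (hf : ContDiff ℝ ∞ f) (T : E →L[ℝ] E') (c : E') (n : ℕ) (x : E) :
    ‖iteratedFDeriv ℝ n (fun y => f (T y + c)) x‖ ≤ ‖iteratedFDeriv ℝ n f (T x + c)‖ * ‖T‖ ^ n := by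
  have h : (fun y => f (T y + c)) = (fun z => f (z + c)) ∘ T := rfl
  have h' : ContDiff ℝ ∞ fun z => f (z + c) := hf.comp (contDiff_id.add contDiff_const)
  rw [h, T.iteratedFDeriv_comp_right h' x
    (by exact_mod_cast le_top), iteratedFDeriv_comp_add_right]
  refine (ContinuousMultilinearMap.norm_compContinuousLinearMap_le _ _).trans ?_
  simp

/-! ### Propagators -/

theorem exists_bound_iteratedFDeriv_of_support {E F : Type*} [NormedAddCommGroup E]
    [NormedSpace ℝ E] [ProperSpace E] [NormedAddCommGroup F] [NormedSpace ℝ F] {φ : ℝ → E → F}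
    (hφ : ContDiff ℝ ∞ fun y : ℝ × E => φ y.1 y.2) {R : ℝ} (h0 : ∀ t x, R < ‖x‖ → φ t x = 0)
    (b : ℝ) (n : ℕ) : ∃ A, 0 ≤ A ∧ ∀ t, 0 ≤ t → t ≤ b → ∀ x, ‖iteratedFDeriv ℝ n (φ t) x‖ ≤ A := by
  have hc := (contDiffOn_iteratedFDeriv_partial (S := univ) uniqueDiffOn_univ (g := φ)
    hφ.contDiffOn n).continuousOn
  obtain ⟨A, hA⟩ := ((isCompact_Icc (a := 0) (b := b)).prod
    (isCompact_closedBall (0 : E) R)).exists_bound_of_continuousOn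
    (hc.mono (prod_mono (subset_univ _) (subset_univ _)))
  refine ⟨max A 0, le_max_right _ _, fun t h1 h2 x => ?_⟩
  by_cases hx : R < ‖x‖
  · have : φ t =ᶠ[nhds x] fun _ => 0 := by
      filter_upwards [(isOpen_lt continuous_const continuous_norm).mem_nhds hx] with y hy
      exact h0 t y hy
    rw [(this.iteratedFDeriv ℝ n).eq_of_nhds, iteratedFDeriv_fun_zero]
    simp
  · exact (hA (t, x) ⟨⟨h1, h2⟩, by simpa using hx⟩).trans (le_max_left _ _)

/-- A smooth function vanishing on the negative half-line is flat at zero; the induction passes to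
its derivative. The powers of `t = Λ / a` absorb the factors $\Lambda^{-1}$ that momentum
derivatives produce when the scale is far below the mass. -/
theorem flat_bound {c : ℝ → ℝ} (hc : ContDiff ℝ ∞ c) (h0 : ∀ t ≤ 0, c t = 0) (b : ℝ) (N : ℕ) :
    ∃ A, 0 ≤ A ∧ ∀ t, 0 ≤ t → t ≤ b → |c t| ≤ A * t ^ N := by
  induction N generalizing c with
  | zero =>
    obtain ⟨A, hA⟩ := (isCompact_Icc (a := 0) (b := b)).exists_bound_of_continuousOn
      hc.continuous.continuousOn
    exact ⟨max A 0, le_max_right _ _, fun t h1 h2 => by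
      simpa using Or.inl (hA t ⟨h1, h2⟩)⟩
  | succ N ih =>
    have h0' : ∀ t < 0, deriv c t = 0 := by
      intro t ht
      have : c =ᶠ[nhds t] fun _ => 0 := by
        filter_upwards [gt_mem_nhds ht] with s hs using h0 s hs.le
      rw [this.deriv_eq]; simp
    have hd : ContDiff ℝ ∞ (deriv c) := (contDiff_infty_iff_deriv.1 hc).2
    have h0'' : ∀ t ≤ 0, deriv c t = 0 := by
      intro t ht
      have hcl : closure (Iio (0 : ℝ)) ⊆ {t | deriv c t = 0} :=
        closure_minimal h0' (isClosed_eq hd.continuous continuous_const)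
      rw [closure_Iio] at hcl
      exact hcl ht
    obtain ⟨A, hA, h⟩ := ih hd h0''
    refine ⟨A, hA, fun t h1 h2 => ?_⟩
    have := (convex_Icc 0 t).norm_image_sub_le_of_norm_deriv_le (f := c) (C := A * t ^ N)
      (fun s _ => (hc.differentiable (by simp)) s) (fun s hs => (h s hs.1 (hs.2.trans h2)).trans
        (by gcongr; exacts [hs.1, hs.2])) (left_mem_Icc.2 h1) (right_mem_Icc.2 h1)
    rw [h0 0 le_rfl] at this
    simpa [abs_of_nonneg h1, pow_succ, mul_assoc] using this

/-- The cutoff profile, extended to the whole line. -/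
def extProfile (K : ℝ → ℝ) (a : ℝ) : ℝ := if a < 0 then 1 else K a

/-! ### Cutoff profile, switches and scale derivatives of propagators -/

section Profile

variable {K : ℝ → ℝ}

theorem extProfile_of_nonneg {a : ℝ} (ha : 0 ≤ a) : extProfile K a = K a := if_neg ha.not_gt

theorem extProfile_eq_one (hK : IsCutoffProfile K) {a : ℝ} (ha : a ≤ 1) : extProfile K a = 1 := by
  unfold extProfile
  split_ifs with h
  · rfl
  · exact hK.eq_one a (not_lt.1 h) ha

theorem extProfile_eq_zero (hK : IsCutoffProfile K) {a : ℝ} (ha : 4 ≤ a) : extProfile K a = 0 := by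
  rw [extProfile_of_nonneg (by linarith), hK.eq_zero a ha]

theorem contDiff_extProfile (hK : IsCutoffProfile K) : ContDiff ℝ ∞ (extProfile K) := by
  rw [contDiff_iff_contDiffAt]
  intro a
  rcases lt_or_ge a 1 with h | h
  · refine (contDiffAt_const (c := (1 : ℝ))).congr_of_eventuallyEq ?_
    filter_upwards [gt_mem_nhds h] with s hs using extProfile_eq_one hK hs.le
  · refine (hK.smooth.contDiffAt (Ici_mem_nhds (by linarith))).congr_of_eventuallyEq ?_
    filter_upwards [lt_mem_nhds (show 0 < a by linarith)] with s hs using extProfile_of_nonneg hs.le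

theorem contDiff_deriv_extProfile (hK : IsCutoffProfile K) :
    ContDiff ℝ ∞ (deriv (extProfile K)) := (contDiff_infty_iff_deriv.1 (contDiff_extProfile hK)).2

theorem deriv_extProfile_of_lt (hK : IsCutoffProfile K) {a : ℝ} (ha : a < 1) :
    deriv (extProfile K) a = 0 := by
  have : extProfile K =ᶠ[nhds a] fun _ => 1 := by
    filter_upwards [gt_mem_nhds ha] with s hs using extProfile_eq_one hK hs.le
  rw [this.deriv_eq]; simp

theorem deriv_extProfile_of_gt (hK : IsCutoffProfile K) {a : ℝ} (ha : 4 < a) :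
    deriv (extProfile K) a = 0 := by
  have : extProfile K =ᶠ[nhds a] fun _ => 0 := by
    filter_upwards [lt_mem_nhds ha] with s hs using extProfile_eq_zero hK hs.le
  rw [this.deriv_eq]; simp

theorem exists_bound_extProfile (hK : IsCutoffProfile K) :
    ∃ B, 0 ≤ B ∧ ∀ a, |extProfile K a| ≤ B := by
  obtain ⟨B, hB⟩ := (isCompact_Icc (a := 0) (b := 4)).exists_bound_of_continuousOn
      (contDiff_extProfile hK).continuous.continuousOn
  refine ⟨max B 1, by positivity, fun a => ?_⟩
  rcases lt_or_ge a 0 with h | h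
  · rw [extProfile_eq_one hK (by linarith)]; simp
  rcases le_or_gt a 4 with h' | h'
  · exact (hB a ⟨h, h'⟩).trans (le_max_left _ _)
  · rw [extProfile_eq_zero hK h'.le]; simp

/-- A smooth function increasing the cutoff from nothing to its full strength. -/
structure IsSwitch (c : ℝ → ℝ) : Prop where
  smooth : ContDiff ℝ ∞ c
  eq_zero : ∀ t ≤ 0, c t = 0
  eq_one : ∀ t, 2 ≤ t → c t = 1

/-- The switch of the light field. -/
def lightSwitch (K : ℝ → ℝ) (t : ℝ) : ℝ := if t ≤ 0 then 0 else 1 - extProfile K ((1 + t) ^ 2)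

/-- The switch of the heavy field. -/
def heavySwitch (K : ℝ → ℝ) (t : ℝ) : ℝ := if t ≤ 0 then 0 else 1 - extProfile K (t ^ 2)

theorem heavySwitch_eq_zero (hK : IsCutoffProfile K) {t : ℝ} (ht : t ≤ 1) : heavySwitch K t = 0 := by
  unfold heavySwitch
  split_ifs with h
  · rfl
  · rw [extProfile_eq_one hK (by nlinarith)]; simp

theorem isSwitch_light (hK : IsCutoffProfile K) : IsSwitch (lightSwitch K) := by
  refine ⟨?_, fun t ht => if_pos ht, fun t ht => ?_⟩
  · rw [contDiff_iff_contDiffAt]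
    intro a
    rcases lt_or_ge a 0 with h | h
    · refine (contDiffAt_const (c := (0 : ℝ))).congr_of_eventuallyEq ?_
      filter_upwards [gt_mem_nhds h] with s hs using if_pos hs.le
    · have h1 : ContDiff ℝ ∞ fun t : ℝ => 1 - extProfile K ((1 + t) ^ 2) :=
        contDiff_const.sub ((contDiff_extProfile hK).comp (by fun_prop))
      refine h1.contDiffAt.congr_of_eventuallyEq ?_
      filter_upwards [lt_mem_nhds (show -1 < a by linarith)] with s hs
      unfold lightSwitch
      split_ifs with h'
      · rw [extProfile_eq_one hK (by nlinarith)]; simp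
      · rfl
  · unfold lightSwitch
    rw [if_neg (by linarith), extProfile_eq_zero hK (by nlinarith)]; simp

theorem isSwitch_heavy (hK : IsCutoffProfile K) : IsSwitch (heavySwitch K) := by
  refine ⟨?_, fun t ht => if_pos ht, fun t ht => ?_⟩
  · rw [contDiff_iff_contDiffAt]
    intro a
    rcases lt_or_ge a 1 with h | h
    · refine (contDiffAt_const (c := (0 : ℝ))).congr_of_eventuallyEq ?_
      filter_upwards [gt_mem_nhds h] with s hs using heavySwitch_eq_zero hK hs.le
    · have h1 : ContDiff ℝ ∞ fun t : ℝ => 1 - extProfile K (t ^ 2) :=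
        contDiff_const.sub ((contDiff_extProfile hK).comp (by fun_prop))
      refine h1.contDiffAt.congr_of_eventuallyEq ?_
      filter_upwards [lt_mem_nhds (show 0 < a by linarith)] with s hs using if_neg hs.not_ge
  · unfold heavySwitch
    rw [if_neg (by linarith), extProfile_eq_zero hK (by nlinarith)]; simp

/-- The propagator of mass `a` with switch `c`. -/
def propagator (K c : ℝ → ℝ) (a Λ : ℝ) (p : Momentum) : ℝ :=
  c (Λ / a) * extProfile K (‖p‖ ^ 2 / Λ ^ 2) / (‖p‖ ^ 2 + a ^ 2)

/-- The scale derivative of `propagator`. -/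
def propagatorDot (K c : ℝ → ℝ) (a Λ : ℝ) (p : Momentum) : ℝ :=
  (deriv c (Λ / a) / a * extProfile K (‖p‖ ^ 2 / Λ ^ 2) +
    c (Λ / a) * (deriv (extProfile K) (‖p‖ ^ 2 / Λ ^ 2) * (-2 * ‖p‖ ^ 2 / Λ ^ 3))) /
    (‖p‖ ^ 2 + a ^ 2)

theorem hasDerivAt_propagator (hK : IsCutoffProfile K) {c : ℝ → ℝ} (hc : IsSwitch c) {a Λ : ℝ}
    (hΛ : 0 < Λ) (p : Momentum) :
    HasDerivAt (fun l => propagator K c a l p) (propagatorDot K c a Λ p) Λ := by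
  have h1 : HasDerivAt (fun l => c (l / a)) (deriv c (Λ / a) * (1 / a)) Λ :=
    HasDerivAt.comp Λ ((hc.smooth.differentiable (by simp)) (Λ / a)).hasDerivAt
      ((hasDerivAt_id Λ).div_const a)
  have h2 : HasDerivAt (fun l : ℝ => ‖p‖ ^ 2 / l ^ 2) (-2 * ‖p‖ ^ 2 / Λ ^ 3) Λ := by
    have := ((hasDerivAt_pow 2 Λ).inv (by positivity)).const_mul (‖p‖ ^ 2)
    refine (this.congr_deriv ?_).congr_of_eventuallyEq ?_
    · field_simp; norm_num; ring
    · exact Filter.Eventually.of_forall fun l => by simp [div_eq_mul_inv]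
  have h3 : HasDerivAt (fun l => extProfile K (‖p‖ ^ 2 / l ^ 2))
      (deriv (extProfile K) (‖p‖ ^ 2 / Λ ^ 2) * (-2 * ‖p‖ ^ 2 / Λ ^ 3)) Λ :=
    HasDerivAt.comp Λ (((contDiff_extProfile hK).differentiable (by simp)) _).hasDerivAt h2
  refine ((h1.mul h3).div_const (‖p‖ ^ 2 + a ^ 2)).congr_deriv ?_
  unfold propagatorDot
  ring

theorem lightPropagator_eq (hK : IsCutoffProfile K) {m Λ : ℝ} (hm : 0 < m) (hΛ : 0 ≤ Λ)
    (p : Momentum) : lightPropagator K m Λ p = propagator K (lightSwitch K) m Λ p := by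
  unfold lightPropagator lightCutoff propagator lightSwitch
  rw [extProfile_of_nonneg (by positivity), extProfile_of_nonneg (by positivity)]
  split_ifs with h
  · have : Λ = 0 := by
      rcases hΛ.eq_or_lt with h' | h'
      · exact h'.symm
      · exact absurd h (not_le.2 (by positivity))
    subst this
    rw [hK.eq_one _ (by positivity) (by simp)]; simp
  · rfl

theorem heavyPropagator_eq (hK : IsCutoffProfile K) {M Λ : ℝ} (hM : 0 < M) (hΛ : 0 ≤ Λ)
    (p : Momentum) : heavyPropagator K M Λ p = propagator K (heavySwitch K) M Λ p := by
  unfold heavyPropagator heavyCutoff propagator heavySwitch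
  rw [extProfile_of_nonneg (by positivity), extProfile_of_nonneg (by positivity), div_pow]
  split_ifs with h
  · have : Λ = 0 := by
      rcases hΛ.eq_or_lt with h' | h'
      · exact h'.symm
      · exact absurd h (not_le.2 (by positivity))
    subst this
    rw [hK.eq_one _ (by positivity) (by simp)]; simp
  · rfl

theorem lightDot_eq (hK : IsCutoffProfile K) {m Λ : ℝ} (hm : 0 < m) (hΛ : 0 < Λ) :
    lightDot K m Λ = propagatorDot K (lightSwitch K) m Λ := by
  funext p
  have : (fun l => lightPropagator K m l p) =ᶠ[nhds Λ] fun l => propagator K (lightSwitch K) m l p := by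
    filter_upwards [lt_mem_nhds hΛ] with l hl using lightPropagator_eq hK hm hl.le p
  rw [lightDot, this.deriv_eq, (hasDerivAt_propagator hK (isSwitch_light hK) hΛ p).deriv]

theorem heavyDot_eq (hK : IsCutoffProfile K) {M Λ : ℝ} (hM : 0 < M) (hΛ : 0 < Λ) :
    heavyDot K M Λ = propagatorDot K (heavySwitch K) M Λ := by
  funext p
  have : (fun l => heavyPropagator K M l p) =ᶠ[nhds Λ] fun l => propagator K (heavySwitch K) M l p := by
    filter_upwards [lt_mem_nhds hΛ] with l hl using heavyPropagator_eq hK hM hl.le p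
  rw [heavyDot, this.deriv_eq, (hasDerivAt_propagator hK (isSwitch_heavy hK) hΛ p).deriv]

theorem heavyDot_eq_zero (hK : IsCutoffProfile K) {M Λ : ℝ} (hΛ : 0 < Λ)
    (h : Λ < M) : heavyDot K M Λ = 0 := by
  funext p
  have hM := hΛ.trans h
  rw [heavyDot_eq hK hM hΛ, propagatorDot]
  have h1 : Λ / M < 1 := (div_lt_one hM).2 h
  have : heavySwitch K =ᶠ[nhds (Λ / M)] fun _ => 0 := by
    filter_upwards [gt_mem_nhds h1] with s hs using heavySwitch_eq_zero hK hs.le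
  rw [this.deriv_eq, heavySwitch_eq_zero hK h1.le]
  simp

theorem propagatorDot_eq_zero (hK : IsCutoffProfile K) {c : ℝ → ℝ} {a Λ : ℝ} (hΛ : 0 < Λ)
    {p : Momentum} (hp : 2 * Λ < ‖p‖) : propagatorDot K c a Λ p = 0 := by
  have : 4 < ‖p‖ ^ 2 / Λ ^ 2 := by rw [lt_div_iff₀ (by positivity)]; nlinarith
  rw [propagatorDot, extProfile_eq_zero hK this.le, deriv_extProfile_of_gt hK this]
  simp

theorem contDiff_propagatorDot (hK : IsCutoffProfile K) {c : ℝ → ℝ} {a Λ : ℝ} (ha : 0 < a) :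
    ContDiff ℝ ∞ (propagatorDot K c a Λ) := by
  have h1 := contDiff_extProfile hK
  have h2 := contDiff_deriv_extProfile hK
  have h3 : ContDiff ℝ ∞ fun p : Momentum => ‖p‖ ^ 2 := contDiff_norm_sq ℝ
  unfold propagatorDot
  refine ContDiff.div ?_ (h3.add contDiff_const) (fun p => by positivity)
  exact (contDiff_const.mul (h1.comp (h3.div_const _))).add
    (contDiff_const.mul ((h2.comp (h3.div_const _)).mul ((contDiff_const.mul h3).div_const _)))

theorem zpow_neg_three_sub (x : ℝ) (z : ℕ) : x ^ (-3 - z : ℤ) = x⁻¹ ^ 3 * x⁻¹ ^ z := by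
  rw [← pow_add, inv_pow, ← zpow_natCast, ← zpow_neg]
  congr 1
  push_cast
  ring

/-- The scale derivative of a propagator has as many inverse powers of `Λ + a` as its dimension
tells, also after differentiation in the momentum. -/
theorem exists_bound_propagatorDot (hK : IsCutoffProfile K) {c : ℝ → ℝ} (hc : IsSwitch c) (z : ℕ) :
    ∃ A, 0 ≤ A ∧ ∀ a Λ : ℝ, 0 < a → 0 < Λ → ∀ p,
      ‖iteratedFDeriv ℝ z (propagatorDot K c a Λ) p‖ ≤ A * (Λ + a) ^ (-3 - z : ℤ) := by
  have k1 := contDiff_extProfile hK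
  have k2 := contDiff_deriv_extProfile hK
  have k3 : ContDiff ℝ ∞ fun y : ℝ × Momentum => ‖y.2‖ ^ 2 := contDiff_snd.norm_sq ℝ
  have k4 : ContDiff ℝ ∞ fun y : ℝ × Momentum => y.1 ^ 2 := contDiff_fst.pow 2
  have k5 : ContDiff ℝ ∞ fun y : ℝ × Momentum => y.1 ^ 2 * ‖y.2‖ ^ 2 + 1 :=
    (k4.mul k3).add contDiff_const
  have big : ∀ x : Momentum, 2 < ‖x‖ → 4 < ‖x‖ ^ 2 := fun x hx => by nlinarith
  -- In the variable `x = p / Λ` all supports lie in a fixed ball. For `Λ ≤ 2 * a` the units are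
  -- those of `a`, with parameter `t = Λ / a`, giving `φ₁` and `φ₂`; for larger scales they are
  -- those of `Λ`, with parameter `e = a / Λ`, giving `h`.
  let φ₁ : ℝ → Momentum → ℝ := fun t x => extProfile K (‖x‖ ^ 2) / (t ^ 2 * ‖x‖ ^ 2 + 1)
  let φ₂ : ℝ → Momentum → ℝ := fun t x =>
    -2 * ‖x‖ ^ 2 * deriv (extProfile K) (‖x‖ ^ 2) / (t ^ 2 * ‖x‖ ^ 2 + 1)
  let h : ℝ → Momentum → ℝ := fun e x =>
    -2 * ‖x‖ ^ 2 * deriv (extProfile K) (‖x‖ ^ 2) / (‖x‖ ^ 2 + e ^ 2)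
  have s₁ : ContDiff ℝ ∞ fun y : ℝ × Momentum => φ₁ y.1 y.2 :=
    (k1.comp k3).div k5 fun y => by positivity
  have s₂ : ContDiff ℝ ∞ fun y : ℝ × Momentum => φ₂ y.1 y.2 :=
    ((contDiff_const.mul k3).mul (k2.comp k3)).div k5 fun y => by positivity
  have s₃ : ContDiff ℝ ∞ fun y : ℝ × Momentum => h y.1 y.2 := by
    rw [contDiff_iff_contDiffAt]
    intro y
    -- The denominator vanishes only at `x = 0`, `e = 0`, and there the derivative of the profile is
    -- zero in a whole neighbourhood.
    rcases lt_or_ge (‖y.2‖ ^ 2) 1 with hy | hy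
    · refine (contDiffAt_const (c := (0 : ℝ))).congr_of_eventuallyEq ?_
      filter_upwards [(isOpen_lt k3.continuous continuous_const).mem_nhds hy] with w hw
      simp only [h]
      rw [deriv_extProfile_of_lt hK hw]; simp
    · exact (((contDiff_const.mul k3).mul (k2.comp k3)).contDiffAt).div
        ((k3.add k4).contDiffAt) (by positivity)
  obtain ⟨A₁, hA₁, b₁⟩ := exists_bound_iteratedFDeriv_of_support s₁ (R := 2)
    (fun t x hx => by simp only [φ₁]; rw [extProfile_eq_zero hK (big x hx).le]; simp) 2 z
  obtain ⟨A₂, hA₂, b₂⟩ := exists_bound_iteratedFDeriv_of_support s₂ (R := 2)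
    (fun t x hx => by simp only [φ₂]; rw [deriv_extProfile_of_gt hK (big x hx)]; simp) 2 z
  obtain ⟨A₃, hA₃, b₃⟩ := exists_bound_iteratedFDeriv_of_support s₃ (R := 2)
    (fun t x hx => by simp only [h]; rw [deriv_extProfile_of_gt hK (big x hx)]; simp) 1 z
  obtain ⟨B₁, hB₁, f₁⟩ := flat_bound (contDiff_infty_iff_deriv.1 hc.smooth).2 (fun t ht => by
    have hcl : closure (Iio (0 : ℝ)) ⊆ {t | deriv c t = 0} := by
      refine closure_minimal (fun t (ht : t < 0) => ?_)
        (isClosed_eq (contDiff_infty_iff_deriv.1 hc.smooth).2.continuous continuous_const)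
      have : c =ᶠ[nhds t] fun _ => 0 := by
        filter_upwards [gt_mem_nhds ht] with s hs using hc.eq_zero s hs.le
      simp [this.deriv_eq]
    rw [closure_Iio] at hcl
    exact hcl ht) 2 z
  -- One power more than for `deriv c`, because `c t` enters divided by `t`.
  obtain ⟨B₂, hB₂, f₂⟩ := flat_bound hc.smooth hc.eq_zero 2 (z + 1)
  refine ⟨(B₁ * A₁ + B₂ * A₂ + A₃) * 3 ^ (z + 3), by positivity, fun a Λ ha hΛ p => ?_⟩
  -- Applied with `r = a` when `Λ ≤ 2 * a` and with `r = Λ` when `Λ > 2 * a`; in both regimes `Λ + a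
  -- ≤ 3 * r`.
  have conv : ∀ {r : ℝ}, 0 < r → Λ + a ≤ 3 * r →
      r ^ (-3 - z : ℤ) ≤ 3 ^ (z + 3) * (Λ + a) ^ (-3 - z : ℤ) := by
    intro r hr hle
    have e : ∀ s : ℝ, s ^ (-3 - z : ℤ) = (s ^ (z + 3))⁻¹ := fun s => by
      rw [← zpow_natCast, ← zpow_neg]; congr 1; push_cast; ring
    rw [e, e, ← div_eq_mul_inv, inv_le_comm₀ (by positivity) (by positivity), inv_div,
      div_le_iff₀ (by positivity), mul_comm (r ^ (z + 3)), ← mul_pow]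
    gcongr
  have scal : ∀ f : Momentum → ℝ, ContDiff ℝ ∞ f →
      ‖iteratedFDeriv ℝ z (fun p => f (Λ⁻¹ • p)) p‖ ≤ ‖iteratedFDeriv ℝ z f (Λ⁻¹ • p)‖ * Λ⁻¹ ^ z := by
    intro f hf
    have h1 := norm_iteratedFDeriv_comp_clm_add_le hf (Λ⁻¹ • ContinuousLinearMap.id ℝ Momentum) 0 z p
    simp only [_root_.smul_apply, ContinuousLinearMap.id_apply, add_zero] at h1
    refine h1.trans ?_
    gcongr
    rw [norm_smul]
    calc _ ≤ ‖Λ⁻¹‖ * 1 := by gcongr; exact ContinuousLinearMap.norm_id_le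
      _ = _ := by rw [mul_one, Real.norm_of_nonneg (by positivity)]
  have nrm : ∀ p : Momentum, ‖Λ⁻¹ • p‖ ^ 2 = ‖p‖ ^ 2 / Λ ^ 2 := fun p => by
    rw [norm_smul, Real.norm_of_nonneg (by positivity)]; field_simp
  have slice : ∀ {f : ℝ → Momentum → ℝ}, ContDiff ℝ ∞ (fun y : ℝ × Momentum => f y.1 y.2) → ∀ t,
      ContDiff ℝ ∞ (f t) := fun hf t => hf.comp (contDiff_prodMk_right t)
  set t := Λ / a with ht
  have ht0 : 0 < t := by positivity
  rcases le_or_gt t 2 with h2 | h2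
  · have e : propagatorDot K c a Λ = fun p =>
        (fun x => (a⁻¹ ^ 3 * deriv c t) * φ₁ t x + (a⁻¹ ^ 3 * (c t / t)) * φ₂ t x) (Λ⁻¹ • p) := by
      funext p
      simp only [φ₁, φ₂, nrm, propagatorDot, ← ht]
      have : Λ = t * a := by rw [ht]; field_simp
      rw [this]
      field_simp
    have g₁ := (contDiff_const (c := a⁻¹ ^ 3 * deriv c t)).mul (slice s₁ t)
    have g₂ := (contDiff_const (c := a⁻¹ ^ 3 * (c t / t))).mul (slice s₂ t)
    rw [e]
    refine (scal _ (g₁.add g₂)).trans ?_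
    have q₁ : |c t / t| ≤ B₂ * t ^ z := by
      rw [abs_div, abs_of_pos ht0, div_le_iff₀ ht0, mul_assoc, ← pow_succ]
      exact f₂ t ht0.le h2
    have main : ‖iteratedFDeriv ℝ z (fun x => (a⁻¹ ^ 3 * deriv c t) * φ₁ t x +
        (a⁻¹ ^ 3 * (c t / t)) * φ₂ t x) (Λ⁻¹ • p)‖ ≤
        a⁻¹ ^ 3 * (B₁ * t ^ z) * A₁ + a⁻¹ ^ 3 * (B₂ * t ^ z) * A₂ := by
      have zle : (z : WithTop ℕ∞) ≤ ((⊤ : ℕ∞) : WithTop ℕ∞) := by exact_mod_cast le_top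
      rw [fun_iteratedFDeriv_add_apply (g₁.of_le zle).contDiffAt (g₂.of_le zle).contDiffAt]
      refine (norm_add_le _ _).trans ?_
      rw [iteratedFDeriv_const_mul (slice s₁ t), iteratedFDeriv_const_mul (slice s₂ t), norm_smul, norm_smul, norm_mul, norm_mul,
        Real.norm_of_nonneg (show 0 ≤ a⁻¹ ^ 3 by positivity)]
      gcongr
      · exact f₁ t ht0.le h2
      · exact b₁ t ht0.le h2 _
      · exact q₁
      · exact b₂ t ht0.le h2 _
    calc _ ≤ (a⁻¹ ^ 3 * (B₁ * t ^ z) * A₁ + a⁻¹ ^ 3 * (B₂ * t ^ z) * A₂) * Λ⁻¹ ^ z := by gcongr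
      _ = (B₁ * A₁ + B₂ * A₂) * a ^ (-3 - z : ℤ) := by
        have : (a : ℝ) ^ (-3 - z : ℤ) = a⁻¹ ^ 3 * a⁻¹ ^ z := zpow_neg_three_sub a z
        rw [this, ht, div_eq_mul_inv, mul_pow]
        have : Λ ^ z * Λ⁻¹ ^ z = 1 := by rw [← mul_pow]; field_simp; simp
        linear_combination (a⁻¹ ^ 3 * B₁ * A₁ * a⁻¹ ^ z + a⁻¹ ^ 3 * B₂ * A₂ * a⁻¹ ^ z) * this
      _ ≤ (B₁ * A₁ + B₂ * A₂) * (3 ^ (z + 3) * (Λ + a) ^ (-3 - z : ℤ)) := by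
        gcongr
        refine conv ha ?_
        have : Λ ≤ 2 * a := by rwa [ht, div_le_iff₀ ha] at h2
        linarith
      _ ≤ _ := by
        rw [← mul_assoc]
        have := mul_nonneg hB₁ hA₁
        have := mul_nonneg hB₂ hA₂
        refine mul_le_mul_of_nonneg_right (mul_le_mul_of_nonneg_right ?_ (by positivity))
          (by positivity)
        linarith
  · have hd : deriv c t = 0 := by
      have : c =ᶠ[nhds t] fun _ => 1 := by
        filter_upwards [lt_mem_nhds h2] with s hs using hc.eq_one s hs.le
      simp [this.deriv_eq]
    have e : propagatorDot K c a Λ = fun p => (fun x => Λ⁻¹ ^ 3 * h t⁻¹ x) (Λ⁻¹ • p) := by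
      funext p
      simp only [h, nrm, propagatorDot, ← ht, hd, hc.eq_one t h2.le]
      have : a = Λ * t⁻¹ := by rw [ht]; field_simp
      rw [this]
      field_simp
      ring
    have g := (contDiff_const (c := Λ⁻¹ ^ 3)).mul (slice s₃ t⁻¹)
    rw [e]
    refine (scal _ g).trans ?_
    rw [iteratedFDeriv_const_mul (slice s₃ t⁻¹), norm_smul, Real.norm_of_nonneg (show 0 ≤ Λ⁻¹ ^ 3 by positivity)]
    calc _ ≤ Λ⁻¹ ^ 3 * A₃ * Λ⁻¹ ^ z := by
          gcongr
          exact b₃ _ (by positivity) (inv_le_one_of_one_le₀ (by linarith)) _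
      _ = A₃ * Λ ^ (-3 - z : ℤ) := by
        have : (Λ : ℝ) ^ (-3 - z : ℤ) = Λ⁻¹ ^ 3 * Λ⁻¹ ^ z := zpow_neg_three_sub Λ z
        rw [this]; ring
      _ ≤ A₃ * (3 ^ (z + 3) * (Λ + a) ^ (-3 - z : ℤ)) := by
        gcongr
        refine conv hΛ ?_
        have : a * 2 < Λ := by rw [ht, lt_div_iff₀ ha] at h2; linarith
        linarith
      _ ≤ _ := by
        rw [← mul_assoc]
        have := mul_nonneg hB₁ hA₁
        have := mul_nonneg hB₂ hA₂
        refine mul_le_mul_of_nonneg_right (mul_le_mul_of_nonneg_right ?_ (by positivity))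
          (by positivity)
        linarith

end Profile

/-! ### Symbols -/

theorem natCast_le_infty (z : ℕ) : (z : WithTop ℕ∞) ≤ ((⊤ : ℕ∞) : WithTop ℕ∞) := by
  exact_mod_cast le_top

/-- A family of smooth functions `F i`, with points `x i`, is a symbol of order `a` with respect to
the scale `ρ` if derivatives of order `z` of `F i` at `x i` are bounded by `ρ i ^ (a - z)`, up to
powers of the logarithm `g i`, uniformly in `i`. -/
structure IsSymbol {ι E : Type*} [NormedAddCommGroup E] [NormedSpace ℝ E] (g ρ : ι → ℝ)
    (F : ι → E → ℝ) (x : ι → E) (a : ℤ) : Prop where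
  smooth : ∀ i, ContDiff ℝ ∞ (F i)
  bound : ∀ z : ℕ, ∃ (A : ℝ) (d : ℕ), 0 ≤ A ∧
    ∀ i, ‖iteratedFDeriv ℝ z (F i) (x i)‖ ≤ A * ρ i ^ (a - z) * g i ^ d

namespace IsSymbol

variable {ι κ E E' : Type*} [NormedAddCommGroup E] [NormedSpace ℝ E] [NormedAddCommGroup E']
  [NormedSpace ℝ E'] {g ρ : ι → ℝ} {F G : ι → E → ℝ} {x : ι → E} {a b : ℤ}

theorem zero : IsSymbol g ρ (fun _ _ => 0) x a :=
  ⟨fun _ => contDiff_const, fun z => ⟨0, 0, le_rfl, fun i => by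
    rw [iteratedFDeriv_fun_zero]; simp⟩⟩

theorem add (hg : ∀ i, 1 ≤ g i) (hρ : ∀ i, 0 < ρ i) (hF : IsSymbol g ρ F x a)
    (hG : IsSymbol g ρ G x a) : IsSymbol g ρ (fun i e => F i e + G i e) x a := by
  refine ⟨fun i => (hF.smooth i).add (hG.smooth i), fun z => ?_⟩
  obtain ⟨A, d, hA, h⟩ := hF.bound z
  obtain ⟨A', d', hA', h'⟩ := hG.bound z
  refine ⟨A + A', max d d', by positivity, fun i => ?_⟩
  have p := hρ i
  have q : 0 < g i := one_pos.trans_le (hg i)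
  rw [fun_iteratedFDeriv_add_apply ((hF.smooth i).of_le (natCast_le_infty z)).contDiffAt
    ((hG.smooth i).of_le (natCast_le_infty z)).contDiffAt]
  calc _ ≤ A * ρ i ^ (a - z) * g i ^ d + A' * ρ i ^ (a - z) * g i ^ d' :=
        (norm_add_le _ _).trans (add_le_add (h i) (h' i))
    _ ≤ A * ρ i ^ (a - z) * g i ^ max d d' + A' * ρ i ^ (a - z) * g i ^ max d d' := by
        gcongr
        exacts [hg i, le_max_left _ _, hg i, le_max_right _ _]
    _ = _ := by ring

theorem const_mul (s : ℝ) (hF : IsSymbol g ρ F x a) : IsSymbol g ρ (fun i e => s * F i e) x a := by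
  refine ⟨fun i => contDiff_const.mul (hF.smooth i), fun z => ?_⟩
  obtain ⟨A, d, hA, h⟩ := hF.bound z
  refine ⟨|s| * A, d, by positivity, fun i => ?_⟩
  rw [iteratedFDeriv_const_mul (hF.smooth i), norm_smul, Real.norm_eq_abs, mul_assoc, mul_assoc,
    ← mul_assoc A]
  gcongr
  exact h i

theorem sum (hg : ∀ i, 1 ≤ g i) (hρ : ∀ i, 0 < ρ i) {s : Finset κ} {F : κ → ι → E → ℝ}
    (hF : ∀ j ∈ s, IsSymbol g ρ (F j) x a) : IsSymbol g ρ (fun i e => ∑ j ∈ s, F j i e) x a := by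
  classical
  induction s using Finset.induction_on with
  | empty => simpa using zero
  | insert j s hj ih =>
    simp only [Finset.sum_insert hj]
    exact (hF j (Finset.mem_insert_self j s)).add hg hρ
      (ih fun k hk => hF k (Finset.mem_insert_of_mem hk))

theorem mul (hg : ∀ i, 1 ≤ g i) (hρ : ∀ i, 0 < ρ i) (hF : IsSymbol g ρ F x a)
    (hG : IsSymbol g ρ G x b) : IsSymbol g ρ (fun i e => F i e * G i e) x (a + b) := by
  refine ⟨fun i => (hF.smooth i).mul (hG.smooth i), fun z => ?_⟩
  choose A d hA h using hF.bound
  choose A' d' hA' h' using hG.bound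
  -- The sum of all logarithmic exponents in the Leibniz formula is a crude common exponent, allowed
  -- because `g` is at least one.
  let D := ∑ j ∈ Finset.range (z + 1), (d j + d' (z - j))
  refine ⟨∑ j ∈ Finset.range (z + 1), (z.choose j : ℝ) * A j * A' (z - j), D,
    Finset.sum_nonneg fun j _ => mul_nonneg (mul_nonneg (by positivity) (hA j)) (hA' _),
    fun i => ?_⟩
  have p := hρ i
  have q : 0 < g i := one_pos.trans_le (hg i)
  refine (norm_iteratedFDeriv_mul_le (hF.smooth i) (hG.smooth i) (x i)
    (natCast_le_infty z)).trans ?_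
  rw [Finset.sum_mul, Finset.sum_mul]
  refine Finset.sum_le_sum fun j hj => ?_
  have hjz : j ≤ z := Nat.lt_succ_iff.1 (Finset.mem_range.1 hj)
  calc _ ≤ (z.choose j : ℝ) * (A j * ρ i ^ (a - j) * g i ^ d j) *
        (A' (z - j) * ρ i ^ (b - (z - j : ℕ)) * g i ^ d' (z - j)) := by
        have := hA j
        have := hA' (z - j)
        gcongr
        · exact h j i
        · exact h' _ i
    _ = (z.choose j : ℝ) * A j * A' (z - j) * ρ i ^ (a + b - z) * g i ^ (d j + d' (z - j)) := by
        rw [show a + b - (z : ℤ) = (a - j) + (b - (z - j : ℕ)) by push_cast [hjz]; ring,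
          zpow_add₀ p.ne', pow_add]
        ring
    _ ≤ _ := by
        have : 0 ≤ (z.choose j : ℝ) * A j * A' (z - j) :=
          mul_nonneg (mul_nonneg (by positivity) (hA j)) (hA' _)
        gcongr
        · exact hg i
        · exact Finset.single_le_sum (f := fun j => d j + d' (z - j)) (fun _ _ => Nat.zero_le _) hj

/-- The linear part `T` is the same for all indices, so `‖T‖ ^ z` goes into the uniform constant;
only the shift may vary. -/
theorem comp_clm_add {F : ι → E' → ℝ} (T : E →L[ℝ] E')
    (c : ι → E') (hF : IsSymbol g ρ F (fun i => T (x i) + c i) a) :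
    IsSymbol g ρ (fun i e => F i (T e + c i)) x a := by
  refine ⟨fun i => (hF.smooth i).comp (T.contDiff.add contDiff_const), fun z => ?_⟩
  obtain ⟨A, d, hA, h⟩ := hF.bound z
  refine ⟨A * ‖T‖ ^ z, d, by positivity, fun i => ?_⟩
  calc _ ≤ _ := norm_iteratedFDeriv_comp_clm_add_le (hF.smooth i) T (c i) z (x i)
    _ ≤ (A * ρ i ^ (a - z) * g i ^ d) * ‖T‖ ^ z := by gcongr; exact h i
    _ = _ := by ring

theorem comp_clm {F : ι → E' → ℝ} (T : E →L[ℝ] E')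
    (hF : IsSymbol g ρ F (fun i => T (x i)) a) : IsSymbol g ρ (fun i e => F i (T e)) x a := by
  simpa using comp_clm_add T (fun _ => 0) (by simpa using hF)

/-- This is how the supports of the propagators are exploited: where the line vanishes near the
point, nothing has to be known about the attached vertices. -/
theorem of_subtype (hg : ∀ i, 1 ≤ g i) (hρ : ∀ i, 0 < ρ i) (p : ι → Prop)
    (hs : ∀ i, ¬ p i → ContDiff ℝ ∞ (F i))
    (hF : IsSymbol (fun i : {i // p i} => g i) (fun i => ρ i) (fun i => F i) (fun i => x i) a)
    (h0 : ∀ i, ¬ p i → F i =ᶠ[nhds (x i)] fun _ => 0) : IsSymbol g ρ F x a := by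
  refine ⟨fun i => (em (p i)).elim (fun hi => hF.smooth ⟨i, hi⟩) (hs i), fun z => ?_⟩
  obtain ⟨A, d, hA, h⟩ := hF.bound z
  refine ⟨A, d, hA, fun i => ?_⟩
  by_cases hi : p i
  · exact h ⟨i, hi⟩
  · rw [((h0 i hi).iteratedFDeriv ℝ z).eq_of_nhds, iteratedFDeriv_fun_zero]
    have p := hρ i
    have q : 0 < g i := one_pos.trans_le (hg i)
    simp only [Pi.zero_apply, norm_zero]
    positivity

theorem mono_log {g' : ι → ℝ} (hg : ∀ i, 0 ≤ g i) (hρ : ∀ i, 0 < ρ i) (c : ℝ) (hc : 0 ≤ c)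
    (h : ∀ i, g i ≤ c * g' i)
    (hF : IsSymbol g ρ F x a) : IsSymbol g' ρ F x a := by
  refine ⟨hF.smooth, fun z => ?_⟩
  obtain ⟨A, d, hA, hb⟩ := hF.bound z
  refine ⟨A * c ^ d, d, by positivity, fun i => (hb i).trans ?_⟩
  have := hρ i
  calc _ ≤ A * ρ i ^ (a - z) * (c * g' i) ^ d := by
        gcongr
        exacts [hg i, h i]
    _ = _ := by rw [mul_pow]; ring

/-- Integration of a line of a loop raises the order by one. -/
theorem loop [ProperSpace E] (hg : ∀ i, 1 ≤ g i) (hρ : ∀ i, 0 < ρ i) {Λ : ι → ℝ}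
    (hΛ : ∀ i, 0 < Λ i) (hΛρ : ∀ i, Λ i ≤ ρ i) {D : ι → Momentum → ℝ}
    (hD : ∀ i, ContDiff ℝ ∞ (D i)) (hD0 : ∀ i ℓ, 2 * Λ i < ‖ℓ‖ → D i ℓ = 0) {A₀ : ℝ} (hA₀ : 0 ≤ A₀)
    (hDb : ∀ i ℓ, |D i ℓ| ≤ A₀ * ρ i ^ (-3 : ℤ)) {Φ : ι → Momentum → E → ℝ}
    (hΦ : ∀ i, ContDiff ℝ ∞ fun y : Momentum × E => Φ i y.1 y.2)
    (hs : IsSymbol (fun y : {y : ι × Momentum // ‖y.2‖ ≤ 2 * Λ y.1} => g y.1.1)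
      (fun y => ρ y.1.1) (fun y => Φ y.1.1 y.1.2) (fun y => x y.1.1) a) :
    IsSymbol g ρ (fun i e => ∫ ℓ, D i ℓ * Φ i ℓ e) x (a + 1) := by
  have hset : ∀ i, (fun e => ∫ ℓ, D i ℓ * Φ i ℓ e) =
      fun e => ∫ ℓ in Metric.closedBall (0 : Momentum) (2 * Λ i), D i ℓ * Φ i ℓ e := by
    intro i
    funext e
    refine (setIntegral_eq_integral_of_forall_compl_eq_zero fun ℓ hℓ => ?_).symm
    rw [hD0 i ℓ (by simpa using hℓ), zero_mul]
  have hint := fun i => iteratedFDeriv_setIntegral (S := univ) uniqueDiffOn_univ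
    (isCompact_closedBall (0 : Momentum) (2 * Λ i)) (subset_univ _)
    (μ := volume) measure_closedBall_lt_top.ne (f := fun ℓ e => D i ℓ * Φ i ℓ e)
    (((hD i).comp contDiff_fst).mul (hΦ i)).contDiffOn
  refine ⟨fun i => ?_, fun z => ?_⟩
  · rw [hset]; exact (hint i).1
  obtain ⟨A, d, hA, h⟩ := hs.bound z
  let v : ℝ := volume.real (Metric.ball (0 : Momentum) 1)
  refine ⟨A₀ * A * (16 * v), d, by positivity, fun i => ?_⟩
  have p := hρ i
  have q : 0 < g i := one_pos.trans_le (hg i)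
  have r := hΛ i
  rw [hset, (hint i).2]
  have hvol : volume.real (Metric.closedBall (0 : Momentum) (2 * Λ i)) = (2 * Λ i) ^ 4 * v := by
    rw [Measure.real, Measure.addHaar_closedBall _ _ (by positivity), ENNReal.toReal_mul,
      ENNReal.toReal_ofReal (by positivity)]
    simp [v, Measure.real]
  have hb : ∀ ℓ ∈ Metric.closedBall (0 : Momentum) (2 * Λ i),
      ‖iteratedFDeriv ℝ z (fun e => D i ℓ * Φ i ℓ e) (x i)‖ ≤
        (A₀ * ρ i ^ (-3 : ℤ)) * (A * ρ i ^ (a - z) * g i ^ d) := by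
    intro ℓ hℓ
    have hs : ContDiff ℝ ∞ (Φ i ℓ) := (hΦ i).comp (contDiff_prodMk_right ℓ)
    rw [iteratedFDeriv_const_mul hs, norm_smul]
    have hDl : ‖D i ℓ‖ ≤ A₀ * ρ i ^ (-3 : ℤ) := hDb i ℓ
    gcongr
    exact h ⟨(i, ℓ), by simpa using hℓ⟩
  refine (norm_setIntegral_le_of_norm_le_const measure_closedBall_lt_top hb).trans ?_
  rw [hvol]
  -- The line contributes $-3$ and the volume of the ball $+4$.
  have e : ρ i ^ (a + 1 - z) = ρ i ^ (-3 : ℤ) * ρ i ^ (a - z) * ρ i ^ 4 := by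
    rw [← zpow_natCast, ← zpow_add₀ p.ne', ← zpow_add₀ p.ne']; congr 1; push_cast; ring
  rw [e]
  calc _ ≤ A₀ * ρ i ^ (-3 : ℤ) * (A * ρ i ^ (a - z) * g i ^ d) * ((2 * ρ i) ^ 4 * v) := by
        gcongr; exact hΛρ i
    _ = _ := by ring

theorem congr (hF : IsSymbol g ρ F x a) (h : ∀ i, F i = G i) (hab : a = b) :
    IsSymbol g ρ G x b := by
  rw [← funext h, ← hab]; exact hF

/-- The loop estimate in the form met in the flow equation: the vertex is evaluated at a linear
function of external and loop momenta, and for fixed loop momentum its contribution is a shift. -/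
theorem loop_clm [ProperSpace E] (hg : ∀ i, 1 ≤ g i) (hρ : ∀ i, 0 < ρ i) {Λ : ι → ℝ}
    (hΛ : ∀ i, 0 < Λ i) (hΛρ : ∀ i, Λ i ≤ ρ i) {D : ι → Momentum → ℝ}
    (hD : ∀ i, ContDiff ℝ ∞ (D i)) (hD0 : ∀ i ℓ, 2 * Λ i < ‖ℓ‖ → D i ℓ = 0) {A₀ : ℝ} (hA₀ : 0 ≤ A₀)
    (hDb : ∀ i ℓ, |D i ℓ| ≤ A₀ * ρ i ^ (-3 : ℤ)) (T : E × Momentum →L[ℝ] E') {F : ι → E' → ℝ}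
    (hF : ∀ i, ContDiff ℝ ∞ (F i))
    (hs : IsSymbol (fun y : {y : ι × Momentum // ‖y.2‖ ≤ 2 * Λ y.1} => g y.1.1)
      (fun y => ρ y.1.1) (fun y => F y.1.1) (fun y => T (x y.1.1, y.1.2)) a) :
    IsSymbol g ρ (fun i e => ∫ ℓ, D i ℓ * F i (T (e, ℓ))) x (a + 1) := by
  have split : ∀ e ℓ, T.comp (ContinuousLinearMap.inl ℝ E Momentum) e + T (0, ℓ) = T (e, ℓ) := by
    intro e ℓ
    rw [ContinuousLinearMap.comp_apply, ← map_add]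
    simp
  refine loop hg hρ hΛ hΛρ hD hD0 hA₀ hDb (Φ := fun i ℓ e => F i (T (e, ℓ)))
    (fun i => (hF i).comp (T.contDiff.comp (contDiff_snd.prodMk contDiff_fst))) ?_
  have h := comp_clm_add (T.comp (ContinuousLinearMap.inl ℝ E Momentum))
    (fun y : {y : ι × Momentum // ‖y.2‖ ≤ 2 * Λ y.1} => T (0, y.1.2))
    (F := fun y => F y.1.1) (x := fun y => x y.1.1) (g := fun y => g y.1.1)
    (ρ := fun y => ρ y.1.1) (a := a) (by simpa only [split] using hs)
  exact h.congr (fun y => funext fun e => by rw [split]) rfl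

end IsSymbol

/-! ### Sequences of momenta depending linearly on a parameter -/

section Linear

variable {E : Type*} [NormedAddCommGroup E] [NormedSpace ℝ E]

/-- Every term of the sequence depends linearly on the parameter. -/
def IsLinearSeq (p : E → ℕ → Momentum) : Prop :=
  ∀ i, ∃ T : E →L[ℝ] Momentum, ∀ e, p e i = T e

theorem IsLinearSeq.shift {p : E → ℕ → Momentum} (hp : IsLinearSeq p) (φ : ℕ → ℕ) :
    IsLinearSeq fun e i => p e (φ i) := fun i => hp (φ i)

theorem IsLinearSeq.comp {E' : Type*} [NormedAddCommGroup E'] [NormedSpace ℝ E']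
    {p : E → ℕ → Momentum} (hp : IsLinearSeq p) (S : E' →L[ℝ] E) :
    IsLinearSeq fun e => p (S e) := fun i => by
  obtain ⟨T, hT⟩ := hp i
  exact ⟨T.comp S, fun e => hT (S e)⟩

theorem IsLinearSeq.permute {p : E → ℕ → Momentum} (hp : IsLinearSeq p) {N : ℕ}
    (σ : Equiv.Perm (Fin N)) : IsLinearSeq fun e => permute σ (p e) := by
  intro i
  by_cases h : i < N
  · obtain ⟨T, hT⟩ := hp (σ ⟨i, h⟩)
    exact ⟨T, fun e => by simp [TwoScalar.permute, h, hT]⟩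
  · exact ⟨0, fun e => by simp [TwoScalar.permute, h]⟩

theorem IsLinearSeq.snocTwo {p : E → ℕ → Momentum} (hp : IsLinearSeq p) (N : ℕ)
    (S S' : E →L[ℝ] Momentum) : IsLinearSeq fun e => snocTwo N (p e) (S e) (S' e) := by
  intro i
  by_cases h : i < N
  · obtain ⟨T, hT⟩ := hp i
    exact ⟨T, fun e => by simp [TwoScalar.snocTwo, h, hT]⟩
  · by_cases h' : i = N
    · exact ⟨S, fun e => by simp [TwoScalar.snocTwo, h']⟩
    · exact ⟨S', fun e => by simp [TwoScalar.snocTwo, h, h']⟩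

theorem IsLinearSeq.snocFrom {p : E → ℕ → Momentum} (hp : IsLinearSeq p) (a N : ℕ)
    (S : E →L[ℝ] Momentum) : IsLinearSeq fun e => snocFrom a N (p e) (S e) := by
  intro i
  by_cases h : i < N
  · obtain ⟨T, hT⟩ := hp (a + i)
    exact ⟨T, fun e => by simp [TwoScalar.snocFrom, h, hT]⟩
  · exact ⟨S, fun e => by simp [TwoScalar.snocFrom, h]⟩

theorem IsLinearSeq.exists_sum {p : E → ℕ → Momentum} (hp : IsLinearSeq p) (s : Finset ℕ) :
    ∃ T : E →L[ℝ] Momentum, ∀ e, ∑ i ∈ s, p e i = T e := by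
  choose T hT using hp
  exact ⟨∑ i ∈ s, T i, fun e => by simp [hT]⟩

theorem isLinearSeq_leg (n₁ n₂ : ℕ) : IsLinearSeq fun k : Config n₁ n₂ => leg k := by
  intro i
  by_cases h : i < 2 * n₁ + 2 * n₂ - 1
  · exact ⟨ContinuousLinearMap.proj ⟨i, h⟩, fun k => by simp [leg, h]⟩
  · exact ⟨-∑ j, ContinuousLinearMap.proj j, fun k => by simp [leg, h]⟩

theorem isLinearSeq_lightLegs (n₁ n₂ : ℕ) : IsLinearSeq fun k : Config n₁ n₂ => lightLegs k :=
  isLinearSeq_leg n₁ n₂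

theorem isLinearSeq_heavyLegs (n₁ n₂ : ℕ) : IsLinearSeq fun k : Config n₁ n₂ => heavyLegs k :=
  (isLinearSeq_leg n₁ n₂).shift fun i => 2 * n₁ + i

/-- The map `T` depends only on the pattern of the legs, not on masses, scale or vertex function, so
its norm is harmless for uniformity. -/
theorem IsLinearSeq.exists_config {p q : E → ℕ → Momentum} (hp : IsLinearSeq p)
    (hq : IsLinearSeq q) (n₁ n₂ : ℕ) : ∃ T : E →L[ℝ] Config n₁ n₂,
      (∀ e i, T e i = if (i : ℕ) < 2 * n₁ then p e i else q e (i - 2 * n₁)) ∧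
      ∀ (F : Config n₁ n₂ → ℝ) e, atLegs F (p e) (q e) = F (T e) := by
  have h : ∀ i : Fin (2 * n₁ + 2 * n₂ - 1), ∃ T : E →L[ℝ] Momentum,
      ∀ e, T e = if (i : ℕ) < 2 * n₁ then p e i else q e (i - 2 * n₁) := by
    intro i
    by_cases hi : (i : ℕ) < 2 * n₁
    · obtain ⟨T, hT⟩ := hp i
      exact ⟨T, fun e => by simp [hi, hT]⟩
    · obtain ⟨T, hT⟩ := hq (i - 2 * n₁)
      exact ⟨T, fun e => by simp [hi, hT]⟩
  choose T hT using h
  refine ⟨ContinuousLinearMap.pi T, fun e i => hT i e, fun F e => ?_⟩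
  unfold atLegs
  congr 1
  funext i
  exact (hT i e).symm

end Linear

/-! ### Theories -/

/-- The data of a theory with cutoff profile `K`. -/
structure Theory (K : ℝ → ℝ) where
  /-- mass of the light field -/
  m : ℝ
  /-- mass of the heavy field -/
  M : ℝ
  /-- ultraviolet cutoff -/
  Λ₀ : ℝ
  /-- renormalization points -/
  pbar : Fin 5 → Momentum
  /-- vertex functions -/
  L : VertexFamily
  m_pos : 0 < m
  m_le : m ≤ M
  M_le : M ≤ Λ₀
  norm_pbar : ∀ i, ‖pbar i‖ = M
  sol : IsPerturbativeSolution K m M Λ₀ pbar L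

namespace Theory

variable {K : ℝ → ℝ} (t : Theory K)

theorem M_pos : 0 < t.M := t.m_pos.trans_le t.m_le

theorem Λ₀_pos : 0 < t.Λ₀ := t.M_pos.trans_le t.M_le

/-- The momenta at which a vertex is estimated. -/
def region (C Λ : ℝ) (n₁ n₂ : ℕ) : Set (Config n₁ n₂) :=
  {k | ∀ i, ‖k i‖ ≤ C * (Λ + if (i : ℕ) < 2 * n₁ then t.m else t.M)}

/-- The mass in the logarithms of a vertex. -/
def gap (n₂ : ℕ) : ℝ := if n₂ = 0 then t.m else t.M

/-- The logarithm in the estimate of a vertex with `2 * n₂` heavy legs. -/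
def lg (n₂ : ℕ) (Λ : ℝ) : ℝ := 1 + Real.log ((Λ + t.gap n₂) / t.m)

/-- The power of the scale in the estimate of a derivative of order `z` of a vertex. -/
def weight (n₁ n₂ z : ℕ) (Λ : ℝ) : ℝ :=
  if n₂ = 0 ∨ 4 < 2 * (n₁ + n₂) + z then (Λ + t.m) ^ (4 - 2 * ((n₁ : ℤ) + n₂) - z)
  else (Λ + t.M) ^ (4 - 2 * ((n₁ : ℤ) + n₂) - z)

variable {t} {Λ : ℝ}

theorem m_le_gap (n₂ : ℕ) : t.m ≤ t.gap n₂ := by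
  unfold gap; split_ifs; exacts [le_rfl, t.m_le]

theorem gap_le (n₂ : ℕ) : t.gap n₂ ≤ t.M := by
  unfold gap; split_ifs; exacts [t.m_le, le_rfl]

theorem one_le_lg (n₂ : ℕ) (hΛ : 0 ≤ Λ) : 1 ≤ t.lg n₂ Λ := by
  unfold lg
  have := t.m_pos
  have := Real.log_nonneg (x := (Λ + t.gap n₂) / t.m) (by
    rw [one_le_div t.m_pos]; linarith [t.m_le_gap n₂])
  linarith

theorem lg_mono_gap {l₂ n₂ : ℕ} (h : n₂ = 0 → l₂ = 0) (hΛ : 0 ≤ Λ) : t.lg l₂ Λ ≤ t.lg n₂ Λ := by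
  unfold lg
  have := t.m_pos
  have h1 := t.m_le_gap l₂
  have h2 : t.gap l₂ ≤ t.gap n₂ := by
    by_cases hn : n₂ = 0
    · simp [hn, h hn]
    · simpa [gap, hn] using t.gap_le l₂
  have : 0 < (Λ + t.gap l₂) / t.m := div_pos (by linarith) t.m_pos
  gcongr

theorem lg_mono (n₂ : ℕ) {Λ' : ℝ} (hΛ : 0 ≤ Λ) (h : Λ ≤ Λ') : t.lg n₂ Λ ≤ t.lg n₂ Λ' := by
  unfold lg
  have := t.m_pos
  have h1 := t.m_le_gap n₂
  have : 0 < (Λ + t.gap n₂) / t.m := div_pos (by linarith) t.m_pos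
  gcongr

/-- Above `M` the larger mass changes the argument of the logarithm by at most a factor two. This is
what lets a heavy loop feed a purely light vertex, whose logarithm contains only `m`. -/
theorem lg_le_two_mul {l₂ n₂ : ℕ} (h : t.M ≤ Λ) : t.lg l₂ Λ ≤ 2 * t.lg n₂ Λ := by
  have hm := t.m_pos
  have hM := t.M_pos
  have h1 : t.lg l₂ Λ ≤ 1 + Real.log (2 * ((Λ + t.m) / t.m)) := by
    unfold lg
    have := t.gap_le l₂
    have : 0 < (Λ + t.gap l₂) / t.m := div_pos (by linarith [t.m_le_gap l₂]) hm
    gcongr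
    rw [← mul_div_assoc]
    gcongr
    linarith
  have h2 : t.lg 0 Λ ≤ t.lg n₂ Λ := lg_mono_gap (fun _ => rfl) (hM.le.trans h)
  have h3 : t.lg 0 Λ = 1 + Real.log ((Λ + t.m) / t.m) := by simp [lg, gap]
  have h4 : 0 < (Λ + t.m) / t.m := div_pos (by linarith) hm
  rw [Real.log_mul (by norm_num) h4.ne'] at h1
  have h5 : Real.log 2 ≤ 1 := by linarith [Real.log_two_lt_d9]
  have h6 : 0 ≤ Real.log ((Λ + t.m) / t.m) := Real.log_nonneg (by rw [one_le_div hm]; linarith)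
  linarith

/-- The dependent leg costs the factor counting legs. It is light only if there are no heavy legs at
all, and then every momentum in its sum is light; this permits `X = t.m`. -/
theorem norm_leg_le {n₁ n₂ : ℕ} {C : ℝ} (hC : 0 ≤ C) (hΛ : 0 ≤ Λ) {k : Config n₁ n₂}
    (hk : k ∈ t.region C Λ n₁ n₂) {i : ℕ} {X : ℝ}
    (hX : (X = t.m ∧ (i < 2 * n₁ )) ∨ X = t.M) :
    ‖leg k i‖ ≤ (2 * n₁ + 2 * n₂) * C * (Λ + X) := by
  have hm := t.m_pos
  have hmM := t.m_le
  have hX0 : 0 < X := by rcases hX with ⟨h, -⟩ | h <;> rw [h]; exacts [t.m_pos, t.M_pos]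
  unfold leg
  split_ifs with h
  · refine (hk ⟨i, h⟩).trans ?_
    have h1 : (if i < 2 * n₁ then t.m else t.M) ≤ X := by
      split_ifs with h'
      · rcases hX with ⟨h, -⟩ | h <;> rw [h]; exact t.m_le
      · rcases hX with ⟨-, h⟩ | h
        · exact absurd h h'
        · exact h.ge
    have h2 : (1 : ℝ) ≤ 2 * n₁ + 2 * n₂ := by exact_mod_cast (by omega : 1 ≤ 2 * n₁ + 2 * n₂)
    calc _ ≤ 1 * C * (Λ + X) := by rw [one_mul]; dsimp only; gcongr
      _ ≤ _ := by gcongr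
  · rw [norm_neg]
    have h1 : ∀ j ∈ Finset.univ, ‖k j‖ ≤ C * (Λ + X) := by
      intro j _
      refine (hk j).trans ?_
      gcongr
      rcases hX with ⟨h', h''⟩ | h'
      · rw [if_pos (by have := j.2; omega), h']
      · rw [h']; split_ifs; exacts [t.m_le, le_rfl]
    refine (norm_sum_le_of_le _ h1).trans ?_
    rw [Finset.sum_const, Finset.card_univ, Fintype.card_fin, nsmul_eq_mul, mul_assoc]
    gcongr
    exact_mod_cast Nat.sub_le _ _

theorem mem_region_of_legs {n₁ n₂ : ℕ} {C : ℝ} {p q : ℕ → Momentum} {k : Config n₁ n₂}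
    (hp : ∀ i < 2 * n₁, ‖p i‖ ≤ C * (Λ + t.m)) (hq : ∀ i < 2 * n₂, ‖q i‖ ≤ C * (Λ + t.M))
    (hk : ∀ i, k i = if (i : ℕ) < 2 * n₁ then p i else q (i - 2 * n₁)) :
    k ∈ t.region C Λ n₁ n₂ := by
  intro i
  rw [hk]
  split_ifs with h
  · exact hp i h
  · exact hq _ (by have := i.2; omega)

/-- The weights with base `Λ + M` have nonnegative exponents at most 4, and for `Λ ≥ M` the base is
at most twice `Λ + m`. -/
theorem weight_le {n₁ n₂ z : ℕ} (hΛ : 0 ≤ Λ) (h : n₂ = 0 ∨ t.M ≤ Λ) :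
    t.weight n₁ n₂ z Λ ≤ 2 ^ 4 * (Λ + t.m) ^ (4 - 2 * ((n₁ : ℤ) + n₂) - z) := by
  have hm := t.m_pos
  have hM := t.M_pos
  have hw : 0 < (Λ + t.m) ^ (4 - 2 * ((n₁ : ℤ) + n₂) - z) := by positivity
  unfold weight
  split_ifs with hc
  · linarith
  · obtain ⟨e, he, he'⟩ : ∃ e : ℕ, 4 - 2 * ((n₁ : ℤ) + n₂) - z = e ∧ e ≤ 4 :=
      ⟨4 - 2 * (n₁ + n₂) - z, by omega, by omega⟩
    have h' : t.M ≤ Λ := h.resolve_left fun h => hc (Or.inl h)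
    rw [he, zpow_natCast, zpow_natCast]
    calc (Λ + t.M) ^ e ≤ (2 * (Λ + t.m)) ^ e := by
          gcongr; linarith
      _ = 2 ^ e * (Λ + t.m) ^ e := mul_pow _ _ _
      _ ≤ _ := by gcongr; norm_num

theorem smooth (t : Theory K) (r : Fin 3 → ℕ) {n₁ n₂ : ℕ} (hn : 1 ≤ n₁ + n₂) (hΛ : 0 ≤ Λ) (hΛ' : Λ ≤ t.Λ₀) :
    ContDiff ℝ ∞ (t.L r n₁ n₂ Λ) :=
  contDiff_partial (g := fun Λ => t.L r n₁ n₂ Λ) (t.sol.smooth r n₁ n₂ hn) ⟨hΛ, hΛ'⟩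

end Theory

/-- The estimate of the derivatives of order `z` of a vertex function. -/
def VertexBound (K : ℝ → ℝ) (r : Fin 3 → ℕ) (n₁ n₂ z : ℕ) : Prop :=
  ∀ C : ℝ, 0 ≤ C → ∃ (A : ℝ) (d : ℕ), 0 ≤ A ∧ ∀ (t : Theory K) (Λ : ℝ), 0 ≤ Λ → Λ ≤ t.Λ₀ →
    ∀ k ∈ t.region C Λ n₁ n₂,
      ‖iteratedFDeriv ℝ z (t.L r n₁ n₂ Λ) k‖ ≤ A * t.weight n₁ n₂ z Λ * t.lg n₂ Λ ^ d

/-! ### Vertex functions and propagators as symbols -/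

section Symbols

variable {K : ℝ → ℝ} {ι : Type*} {t : ι → Theory K} {Λ : ι → ℝ} {r : Fin 3 → ℕ} {n₁ n₂ l₁ l₂ : ℕ}

/-- Hypothesis `hl'` excludes the heavy two-point vertex. For any other vertex with heavy legs the
weight has base `Λ + M` only with exponent zero, so no relation between `Λ` and `M` is needed. -/
theorem VertexBound.isSymbol (h : ∀ z, VertexBound K r l₁ l₂ z) (hl : 1 ≤ l₁ + l₂)
    (hl' : l₂ = 0 ∨ 2 ≤ l₁ + l₂) (hn : n₂ = 0 → l₂ = 0) (h0 : ∀ i, 0 < Λ i)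
    (h1 : ∀ i, Λ i ≤ (t i).Λ₀) {C : ℝ} (hC : 0 ≤ C) {x : ι → Config l₁ l₂}
    (hx : ∀ i, x i ∈ (t i).region C (Λ i) l₁ l₂) :
    IsSymbol (fun i => (t i).lg n₂ (Λ i)) (fun i => Λ i + (t i).m)
      (fun i => (t i).L r l₁ l₂ (Λ i)) x (4 - 2 * ((l₁ : ℤ) + l₂)) := by
  refine IsSymbol.mono_log (g := fun i => (t i).lg l₂ (Λ i)) (fun i => ?_) (fun i => ?_) 1
    zero_le_one (fun i => ?_) ⟨fun i => (t i).smooth r hl (h0 i).le (h1 i), fun z => ?_⟩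
  · exact zero_le_one.trans ((t i).one_le_lg _ (h0 i).le)
  · exact add_pos (h0 i) (t i).m_pos
  · rw [one_mul]; exact Theory.lg_mono_gap hn (h0 i).le
  · obtain ⟨A, d, hA, hb⟩ := h z C hC
    refine ⟨A, d, hA, fun i => (hb (t i) (Λ i) (h0 i).le (h1 i) (x i) (hx i)).trans_eq ?_⟩
    unfold Theory.weight
    split_ifs with hc
    · rfl
    · rw [show 4 - 2 * ((l₁ : ℤ) + l₂) - z = 0 by omega]; simp

/-- Used at the ends of heavy lines, where `M ≤ Λ` is available and the heavy two-point vertex may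
occur. -/
theorem VertexBound.isSymbol_of_le (h : ∀ z, VertexBound K r l₁ l₂ z) (hl : 1 ≤ l₁ + l₂)
    (h0 : ∀ i, 0 < Λ i) (h1 : ∀ i, Λ i ≤ (t i).Λ₀) (h2 : ∀ i, (t i).M ≤ Λ i) {C : ℝ} (hC : 0 ≤ C)
    {x : ι → Config l₁ l₂} (hx : ∀ i, x i ∈ (t i).region C (Λ i) l₁ l₂) :
    IsSymbol (fun i => (t i).lg n₂ (Λ i)) (fun i => Λ i + (t i).m)
      (fun i => (t i).L r l₁ l₂ (Λ i)) x (4 - 2 * ((l₁ : ℤ) + l₂)) := by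
  refine IsSymbol.mono_log (g := fun i => (t i).lg l₂ (Λ i)) (fun i => ?_) (fun i => ?_) 2
    zero_le_two (fun i => ?_) ⟨fun i => (t i).smooth r hl (h0 i).le (h1 i), fun z => ?_⟩
  · exact zero_le_one.trans ((t i).one_le_lg _ (h0 i).le)
  · exact add_pos (h0 i) (t i).m_pos
  · exact Theory.lg_le_two_mul (h2 i)
  · obtain ⟨A, d, hA, hb⟩ := h z C hC
    refine ⟨A * 2 ^ 4, d, by positivity,
      fun i => (hb (t i) (Λ i) (h0 i).le (h1 i) (x i) (hx i)).trans ?_⟩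
    have hm := (t i).m_pos
    have hM := (t i).M_pos
    have := h0 i
    have hlg : 0 ≤ (t i).lg l₂ (Λ i) := zero_le_one.trans ((t i).one_le_lg _ (h0 i).le)
    have key := (t i).weight_le (n₁ := l₁) (z := z) (h0 i).le (Or.inr (h2 i) : l₂ = 0 ∨ _)
    calc _ ≤ A * (2 ^ 4 * (Λ i + (t i).m) ^ (4 - 2 * ((l₁ : ℤ) + l₂) - z)) *
          (t i).lg l₂ (Λ i) ^ d := by gcongr
      _ = _ := by ring

theorem isSymbol_lightDot (hK : IsCutoffProfile K) (h0 : ∀ i, 0 < Λ i) (g : ι → ℝ)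
    (x : ι → Momentum) : IsSymbol g (fun i => Λ i + (t i).m)
      (fun i => lightDot K (t i).m (Λ i)) x (-3) := by
  refine ⟨fun i => ?_, fun z => ?_⟩
  · rw [lightDot_eq hK (t i).m_pos (h0 i)]; exact contDiff_propagatorDot hK (t i).m_pos
  · obtain ⟨A, hA, h⟩ := exists_bound_propagatorDot hK (isSwitch_light hK) z
    refine ⟨A, 0, hA, fun i => ?_⟩
    rw [lightDot_eq hK (t i).m_pos (h0 i), pow_zero, mul_one]
    exact h _ _ (t i).m_pos (h0 i) _

/-- The natural scale is `Λ + M`; the exponents are negative, so passing to the smaller `Λ + m` only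
weakens the bound. -/
theorem isSymbol_heavyDot (hK : IsCutoffProfile K) (h0 : ∀ i, 0 < Λ i) (g : ι → ℝ)
    (x : ι → Momentum) : IsSymbol g (fun i => Λ i + (t i).m)
      (fun i => heavyDot K (t i).M (Λ i)) x (-3) := by
  refine ⟨fun i => ?_, fun z => ?_⟩
  · rw [heavyDot_eq hK (t i).M_pos (h0 i)]; exact contDiff_propagatorDot hK (t i).M_pos
  · obtain ⟨A, hA, h⟩ := exists_bound_propagatorDot hK (isSwitch_heavy hK) z
    refine ⟨A, 0, hA, fun i => ?_⟩
    rw [heavyDot_eq hK (t i).M_pos (h0 i), pow_zero, mul_one]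
    refine (h _ _ (t i).M_pos (h0 i) _).trans ?_
    rw [zpow_neg_three_sub, zpow_neg_three_sub]
    have := (t i).m_pos
    have := h0 i
    have := (t i).m_le
    have := (t i).M_pos
    gcongr

theorem exists_bound_lightDot (hK : IsCutoffProfile K) : ∃ A, 0 ≤ A ∧ ∀ (t : Theory K) (Λ : ℝ),
    0 < Λ → ∀ ℓ, |lightDot K t.m Λ ℓ| ≤ A * (Λ + t.m) ^ (-3 : ℤ) := by
  obtain ⟨A, d, hA, h⟩ := (isSymbol_lightDot (ι := {y : Theory K × ℝ × Momentum // 0 < y.2.1})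
    (t := fun y => y.1.1) (Λ := fun y => y.1.2.1) hK (fun y => y.2) (fun _ => 1)
    (fun y => y.1.2.2)).bound 0
  exact ⟨A, hA, fun t Λ hΛ ℓ => by simpa using h ⟨(t, Λ, ℓ), hΛ⟩⟩

theorem exists_bound_heavyDot (hK : IsCutoffProfile K) : ∃ A, 0 ≤ A ∧ ∀ (t : Theory K) (Λ : ℝ),
    0 < Λ → ∀ ℓ, |heavyDot K t.M Λ ℓ| ≤ A * (Λ + t.m) ^ (-3 : ℤ) := by
  obtain ⟨A, d, hA, h⟩ := (isSymbol_heavyDot (ι := {y : Theory K × ℝ × Momentum // 0 < y.2.1})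
    (t := fun y => y.1.1) (Λ := fun y => y.1.2.1) hK (fun y => y.2) (fun _ => 1)
    (fun y => y.1.2.2)).bound 0
  exact ⟨A, hA, fun t Λ hΛ ℓ => by simpa using h ⟨(t, Λ, ℓ), hΛ⟩⟩

theorem lightDot_eq_zero (hK : IsCutoffProfile K) {m Λ : ℝ} (hm : 0 < m) (hΛ : 0 < Λ)
    {p : Momentum} (hp : 2 * Λ < ‖p‖) : lightDot K m Λ p = 0 := by
  rw [lightDot_eq hK hm hΛ, propagatorDot_eq_zero hK hΛ hp]

theorem heavyDot_eq_zero_of_norm (hK : IsCutoffProfile K) {M Λ : ℝ} (hM : 0 < M) (hΛ : 0 < Λ)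
    {p : Momentum} (hp : 2 * Λ < ‖p‖) : heavyDot K M Λ p = 0 := by
  rw [heavyDot_eq hK hM hΛ, propagatorDot_eq_zero hK hΛ hp]

end Symbols

/-! ### The right-hand side of the flow equation is a symbol -/

section Flow

variable {K : ℝ → ℝ} {ι E : Type*} [NormedAddCommGroup E] [NormedSpace ℝ E] {t : ι → Theory K}
  {Λ : ι → ℝ} {r s u : Fin 3 → ℕ} {n₁ n₂ a a' b b' : ℕ} {p q : E → ℕ → Momentum} {x : ι → E} {C : ℝ}

theorem one_le_lg (h0 : ∀ i, 0 < Λ i) (i : ι) : 1 ≤ (t i).lg n₂ (Λ i) :=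
  (t i).one_le_lg _ (h0 i).le

theorem scale_pos (h0 : ∀ i, 0 < Λ i) (i : ι) : 0 < Λ i + (t i).m := add_pos (h0 i) (t i).m_pos

/-- The vertex has order $4-2(|n|+1)$ and the loop raises it by one. The enlarged vertex has light
legs, hence is never the heavy two-point vertex. -/
theorem isSymbol_lightLoop [ProperSpace E] (hK : IsCutoffProfile K) (h0 : ∀ i, 0 < Λ i)
    (h1 : ∀ i, Λ i ≤ (t i).Λ₀) (hL : ∀ z, VertexBound K r (n₁ + 1) n₂ z) (hp : IsLinearSeq p)
    (hq : IsLinearSeq q) (hC : 2 ≤ C)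
    (hpx : ∀ i, ∀ j < 2 * n₁, ‖p (x i) j‖ ≤ C * (Λ i + (t i).m))
    (hqx : ∀ i, ∀ j < 2 * n₂, ‖q (x i) j‖ ≤ C * (Λ i + (t i).M)) :
    IsSymbol (fun i => (t i).lg n₂ (Λ i)) (fun i => Λ i + (t i).m)
      (fun i e => lightLoop K (t i).m (t i).L r n₁ n₂ (Λ i) (p e) (q e)) x
      (3 - 2 * ((n₁ : ℤ) + n₂)) := by
  obtain ⟨T, hT, hTF⟩ := ((hp.comp (ContinuousLinearMap.fst ℝ E Momentum)).snocTwo (2 * n₁)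
    (ContinuousLinearMap.snd ℝ E Momentum) (-ContinuousLinearMap.snd ℝ E Momentum)).exists_config
    (hq.comp (ContinuousLinearMap.fst ℝ E Momentum)) (n₁ + 1) n₂
  obtain ⟨A₀, hA₀, hD⟩ := exists_bound_lightDot hK
  refine ((IsSymbol.loop_clm (x := x) (a := 4 - 2 * (((n₁ + 1 : ℕ) : ℤ) + n₂))
    (D := fun i => lightDot K (t i).m (Λ i)) (F := fun i => (t i).L r (n₁ + 1) n₂ (Λ i))
    (one_le_lg (n₂ := n₂) h0) (scale_pos h0) h0 (fun i => by linarith [(t i).m_pos])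
    (fun i => ?_) (fun i ℓ hℓ => lightDot_eq_zero hK (t i).m_pos (h0 i) hℓ)
    hA₀ (fun i ℓ => hD (t i) (Λ i) (h0 i) ℓ) T
    (fun i => (t i).smooth r (by omega) (h0 i).le (h1 i)) ?_).const_mul
    ((2 * Real.pi) ^ 4)⁻¹).congr (fun i => ?_) (by push_cast; ring)
  · rw [lightDot_eq hK (t i).m_pos (h0 i)]; exact contDiff_propagatorDot hK (t i).m_pos
  · refine VertexBound.isSymbol (ι := {y : ι × Momentum // ‖y.2‖ ≤ 2 * Λ y.1})
      (t := fun y => t y.1.1) (Λ := fun y => Λ y.1.1) hL (by omega) (by omega) id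
      (fun y => h0 _) (fun y => h1 _) (C := C) (by linarith) ?_
    rintro ⟨⟨i, ℓ⟩, hℓ⟩
    dsimp only at hℓ ⊢
    have hℓ' : ‖ℓ‖ ≤ C * (Λ i + (t i).m) := by nlinarith [h0 i, (t i).m_pos]
    refine Theory.mem_region_of_legs ?_ (hqx i) (hT (x i, ℓ))
    intro j hj
    simp only [snocTwo]
    split_ifs
    · simpa using hpx i j (by assumption)
    · simpa using hℓ'
    · simpa using hℓ'
  · funext e
    unfold lightLoop
    rw [div_eq_inv_mul]
    congr 1
    refine integral_congr_ae (Filter.Eventually.of_forall fun ℓ => ?_)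
    exact congrArg (lightDot K (t i).m (Λ i) ℓ * ·)
      (hTF ((t i).L r (n₁ + 1) n₂ (Λ i)) (e, ℓ)).symm

/-- For `Λ < M` the heavy line vanishes identically; on the remaining indices the two mass scales
are comparable. -/
theorem isSymbol_heavyLoop [ProperSpace E] (hK : IsCutoffProfile K) (h0 : ∀ i, 0 < Λ i)
    (h1 : ∀ i, Λ i ≤ (t i).Λ₀) (hL : ∀ z, VertexBound K r n₁ (n₂ + 1) z) (hp : IsLinearSeq p)
    (hq : IsLinearSeq q) (hC : 2 ≤ C)
    (hpx : ∀ i, ∀ j < 2 * n₁, ‖p (x i) j‖ ≤ C * (Λ i + (t i).m))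
    (hqx : ∀ i, ∀ j < 2 * n₂, ‖q (x i) j‖ ≤ C * (Λ i + (t i).M)) :
    IsSymbol (fun i => (t i).lg n₂ (Λ i)) (fun i => Λ i + (t i).m)
      (fun i e => heavyLoop K (t i).M (t i).L r n₁ n₂ (Λ i) (p e) (q e)) x
      (3 - 2 * ((n₁ : ℤ) + n₂)) := by
  obtain ⟨T, hT, hTF⟩ := (hp.comp (ContinuousLinearMap.fst ℝ E Momentum)).exists_config
    ((hq.comp (ContinuousLinearMap.fst ℝ E Momentum)).snocTwo (2 * n₂)
    (ContinuousLinearMap.snd ℝ E Momentum) (-ContinuousLinearMap.snd ℝ E Momentum)) n₁ (n₂ + 1)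
  obtain ⟨A₀, hA₀, hD⟩ := exists_bound_heavyDot hK
  have hz : ∀ i, ¬ (t i).M ≤ Λ i →
      (fun e => heavyLoop K (t i).M (t i).L r n₁ n₂ (Λ i) (p e) (q e)) = fun _ => 0 := by
    intro i hi
    funext e
    rw [heavyLoop, heavyDot_eq_zero hK (h0 i) (not_le.1 hi)]
    simp
  refine IsSymbol.of_subtype (one_le_lg h0) (scale_pos h0) (fun i => (t i).M ≤ Λ i)
    (fun i hi => ?_) ?_ (fun i hi => ?_)
  · rw [hz i hi]; exact contDiff_const
  swap
  · rw [hz i hi]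
  refine ((IsSymbol.loop_clm (ι := {i // (t i).M ≤ Λ i}) (x := fun i => x i)
    (a := 4 - 2 * ((n₁ : ℤ) + (n₂ + 1 : ℕ)))
    (D := fun i => heavyDot K (t i).M (Λ i)) (F := fun i => (t i).L r n₁ (n₂ + 1) (Λ i))
    (fun i => one_le_lg (n₂ := n₂) h0 i.1) (fun i => scale_pos h0 i.1) (fun i => h0 i.1)
    (fun i => by linarith [(t i).m_pos])
    (fun i => ?_) (fun i ℓ hℓ => heavyDot_eq_zero_of_norm hK (t i).M_pos (h0 i) hℓ)
    hA₀ (fun i ℓ => hD (t i) (Λ i) (h0 i) ℓ) T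
    (fun i => (t i).smooth r (by omega) (h0 i).le (h1 i)) ?_).const_mul
    ((2 * Real.pi) ^ 4)⁻¹).congr (fun i => ?_) (by push_cast; ring)
  · rw [heavyDot_eq hK (t i).M_pos (h0 i)]; exact contDiff_propagatorDot hK (t i).M_pos
  · refine VertexBound.isSymbol_of_le
      (ι := {y : {i // (t i).M ≤ Λ i} × Momentum // ‖y.2‖ ≤ 2 * Λ y.1})
      (t := fun y => t y.1.1) (Λ := fun y => Λ y.1.1) hL (by omega)
      (fun y => h0 _) (fun y => h1 _) (fun y => y.1.1.2) (C := C) (by linarith) ?_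
    rintro ⟨⟨⟨i, hi⟩, ℓ⟩, hℓ⟩
    dsimp only at hℓ ⊢
    have hℓ' : ‖ℓ‖ ≤ C * (Λ i + (t i).M) := by nlinarith [h0 i, (t i).M_pos]
    refine Theory.mem_region_of_legs (hpx i) ?_ (hT (x i, ℓ))
    intro j hj
    simp only [snocTwo]
    split_ifs
    · simpa using hqx i j (by assumption)
    · simpa using hℓ'
    · simpa using hℓ'
  · funext e
    unfold heavyLoop
    rw [div_eq_inv_mul]
    congr 1
    refine integral_congr_ae (Filter.Eventually.of_forall fun ℓ => ?_)
    exact congrArg (heavyDot K (t i).M (Λ i) ℓ * ·)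
      (hTF ((t i).L r n₁ (n₂ + 1) (Λ i)) (e, ℓ)).symm

/-- The orders add up to $-3+4+4-2(|n|+1)$. The line momentum may contain heavy momenta of size `M`,
so it is controlled by `Λ + m` only through the support of the propagator; where it exceeds `2 * Λ`
the product vanishes near the point. Both vertices have light legs and so are not heavy two-point
vertices. -/
theorem isSymbol_lightTree (hK : IsCutoffProfile K) (h0 : ∀ i, 0 < Λ i)
    (h1 : ∀ i, Λ i ≤ (t i).Λ₀) (ha : 1 ≤ a) (ha' : 1 ≤ a') (haa : a + a' = n₁ + 1)
    (hbb : b + b' = n₂) (hs : ∀ z, VertexBound K s a b z) (hu : ∀ z, VertexBound K u a' b' z)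
    (hp : IsLinearSeq p) (hq : IsLinearSeq q) (hC : 2 ≤ C)
    (hpx : ∀ i, ∀ j < 2 * n₁, ‖p (x i) j‖ ≤ C * (Λ i + (t i).m))
    (hqx : ∀ i, ∀ j < 2 * n₂, ‖q (x i) j‖ ≤ C * (Λ i + (t i).M)) :
    IsSymbol (fun i => (t i).lg n₂ (Λ i)) (fun i => Λ i + (t i).m)
      (fun i e => lightTree K (t i).m (t i).L s u a a' b b' (Λ i) (p e) (q e)) x
      (3 - 2 * ((n₁ : ℤ) + n₂)) := by
  obtain ⟨S₁, hS₁⟩ := hp.exists_sum (Finset.range (2 * a - 1))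
  obtain ⟨S₂, hS₂⟩ := hq.exists_sum (Finset.range (2 * b))
  obtain ⟨P, hP⟩ : ∃ P : E →L[ℝ] Momentum, P = -S₁ - S₂ := ⟨_, rfl⟩
  have hPe : ∀ e, -(∑ i ∈ Finset.range (2 * a - 1), p e i) -
      ∑ i ∈ Finset.range (2 * b), q e i = P e := fun e => by simp [hP, hS₁, hS₂]
  obtain ⟨T, hT, hTF⟩ := (hp.snocFrom 0 (2 * a - 1) P).exists_config hq a b
  obtain ⟨T', hT', hTF'⟩ := (hp.snocFrom (2 * a - 1) (2 * a' - 1) (-P)).exists_config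
    (hq.shift fun i => 2 * b + i) a' b'
  have hfun : ∀ i, (fun e => lightDot K (t i).m (Λ i) (P e) * (t i).L s a b (Λ i) (T e) *
      (t i).L u a' b' (Λ i) (T' e)) =
      fun e => lightTree K (t i).m (t i).L s u a a' b b' (Λ i) (p e) (q e) := by
    intro i
    funext e
    rw [lightTree]
    simp only [hPe]
    exact congrArg₂ (lightDot K (t i).m (Λ i) (P e) * · * ·) (hTF _ e).symm (hTF' _ e).symm
  have hD : ∀ i, ContDiff ℝ ∞ (lightDot K (t i).m (Λ i)) := fun i => by
    rw [lightDot_eq hK (t i).m_pos (h0 i)]; exact contDiff_propagatorDot hK (t i).m_pos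
  refine IsSymbol.congr (a := 3 - 2 * ((n₁ : ℤ) + n₂)) ?_ hfun rfl
  refine IsSymbol.of_subtype (one_le_lg h0) (scale_pos h0) (fun i => ‖P (x i)‖ ≤ 2 * Λ i)
    (fun i _ => (((hD i).comp P.contDiff).mul (((t i).smooth s (by omega) (h0 i).le (h1 i)).comp
      T.contDiff)).mul (((t i).smooth u (by omega) (h0 i).le (h1 i)).comp T'.contDiff))
    ?_ (fun i hi => ?_)
  swap
  · filter_upwards [(isOpen_lt continuous_const P.continuous.norm).mem_nhds (not_le.1 hi)] with e he
    rw [lightDot_eq_zero hK (t i).m_pos (h0 i) he]; simp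
  have hPx : ∀ i : {i // ‖P (x i)‖ ≤ 2 * Λ i}, ‖P (x i)‖ ≤ C * (Λ i + (t i).m) := fun i => by
    nlinarith [h0 i, (t i).m_pos, i.2]
  have hg : ∀ i : {i // ‖P (x i)‖ ≤ 2 * Λ i}, 1 ≤ (t i).lg n₂ (Λ i) :=
    fun i => one_le_lg h0 i.1
  have hρ : ∀ i : {i // ‖P (x i)‖ ≤ 2 * Λ i}, 0 < Λ i + (t i).m :=
    fun i => scale_pos h0 i.1
  have V₁ := IsSymbol.comp_clm P (isSymbol_lightDot (ι := {i // ‖P (x i)‖ ≤ 2 * Λ i})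
    (t := fun i => t i) (Λ := fun i => Λ i) hK (fun i => h0 i) (fun i => (t i).lg n₂ (Λ i))
    fun i => P (x i))
  have V₂ := IsSymbol.comp_clm T (VertexBound.isSymbol (ι := {i // ‖P (x i)‖ ≤ 2 * Λ i}) (n₂ := n₂)
    (t := fun i => t i) (Λ := fun i => Λ i) (C := C) (x := fun i => T (x i)) hs
    (by omega) (by omega) (by omega) (fun i => h0 i) (fun i => h1 i) (by linarith) (fun i => by
      refine Theory.mem_region_of_legs (fun j hj => ?_) (fun j hj => hqx i j (by omega)) (hT (x i))
      simp only [snocFrom]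
      split_ifs
      · exact hpx i _ (by omega)
      · exact hPx i))
  have V₃ := IsSymbol.comp_clm T' (VertexBound.isSymbol (ι := {i // ‖P (x i)‖ ≤ 2 * Λ i}) (n₂ := n₂)
    (t := fun i => t i) (Λ := fun i => Λ i) (C := C) (x := fun i => T' (x i)) hu
    (by omega) (by omega) (by omega) (fun i => h0 i) (fun i => h1 i) (by linarith) (fun i => by
      refine Theory.mem_region_of_legs (fun j hj => ?_) (fun j hj => hqx i _ (by omega)) (hT' (x i))
      simp only [snocFrom]
      split_ifs
      · exact hpx i _ (by omega)
      · simpa using hPx i))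
  exact ((V₁.mul hg hρ V₂).mul hg hρ V₃).congr (fun i => rfl) (by omega)

/-- Two restrictions are made at once: `M ≤ Λ`, which admits heavy two-point vertices, and the
momentum support of the line. -/
theorem isSymbol_heavyTree (hK : IsCutoffProfile K) (h0 : ∀ i, 0 < Λ i)
    (h1 : ∀ i, Λ i ≤ (t i).Λ₀) (hb : 1 ≤ b) (hb' : 1 ≤ b') (haa : a + a' = n₁)
    (hbb : b + b' = n₂ + 1) (hs : ∀ z, VertexBound K s a b z) (hu : ∀ z, VertexBound K u a' b' z)
    (hp : IsLinearSeq p) (hq : IsLinearSeq q) (hC : 2 ≤ C)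
    (hpx : ∀ i, ∀ j < 2 * n₁, ‖p (x i) j‖ ≤ C * (Λ i + (t i).m))
    (hqx : ∀ i, ∀ j < 2 * n₂, ‖q (x i) j‖ ≤ C * (Λ i + (t i).M)) :
    IsSymbol (fun i => (t i).lg n₂ (Λ i)) (fun i => Λ i + (t i).m)
      (fun i e => heavyTree K (t i).M (t i).L s u a a' b b' (Λ i) (p e) (q e)) x
      (3 - 2 * ((n₁ : ℤ) + n₂)) := by
  obtain ⟨S₁, hS₁⟩ := hp.exists_sum (Finset.range (2 * a))
  obtain ⟨S₂, hS₂⟩ := hq.exists_sum (Finset.range (2 * b - 1))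
  obtain ⟨P, hP⟩ : ∃ P : E →L[ℝ] Momentum, P = -S₁ - S₂ := ⟨_, rfl⟩
  have hPe : ∀ e, -(∑ i ∈ Finset.range (2 * a), p e i) -
      ∑ i ∈ Finset.range (2 * b - 1), q e i = P e := fun e => by simp [hP, hS₁, hS₂]
  obtain ⟨T, hT, hTF⟩ := hp.exists_config (hq.snocFrom 0 (2 * b - 1) P) a b
  obtain ⟨T', hT', hTF'⟩ := (hp.shift fun i => 2 * a + i).exists_config
    (hq.snocFrom (2 * b - 1) (2 * b' - 1) (-P)) a' b'
  have hfun : ∀ i, (fun e => heavyDot K (t i).M (Λ i) (P e) * (t i).L s a b (Λ i) (T e) *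
      (t i).L u a' b' (Λ i) (T' e)) =
      fun e => heavyTree K (t i).M (t i).L s u a a' b b' (Λ i) (p e) (q e) := by
    intro i
    funext e
    rw [heavyTree]
    simp only [hPe]
    exact congrArg₂ (heavyDot K (t i).M (Λ i) (P e) * · * ·) (hTF _ e).symm (hTF' _ e).symm
  have hD : ∀ i, ContDiff ℝ ∞ (heavyDot K (t i).M (Λ i)) := fun i => by
    rw [heavyDot_eq hK (t i).M_pos (h0 i)]; exact contDiff_propagatorDot hK (t i).M_pos
  refine IsSymbol.congr (a := 3 - 2 * ((n₁ : ℤ) + n₂)) ?_ hfun rfl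
  refine IsSymbol.of_subtype (one_le_lg h0) (scale_pos h0)
    (fun i => (t i).M ≤ Λ i ∧ ‖P (x i)‖ ≤ 2 * Λ i)
    (fun i _ => (((hD i).comp P.contDiff).mul (((t i).smooth s (by omega) (h0 i).le (h1 i)).comp
      T.contDiff)).mul (((t i).smooth u (by omega) (h0 i).le (h1 i)).comp T'.contDiff))
    ?_ (fun i hi => ?_)
  swap
  · by_cases hM : (t i).M ≤ Λ i
    · have hi' : 2 * Λ i < ‖P (x i)‖ := not_le.1 fun h => hi ⟨hM, h⟩
      filter_upwards [(isOpen_lt continuous_const P.continuous.norm).mem_nhds hi'] with e he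
      rw [heavyDot_eq_zero_of_norm hK (t i).M_pos (h0 i) he]; simp
    · refine Filter.Eventually.of_forall fun e => ?_
      rw [heavyDot_eq_zero hK (h0 i) (not_le.1 hM)]; simp
  have hPx : ∀ i : {i // (t i).M ≤ Λ i ∧ ‖P (x i)‖ ≤ 2 * Λ i},
      ‖P (x i)‖ ≤ C * (Λ i + (t i).M) := fun i => by
    nlinarith [h0 i, (t i).M_pos, i.2.2]
  have hg : ∀ i : {i // (t i).M ≤ Λ i ∧ ‖P (x i)‖ ≤ 2 * Λ i}, 1 ≤ (t i).lg n₂ (Λ i) :=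
    fun i => one_le_lg h0 i.1
  have hρ : ∀ i : {i // (t i).M ≤ Λ i ∧ ‖P (x i)‖ ≤ 2 * Λ i}, 0 < Λ i + (t i).m :=
    fun i => scale_pos h0 i.1
  have V₁ := IsSymbol.comp_clm P (isSymbol_heavyDot (ι := {i // (t i).M ≤ Λ i ∧ ‖P (x i)‖ ≤ 2 * Λ i})
    (t := fun i => t i) (Λ := fun i => Λ i) hK (fun i => h0 i) (fun i => (t i).lg n₂ (Λ i))
    fun i => P (x i))
  have V₂ := IsSymbol.comp_clm T (VertexBound.isSymbol_of_le (ι := {i // (t i).M ≤ Λ i ∧ ‖P (x i)‖ ≤ 2 * Λ i}) (n₂ := n₂)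
    (t := fun i => t i) (Λ := fun i => Λ i) (C := C) (x := fun i => T (x i)) hs
    (by omega) (fun i => h0 i) (fun i => h1 i) (fun i => i.2.1) (by linarith) (fun i => by
      refine Theory.mem_region_of_legs (fun j hj => hpx i j (by omega)) (fun j hj => ?_) (hT (x i))
      simp only [snocFrom]
      split_ifs
      · exact hqx i _ (by omega)
      · exact hPx i))
  have V₃ := IsSymbol.comp_clm T' (VertexBound.isSymbol_of_le (ι := {i // (t i).M ≤ Λ i ∧ ‖P (x i)‖ ≤ 2 * Λ i}) (n₂ := n₂)
    (t := fun i => t i) (Λ := fun i => Λ i) (C := C) (x := fun i => T' (x i)) hu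
    (by omega) (fun i => h0 i) (fun i => h1 i) (fun i => i.2.1) (by linarith) (fun i => by
      refine Theory.mem_region_of_legs (fun j hj => hpx i _ (by omega)) (fun j hj => ?_) (hT' (x i))
      simp only [snocFrom]
      split_ifs
      · exact hqx i _ (by omega)
      · simpa using hPx i))
  exact ((V₁.mul hg hρ V₂).mul hg hρ V₃).congr (fun i => rfl) (by omega)

theorem IsSymbol.symmetrize (hg : ∀ i, 1 ≤ (t i).lg n₂ (Λ i)) (hρ : ∀ i, 0 < Λ i + (t i).m)
    {F : ι → (ℕ → Momentum) → (ℕ → Momentum) → ℝ} {w : ℤ} {x : ι → Config n₁ n₂}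
    (h : ∀ (σ : Equiv.Perm (Fin (2 * n₁))) (τ : Equiv.Perm (Fin (2 * n₂))),
      IsSymbol (fun i => (t i).lg n₂ (Λ i)) (fun i => Λ i + (t i).m)
        (fun i k => F i (permute σ (lightLegs k)) (permute τ (heavyLegs k))) x w) :
    IsSymbol (fun i => (t i).lg n₂ (Λ i)) (fun i => Λ i + (t i).m)
        (fun i k => symmetrize n₁ n₂ (F i) (lightLegs k) (heavyLegs k)) x w := by
  refine IsSymbol.congr (IsSymbol.const_mul
    (((2 * n₁).factorial * (2 * n₂).factorial : ℝ)⁻¹) (IsSymbol.sum hg hρ (s := Finset.univ)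
    fun σ _ => IsSymbol.sum hg hρ (s := Finset.univ) fun τ _ => h σ τ)) (fun i => ?_) rfl
  funext k
  rw [TwoScalar.symmetrize, div_eq_inv_mul]

theorem sum_lt_of_le_of_ne {s r : Fin 3 → ℕ} (h : s ≤ r) (hne : s ≠ r) : ∑ i, s i < ∑ i, r i := by
  obtain ⟨-, i, hi⟩ := Pi.lt_def.1 (lt_of_le_of_ne h hne)
  exact Finset.sum_lt_sum (fun j _ => h j) ⟨i, Finset.mem_univ i, hi⟩

theorem eq_or_lt_of_mem_Iic (hs : s ∈ Finset.Iic r) :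
    s = 0 ∨ r - s = 0 ∨ (∑ i, s i < ∑ i, r i ∧ ∑ i, (r - s) i < ∑ i, r i) := by
  have hle : s ≤ r := Finset.mem_Iic.1 hs
  by_cases h0 : s = 0
  · exact Or.inl h0
  by_cases h1 : r = s
  · exact Or.inr (Or.inl (by simp [h1]))
  refine Or.inr (Or.inr ⟨sum_lt_of_le_of_ne hle (Ne.symm h1), sum_lt_of_le_of_ne ?_ ?_⟩)
  · exact fun i => Nat.sub_le _ _
  · intro h
    apply h0
    funext i
    have h2 : r i - s i = r i := congrFun h i
    have h3 : s i ≤ r i := hle i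
    change s i = 0
    omega

/-- The right-hand side of the flow equation is one order below the vertex. -/
theorem isSymbol_flowRHS (hK : IsCutoffProfile K) (h0 : ∀ i, 0 < Λ i) (h1 : ∀ i, Λ i ≤ (t i).Λ₀)
    (hfree : ∀ (t : Theory K) (l₁ l₂ : ℕ), 1 ≤ l₁ + l₂ → ∀ Λ, 0 ≤ Λ → Λ ≤ t.Λ₀ → ∀ k,
      t.L 0 l₁ l₂ Λ k = 0)
    (hlow : ∀ s : Fin 3 → ℕ, ∑ i, s i < ∑ i, r i → ∀ l₁ l₂, 1 ≤ l₁ + l₂ →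
      ∀ z, VertexBound K s l₁ l₂ z)
    (hL : ∀ z, VertexBound K r (n₁ + 1) n₂ z) (hH : ∀ z, VertexBound K r n₁ (n₂ + 1) z)
    (hC : 0 ≤ C) {x : ι → Config n₁ n₂} (hx : ∀ i, x i ∈ (t i).region C (Λ i) n₁ n₂) :
    IsSymbol (fun i => (t i).lg n₂ (Λ i)) (fun i => Λ i + (t i).m)
      (fun i k => flowRHS K (t i).m (t i).M (t i).L r n₁ n₂ (Λ i) (lightLegs k) (heavyLegs k)) x
      (3 - 2 * ((n₁ : ℤ) + n₂)) := by
  have hg : ∀ i, 1 ≤ (t i).lg n₂ (Λ i) := one_le_lg h0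
  have hρ : ∀ i, 0 < Λ i + (t i).m := scale_pos h0
  -- The first summand covers the dependent leg; the 2 makes the region contain every momentum in
  -- the support of a propagator.
  obtain ⟨C', hC'⟩ : ∃ C', C' = (2 * n₁ + 2 * n₂) * C + 2 := ⟨_, rfl⟩
  have hC2 : 2 ≤ C' := by rw [hC']; have : 0 ≤ (2 * n₁ + 2 * n₂) * C := by positivity
                          linarith
  have hp : ∀ i, ∀ j < 2 * n₁, ‖lightLegs (x i) j‖ ≤ C' * (Λ i + (t i).m) := fun i j hj => by
    have := Theory.norm_leg_le hC (h0 i).le (hx i) (i := j) (X := (t i).m) (Or.inl ⟨rfl, hj⟩)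
    refine this.trans ?_
    rw [hC']
    have := hρ i
    gcongr
    linarith
  have hq : ∀ i, ∀ j < 2 * n₂, ‖heavyLegs (x i) j‖ ≤ C' * (Λ i + (t i).M) := fun i j hj => by
    have := Theory.norm_leg_le hC (h0 i).le (hx i) (i := 2 * n₁ + j) (X := (t i).M) (Or.inr rfl)
    refine this.trans ?_
    rw [hC']
    have := h0 i
    have := (t i).M_pos
    gcongr
    linarith
  have hpσ : ∀ σ : Equiv.Perm (Fin (2 * n₁)), ∀ i, ∀ j < 2 * n₁,
      ‖permute σ (lightLegs (x i)) j‖ ≤ C' * (Λ i + (t i).m) := fun σ i j hj => by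
    rw [permute, dif_pos hj]; exact hp i _ (σ ⟨j, hj⟩).2
  have hqτ : ∀ τ : Equiv.Perm (Fin (2 * n₂)), ∀ i, ∀ j < 2 * n₂,
      ‖permute τ (heavyLegs (x i)) j‖ ≤ C' * (Λ i + (t i).M) := fun τ i j hj => by
    rw [permute, dif_pos hj]; exact hq i _ (τ ⟨j, hj⟩).2
  have lp := isLinearSeq_lightLegs n₁ n₂
  have lq := isLinearSeq_heavyLegs n₁ n₂
  have z0 : ∀ {l₁ l₂}, 1 ≤ l₁ + l₂ → ∀ i F (p q : ℕ → Momentum), F = (t i).L 0 l₁ l₂ (Λ i) →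
      atLegs F p q = 0 := fun hl i F p q hF => by
    rw [hF]; exact hfree (t i) _ _ hl _ (h0 i).le (h1 i) _
  have T₁ := (isSymbol_lightLoop hK h0 h1 hL lp lq hC2 hp hq).const_mul
    (-((2 * n₁ + 2).choose 2 : ℝ))
  have T₃ := (isSymbol_heavyLoop hK h0 h1 hH lp lq hC2 hp hq).const_mul
    (-((2 * n₂ + 2).choose 2 : ℝ))
  have T₂ : IsSymbol (fun i => (t i).lg n₂ (Λ i)) (fun i => Λ i + (t i).m)
      (fun i (k : Config n₁ n₂) => 2 * ∑ s ∈ Finset.Iic r,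
        ∑ a ∈ Finset.HasAntidiagonal.antidiagonal (n₁ + 1),
        ∑ b ∈ Finset.HasAntidiagonal.antidiagonal n₂, (a.1 : ℝ) * a.2 *
          symmetrize n₁ n₂ (lightTree K (t i).m (t i).L s (r - s) a.1 a.2 b.1 b.2 (Λ i))
            (lightLegs k) (heavyLegs k)) x (3 - 2 * ((n₁ : ℤ) + n₂)) := by
    refine (IsSymbol.sum hg hρ fun s hs => IsSymbol.sum hg hρ fun a ha =>
      IsSymbol.sum hg hρ fun b hb => ?_).const_mul 2
    have haa := Finset.HasAntidiagonal.mem_antidiagonal.1 ha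
    have hbb := Finset.HasAntidiagonal.mem_antidiagonal.1 hb
    -- A vertex without light legs has coefficient zero here. This also removes the vertices without
    -- any legs, about which nothing is assumed.
    by_cases h1a : a.1 = 0
    · simpa [h1a] using IsSymbol.zero
    by_cases h2a : a.2 = 0
    · simpa [h2a] using IsSymbol.zero
    refine IsSymbol.const_mul _ (IsSymbol.symmetrize hg hρ fun σ τ => ?_)
    -- Either one factor has order zero and kills the product, or both orders are strictly lower and
    -- the induction hypothesis applies.
    rcases eq_or_lt_of_mem_Iic hs with h | h | ⟨h, h'⟩
    · refine IsSymbol.zero.congr (fun i => ?_) rfl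
      funext k
      simp only [lightTree]
      rw [z0 (by omega) i _ _ _ (by rw [h])]
      simp
    · refine IsSymbol.zero.congr (fun i => ?_) rfl
      funext k
      simp only [lightTree]
      rw [z0 (l₁ := a.2) (l₂ := b.2) (by omega) i ((t i).L (r - s) a.2 b.2 (Λ i)) _ _ (by rw [h])]
      simp
    · exact isSymbol_lightTree hK h0 h1 (by omega) (by omega) haa hbb
        (hlow s h _ _ (by omega)) (hlow (r - s) h' _ _ (by omega)) (lp.permute σ) (lq.permute τ)
        hC2 (hpσ σ) (hqτ τ)
  have T₄ : IsSymbol (fun i => (t i).lg n₂ (Λ i)) (fun i => Λ i + (t i).m)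
      (fun i (k : Config n₁ n₂) => 2 * ∑ s ∈ Finset.Iic r,
        ∑ a ∈ Finset.HasAntidiagonal.antidiagonal n₁,
        ∑ b ∈ Finset.HasAntidiagonal.antidiagonal (n₂ + 1), (b.1 : ℝ) * b.2 *
          symmetrize n₁ n₂ (heavyTree K (t i).M (t i).L s (r - s) a.1 a.2 b.1 b.2 (Λ i))
            (lightLegs k) (heavyLegs k)) x (3 - 2 * ((n₁ : ℤ) + n₂)) := by
    refine (IsSymbol.sum hg hρ fun s hs => IsSymbol.sum hg hρ fun a ha =>
      IsSymbol.sum hg hρ fun b hb => ?_).const_mul 2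
    have haa := Finset.HasAntidiagonal.mem_antidiagonal.1 ha
    have hbb := Finset.HasAntidiagonal.mem_antidiagonal.1 hb
    by_cases h1b : b.1 = 0
    · simpa [h1b] using IsSymbol.zero
    by_cases h2b : b.2 = 0
    · simpa [h2b] using IsSymbol.zero
    refine IsSymbol.const_mul _ (IsSymbol.symmetrize hg hρ fun σ τ => ?_)
    rcases eq_or_lt_of_mem_Iic hs with h | h | ⟨h, h'⟩
    · refine IsSymbol.zero.congr (fun i => ?_) rfl
      funext k
      simp only [heavyTree]
      rw [z0 (by omega) i _ _ _ (by rw [h])]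
      simp
    · refine IsSymbol.zero.congr (fun i => ?_) rfl
      funext k
      simp only [heavyTree]
      rw [z0 (l₁ := a.2) (l₂ := b.2) (by omega) i ((t i).L (r - s) a.2 b.2 (Λ i)) _ _ (by rw [h])]
      simp
    · exact isSymbol_heavyTree hK h0 h1 (by omega) (by omega) haa hbb
        (hlow s h _ _ (by omega)) (hlow (r - s) h' _ _ (by omega)) (lp.permute σ) (lq.permute τ)
        hC2 (hpσ σ) (hqτ τ)
  refine (((T₁.add hg hρ T₂).add hg hρ T₃).add hg hρ T₄).congr (fun i => ?_) rfl
  funext k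
  unfold flowRHS
  ring

end Flow

/-! ### The vertices of order zero vanish -/

/-- Grönwall's inequality run backwards, by reflecting the interval. The derivative is not needed at
`0`, where the formula for the scale derivative of the propagators is not available. -/
theorem eq_zero_of_hasDerivWithinAt_of_right_eq_zero {y y' : ℝ → ℝ} {b B : ℝ}
    (hy : ContinuousOn y (Icc 0 b))
    (hd : ∀ l ∈ Ioc 0 b, HasDerivWithinAt y (y' l) (Icc 0 b) l)
    (hB : ∀ l ∈ Ioc 0 b, |y' l| ≤ B * |y l|) (h0 : y b = 0) : ∀ l ∈ Icc 0 b, y l = 0 := by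
  have hmap : MapsTo (fun s => b - s) (Icc 0 b) (Icc 0 b) := fun s hs =>
    ⟨by linarith [hs.2], by linarith [hs.1]⟩
  have key := eq_zero_of_abs_deriv_le_mul_abs_self_of_eq_zero_right (f := fun s => y (b - s))
    (f' := fun s => -y' (b - s)) (K := B) (a := 0) (b := b)
    (hy.comp (by fun_prop) hmap) (fun s hs => ?_) (by simpa using h0) (fun s hs => ?_)
  · intro l hl
    simpa using key (b - l) (hmap hl)
  · have h1 := hd (b - s) ⟨by linarith [hs.2], by linarith [hs.1]⟩
    have h2 : HasDerivWithinAt (fun s => b - s) (-1) (Icc 0 b) s :=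
      ((hasDerivAt_id s).const_sub b).hasDerivWithinAt
    have h3 := h1.scomp s h2 hmap
    refine (h3.mono_of_mem_nhdsWithin ?_).congr_deriv (by simp)
    exact Filter.mem_of_superset (Icc_mem_nhdsGE hs.2) (Icc_subset_Icc_left hs.1)
  · simpa using hB (b - s) ⟨by linarith [hs.2], by linarith [hs.1]⟩

/-- Since `Q` is bounded and `f` tends to zero, the relation gives $f(s)=\beta s^2+o(s^2)$. The
first derivative of `f` is not known, so the even part is used: `f s + f (-s)` is $2\beta
s^2+o(s^2)$ by this and $o(s^2)$ by Taylor's formula. -/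
theorem coeff_eq_zero_of_second_deriv {f Q : ℝ → ℝ} {β B : ℝ} (hf : ContDiff ℝ 2 f) (h0 : f 0 = 0)
    (h2 : iteratedDeriv 2 f 0 = 0) (hQ : ∀ s, |Q s| ≤ B)
    (heq : ∀ s, f s * (1 + 2 * (β * s ^ 2) * Q s) = β * s ^ 2) : β = 0 := by
  have ht := taylor_isLittleO_univ (x₀ := 0) (n := 2) (by exact_mod_cast hf)
  have hT : ∀ s, taylorWithinEval f 2 univ 0 s = deriv f 0 * s := by
    intro s
    rw [taylorWithinEval_succ, taylorWithinEval_succ, taylor_within_zero_eval]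
    simp only [iteratedDerivWithin_univ]
    norm_num [h0, h2, iteratedDeriv_one, mul_comm]
  have h3 : (fun s => f s - deriv f 0 * s) =o[nhds 0] fun s => s ^ 2 := by
    simpa only [hT, sub_zero] using ht
  have hneg : Filter.Tendsto (fun s : ℝ => -s) (nhds 0) (nhds 0) := by
    simpa using (continuous_neg (G := ℝ)).tendsto 0
  have h4 : (fun s => f s + f (-s)) =o[nhds 0] fun s => s ^ 2 := by
    have := h3.comp_tendsto hneg
    refine ((h3.add (this.congr_right (fun s => by simp))).congr_left fun s => ?_)
    simp [Function.comp]
  have h5 : ∀ s, f s = β * s ^ 2 - 2 * β * s ^ 2 * Q s * f s := fun s => by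
    linear_combination heq s
  have hfl : f =o[nhds 0] (fun _ => (1 : ℝ)) := by
    rw [Asymptotics.isLittleO_one_iff]
    simpa [h0] using hf.continuous.tendsto 0
  have hQb : Q =O[nhds 0] (fun _ => (1 : ℝ)) :=
    Asymptotics.IsBigO.of_bound B (Filter.Eventually.of_forall fun s => by simpa using hQ s)
  have h6 : (fun s => 2 * β * s ^ 2 * Q s * f s) =o[nhds 0] fun s => s ^ 2 := by
    have := (((Asymptotics.isBigO_refl (fun s : ℝ => s ^ 2) (nhds 0)).const_mul_left
      (2 * β)).mul hQb).mul_isLittleO hfl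
    simpa using this
  have h7 : (fun s => f s - β * s ^ 2) =o[nhds 0] fun s => s ^ 2 := by
    refine h6.neg_left.congr_left fun s => ?_
    linear_combination -h5 s
  have h8 : (fun s : ℝ => 2 * β * s ^ 2) =o[nhds 0] fun s => s ^ 2 := by
    have := h7.comp_tendsto hneg
    refine ((h4.sub (h7.add (this.congr_right fun s => by simp))).congr_left fun s => ?_)
    simp [Function.comp]
    ring
  by_contra hβ
  have h9 : (fun s : ℝ => s ^ 2) =o[nhds 0] fun s => s ^ 2 :=
    (Asymptotics.isLittleO_const_mul_left_iff (mul_ne_zero two_ne_zero hβ)).1 h8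
  have h10 := Asymptotics.isLittleO_irrefl (f'' := fun s : ℝ => s ^ 2) (l := nhds 0) ?_ h9
  · exact h10
  · rw [Filter.frequently_iff]
    intro U hU
    obtain ⟨ε, hε, hs⟩ := Metric.mem_nhds_iff.1 hU
    refine ⟨ε / 2, hs ?_, by positivity⟩
    simp [abs_of_pos hε]
    linarith

/-- The Riccati equation integrates to the relation `rel` between the values at both ends of the
flow. The value condition at `x` gives $\alpha+\beta\|x\|^2=0$, so along the line through `x` in the
direction `e` the bare function is $\beta s^2$; the second-derivative condition then gives `β = 0`,
hence `α = 0`, and uniqueness makes the whole flow vanish. -/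
theorem eq_zero_of_riccati {u D P : ℝ → Momentum → ℝ} {Λ₀ α β B : ℝ} (hΛ₀ : 0 < Λ₀)
    (hcont : ∀ p, ContinuousOn (fun l => u l p) (Icc 0 Λ₀))
    (hu : ∀ p, ∀ l ∈ Ioc 0 Λ₀, HasDerivWithinAt (fun l => u l p) (2 * D l p * u l p ^ 2)
      (Icc 0 Λ₀) l)
    (hP : ∀ p, ContinuousOn (fun l => P l p) (Icc 0 Λ₀)) (hP0 : ∀ p, P 0 p = 0)
    (hPd : ∀ p, ∀ l ∈ Ioc 0 Λ₀, HasDerivAt (fun l => P l p) (D l p) l)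
    (hPb : ∀ p, |P Λ₀ p| ≤ B) (hDb : ∀ p, ∃ A, ∀ l ∈ Ioc 0 Λ₀, |D l p| ≤ A)
    (hbare : ∀ p, u Λ₀ p = α + β * ‖p‖ ^ 2) (hsm : ContDiff ℝ ∞ (u 0)) {x e : Momentum}
    (he : ‖e‖ = 1) (hxe : inner ℝ x e = 0) (hx : u 0 x = 0)
    (hx2 : iteratedFDeriv ℝ 2 (u 0) x (fun _ => e) = 0) : ∀ l ∈ Icc 0 Λ₀, ∀ p, u l p = 0 := by
  have hbd : ∀ p, ∃ A, ∀ l ∈ Ioc 0 Λ₀, |2 * D l p * u l p| ≤ A := by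
    intro p
    obtain ⟨A, hA⟩ := hDb p
    obtain ⟨A', hA'⟩ := isCompact_Icc.exists_bound_of_continuousOn (hcont p)
    refine ⟨2 * A * A', fun l hl => ?_⟩
    rw [abs_mul, abs_mul, abs_two]
    have h1 := hA l hl
    have h2 : |u l p| ≤ A' := hA' l (Ioc_subset_Icc_self hl)
    have : 0 ≤ A := (abs_nonneg _).trans h1
    gcongr
  have rel : ∀ p, u 0 p * (1 + 2 * u Λ₀ p * P Λ₀ p) = u Λ₀ p := by
    intro p
    obtain ⟨A, hA⟩ := hbd p
    -- The solution formula for $1/u$ is multiplied out to avoid division: the defect `y` satisfies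
    -- the linear equation $y'=2Du\,y$ and vanishes at `Λ₀`.
    have := eq_zero_of_hasDerivWithinAt_of_right_eq_zero
      (y := fun l => u l p * (1 + 2 * u Λ₀ p * (P Λ₀ p - P l p)) - u Λ₀ p)
      (y' := fun l => 2 * D l p * u l p * (u l p * (1 + 2 * u Λ₀ p * (P Λ₀ p - P l p)) - u Λ₀ p))
      (b := Λ₀) (B := A) (((hcont p).mul (continuousOn_const.add (continuousOn_const.mul
        (continuousOn_const.sub (hP p))))).sub continuousOn_const) (fun l hl => ?_) (fun l hl => ?_)
      (by simp) 0 (left_mem_Icc.2 hΛ₀.le)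
    · rw [hP0] at this
      linear_combination this
    · have h1 := hu p l hl
      have h2 := (hPd p l hl).hasDerivWithinAt (s := Icc 0 Λ₀)
      refine ((h1.mul (((h2.const_sub (P Λ₀ p)).const_mul (2 * u Λ₀ p)).const_add 1)).sub_const
        (u Λ₀ p)).congr_deriv ?_
      ring
    · rw [abs_mul]
      gcongr
      exact hA l hl
  have hb0 : α + β * ‖x‖ ^ 2 = 0 := by
    have := rel x
    rw [hx, zero_mul, hbare] at this
    exact this.symm
  have hβ : β = 0 := by
    let T : ℝ →L[ℝ] Momentum := (ContinuousLinearMap.id ℝ ℝ).smulRight e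
    have hT : ∀ s, T s = s • e := fun s => by simp [T]
    have hsm' : ContDiff ℝ ∞ fun p => u 0 (p + x) := hsm.comp (contDiff_id.add contDiff_const)
    have hf : ContDiff ℝ ∞ ((fun p => u 0 (p + x)) ∘ T) := hsm'.comp T.contDiff
    refine coeff_eq_zero_of_second_deriv (f := (fun p => u 0 (p + x)) ∘ T)
      (Q := fun s => P Λ₀ (T s + x)) (B := B) (hf.of_le (natCast_le_infty 2)) ?_ ?_
      (fun s => hPb _) (fun s => ?_)
    · simp [hx]
    · rw [iteratedDeriv_eq_iteratedFDeriv, T.iteratedFDeriv_comp_right hsm' _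
        (natCast_le_infty 2), iteratedFDeriv_comp_add_right]
      simpa [hT] using hx2
    · have := rel (T s + x)
      have hn : α + β * ‖T s + x‖ ^ 2 = β * s ^ 2 := by
        rw [norm_add_sq_real, hT, inner_smul_left, real_inner_comm, hxe, norm_smul, he]
        simp
        linear_combination hb0
      rw [hbare, hn] at this
      exact this
  have hα : α = 0 := by simpa [hβ] using hb0
  intro l hl p
  obtain ⟨A, hA⟩ := hbd p
  refine eq_zero_of_hasDerivWithinAt_of_right_eq_zero (y := fun l => u l p)
    (y' := fun l => 2 * D l p * u l p ^ 2) (B := A) (hcont p)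
    (hu p) (fun l hl => ?_) (by simp [hbare, hα, hβ]) l hl
  rw [pow_two, ← mul_assoc, abs_mul]
  gcongr
  exact hA l hl

theorem exists_unit_orthogonal (x : Momentum) : ∃ e : Momentum, ‖e‖ = 1 ∧ inner ℝ x e = 0 := by
  have hne : (Submodule.span ℝ {x})ᗮ ≠ ⊥ := by
    intro h
    have h1 := (Submodule.span ℝ {x}).finrank_add_finrank_orthogonal
    rw [h, finrank_bot, add_zero, finrank_euclideanSpace, Fintype.card_fin] at h1
    have h2 := finrank_span_le_card (R := ℝ) ({x} : Set Momentum)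
    simp at h2
    omega
  obtain ⟨y, hy, hy0⟩ := Submodule.exists_mem_ne_zero_of_ne_bot hne
  have hn : ‖y‖ ≠ 0 := norm_ne_zero_iff.2 hy0
  refine ⟨‖y‖⁻¹ • y, by rw [norm_smul, norm_inv, norm_norm, inv_mul_cancel₀ hn], ?_⟩
  rw [inner_smul_right, Submodule.mem_orthogonal_singleton_iff_inner_right.1 hy, mul_zero]

section Propagator

variable {K c : ℝ → ℝ}

theorem propagator_zero (hc : IsSwitch c) {a : ℝ} (p : Momentum) : propagator K c a 0 p = 0 := by
  rw [propagator, zero_div, hc.eq_zero 0 le_rfl]; simp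

theorem exists_bound_propagator (hK : IsCutoffProfile K) {a : ℝ} (ha : 0 < a) :
    ∃ B, ∀ l p, |propagator K c a l p| ≤ |c (l / a)| * B := by
  obtain ⟨B, hB, h⟩ := exists_bound_extProfile hK
  refine ⟨B / a ^ 2, fun l p => ?_⟩
  have h1 : 0 < ‖p‖ ^ 2 + a ^ 2 := by positivity
  rw [propagator, abs_div, abs_mul, abs_of_pos h1, ← mul_div_assoc]
  gcongr
  · exact h _
  · linarith [sq_nonneg ‖p‖]

/-- At scale zero the momentum cutoff need not be controlled beyond boundedness: the switch tends to
zero and squeezes the product. -/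
theorem continuousOn_propagator (hK : IsCutoffProfile K) (hc : IsSwitch c) {a : ℝ} (ha : 0 < a)
    (b : ℝ) (p : Momentum) : ContinuousOn (fun l => propagator K c a l p) (Icc 0 b) := by
  intro l hl
  rcases hl.1.eq_or_lt with h | h
  · obtain ⟨B, hB⟩ := exists_bound_propagator (c := c) hK ha
    subst h
    refine ContinuousAt.continuousWithinAt ?_
    rw [ContinuousAt, propagator_zero hc]
    refine squeeze_zero_norm (fun l => hB l p) ?_
    have h1 : Continuous fun l => |c (l / a)| * B :=
      ((hc.smooth.continuous.comp (continuous_id.div_const a)).abs).mul continuous_const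
    have h2 := h1.tendsto 0
    rwa [zero_div, hc.eq_zero 0 le_rfl, abs_zero, zero_mul] at h2
  · exact (hasDerivAt_propagator hK hc h p).continuousAt.continuousWithinAt

theorem exists_bound_propagatorDot_of_pos (hK : IsCutoffProfile K) (hc : IsSwitch c) {a : ℝ}
    (ha : 0 < a) : ∃ A, ∀ l, 0 < l → ∀ p, |propagatorDot K c a l p| ≤ A := by
  obtain ⟨A, hA, h⟩ := exists_bound_propagatorDot hK hc 0
  refine ⟨A * a⁻¹ ^ 3, fun l hl p => ?_⟩
  have h1 := h a l ha hl p
  rw [norm_iteratedFDeriv_zero, Real.norm_eq_abs, zpow_neg_three_sub, pow_zero, mul_one] at h1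
  refine h1.trans ?_
  gcongr
  linarith

end Propagator

theorem heavyDot_neg (K : ℝ → ℝ) (M Λ : ℝ) (p : Momentum) :
    heavyDot K M Λ (-p) = heavyDot K M Λ p := by
  simp [heavyDot, heavyPropagator, heavyCutoff]

theorem lightDot_neg (K : ℝ → ℝ) (m Λ : ℝ) (p : Momentum) :
    lightDot K m Λ (-p) = lightDot K m Λ p := by
  simp [lightDot, lightPropagator, lightCutoff]

namespace Theory

variable {K : ℝ → ℝ} (t : Theory K) {Λ : ℝ}

/-- The two legs carry `v` and `-v`; Bose symmetry exchanges them. -/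
theorem light_two_even (r : Fin 3 → ℕ) (hΛ : Λ ∈ Icc 0 t.Λ₀) (v : Momentum) :
    t.L r 1 0 Λ (fun _ => -v) = t.L r 1 0 Λ (fun _ => v) := by
  rw [← t.sol.bose r 1 0 (by norm_num) Λ hΛ (fun _ => v) (Equiv.swap ⟨0, by norm_num⟩ ⟨1, by norm_num⟩) 1]
  unfold atLegs
  congr 1
  funext i
  simp [permute, lightLegs, leg]

theorem heavy_two_even (r : Fin 3 → ℕ) (hΛ : Λ ∈ Icc 0 t.Λ₀) (v : Momentum) :
    t.L r 0 1 Λ (fun _ => -v) = t.L r 0 1 Λ (fun _ => v) := by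
  rw [← t.sol.bose r 0 1 (by norm_num) Λ hΛ (fun _ => v) 1 (Equiv.swap ⟨0, by norm_num⟩ ⟨1, by norm_num⟩)]
  unfold atLegs
  congr 1
  funext i
  simp [permute, heavyLegs, leg]

theorem free_eq_zero_of_two_le {l₁ l₂ : ℕ} (hl : 2 ≤ l₁ + l₂) (hΛ : Λ ∈ Icc 0 t.Λ₀) :
    t.L 0 l₁ l₂ Λ = 0 := by
  funext k
  exact t.sol.connected 0 l₁ l₂ (by simp only [Pi.zero_apply, Finset.sum_const_zero]; omega) Λ hΛ k

theorem atLegs_zero {n₁ n₂ : ℕ} (p q : ℕ → Momentum) : atLegs (0 : Config n₁ n₂ → ℝ) p q = 0 := rfl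

/-- Both loops contain a four-point vertex, which is zero at order zero by connectedness. Among the
trees only two two-point vertices joined by a line survive, and every permutation gives the same
value by evenness. -/
theorem flowRHS_free_light (hΛ : Λ ∈ Icc 0 t.Λ₀) (v : Momentum) :
    flowRHS K t.m t.M t.L 0 1 0 Λ (lightLegs (n₁ := 1) (n₂ := 0) fun _ => v)
      (heavyLegs (n₁ := 1) (n₂ := 0) fun _ => v) =
      2 * lightDot K t.m Λ v * t.L 0 1 0 Λ (fun _ => v) ^ 2 := by
  have h1 : ∀ p q, lightLoop K t.m t.L 0 1 0 Λ p q = 0 := fun p q => by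
    simp [lightLoop, t.free_eq_zero_of_two_le (l₁ := 1 + 1) (l₂ := 0) (by norm_num) hΛ, atLegs_zero]
  have h2 : ∀ p q, heavyLoop K t.M t.L 0 1 0 Λ p q = 0 := fun p q => by
    simp [heavyLoop, t.free_eq_zero_of_two_le (l₁ := 1) (l₂ := 0 + 1) (by norm_num) hΛ, atLegs_zero]
  have hI : Finset.Iic (0 : Fin 3 → ℕ) = {0} := by
    ext s
    rw [Finset.mem_Iic, Finset.mem_singleton]
    exact ⟨fun h => funext fun i => Nat.le_zero.1 (h i), fun h => h.le⟩
  have h3 : ∀ (σ : Equiv.Perm (Fin (2 * 1))) (τ : Equiv.Perm (Fin (2 * 0))),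
      lightTree K t.m t.L 0 0 1 1 0 0 Λ (permute σ (lightLegs (n₁ := 1) (n₂ := 0) fun _ => v))
        (permute τ (heavyLegs (n₁ := 1) (n₂ := 0) fun _ => v)) =
        lightDot K t.m Λ v * t.L 0 1 0 Λ (fun _ => v) ^ 2 := by
    intro σ τ
    have hleg : ∀ i : Fin 2, permute σ (lightLegs (n₁ := 1) (n₂ := 0) fun _ => v) i = v ∨
        permute σ (lightLegs (n₁ := 1) (n₂ := 0) fun _ => v) i = -v := by
      intro i
      rw [permute, dif_pos i.2, lightLegs]
      rcases (σ i) with ⟨j, hj⟩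
      interval_cases j
      · left; simp [leg]
      · right; simp [leg]
    have hv : ∀ w : Momentum, w = v ∨ w = -v → t.L 0 1 0 Λ (fun _ => w) = t.L 0 1 0 Λ (fun _ => v) ∧
        lightDot K t.m Λ w = lightDot K t.m Λ v := by
      rintro w (rfl | rfl)
      · exact ⟨rfl, rfl⟩
      · exact ⟨t.light_two_even 0 hΛ v, lightDot_neg ..⟩
    have hat : ∀ p q : ℕ → Momentum, atLegs (t.L 0 1 0 Λ) p q = t.L 0 1 0 Λ (fun _ => p 0) := by
      intro p q
      unfold atLegs
      congr 1
      funext i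
      simp
    have e0 := hv _ (hleg 0)
    have e1 := hv _ (hleg 1)
    rw [lightTree]
    simp only [hat, snocFrom]
    simp only [Fin.val_zero, Fin.val_one] at e0 e1
    simp [lightDot_neg, e0, e1]
    ring
  rw [flowRHS, h1, h2, hI]
  have ha : Finset.HasAntidiagonal.antidiagonal (1 + 1) = {(0, 2), (1, 1), (2, 0)} := rfl
  have hb : Finset.HasAntidiagonal.antidiagonal 0 = {(0, 0)} := rfl
  have hc : Finset.HasAntidiagonal.antidiagonal 1 = {(0, 1), (1, 0)} := rfl
  simp [ha, hb, hc, symmetrize, h3, Fintype.card_perm]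
  ring

theorem flowRHS_free_heavy (hΛ : Λ ∈ Icc 0 t.Λ₀) (v : Momentum) :
    flowRHS K t.m t.M t.L 0 0 1 Λ (lightLegs (n₁ := 0) (n₂ := 1) fun _ => v)
      (heavyLegs (n₁ := 0) (n₂ := 1) fun _ => v) =
      2 * heavyDot K t.M Λ v * t.L 0 0 1 Λ (fun _ => v) ^ 2 := by
  have h1 : ∀ p q, lightLoop K t.m t.L 0 0 1 Λ p q = 0 := fun p q => by
    simp [lightLoop, t.free_eq_zero_of_two_le (l₁ := 0 + 1) (l₂ := 1) (by norm_num) hΛ, atLegs_zero]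
  have h2 : ∀ p q, heavyLoop K t.M t.L 0 0 1 Λ p q = 0 := fun p q => by
    simp [heavyLoop, t.free_eq_zero_of_two_le (l₁ := 0) (l₂ := 1 + 1) (by norm_num) hΛ, atLegs_zero]
  have hI : Finset.Iic (0 : Fin 3 → ℕ) = {0} := by
    ext s
    rw [Finset.mem_Iic, Finset.mem_singleton]
    exact ⟨fun h => funext fun i => Nat.le_zero.1 (h i), fun h => h.le⟩
  have h3 : ∀ (σ : Equiv.Perm (Fin (2 * 0))) (τ : Equiv.Perm (Fin (2 * 1))),
      heavyTree K t.M t.L 0 0 0 0 1 1 Λ (permute σ (lightLegs (n₁ := 0) (n₂ := 1) fun _ => v))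
        (permute τ (heavyLegs (n₁ := 0) (n₂ := 1) fun _ => v)) =
        heavyDot K t.M Λ v * t.L 0 0 1 Λ (fun _ => v) ^ 2 := by
    intro σ τ
    have hleg : ∀ i : Fin 2, permute τ (heavyLegs (n₁ := 0) (n₂ := 1) fun _ => v) i = v ∨
        permute τ (heavyLegs (n₁ := 0) (n₂ := 1) fun _ => v) i = -v := by
      intro i
      rw [permute, dif_pos i.2, heavyLegs]
      rcases (τ i) with ⟨j, hj⟩
      interval_cases j
      · left; simp [leg]
      · right; simp [leg]
    have hv : ∀ w : Momentum, w = v ∨ w = -v → t.L 0 0 1 Λ (fun _ => w) = t.L 0 0 1 Λ (fun _ => v) ∧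
        heavyDot K t.M Λ w = heavyDot K t.M Λ v := by
      rintro w (rfl | rfl)
      · exact ⟨rfl, rfl⟩
      · exact ⟨t.heavy_two_even 0 hΛ v, heavyDot_neg ..⟩
    have hat : ∀ p q : ℕ → Momentum, atLegs (t.L 0 0 1 Λ) p q = t.L 0 0 1 Λ (fun _ => q 0) := by
      intro p q
      unfold atLegs
      congr 1
      funext i
      simp
    have e0 := hv _ (hleg 0)
    have e1 := hv _ (hleg 1)
    rw [heavyTree]
    simp only [hat, snocFrom]
    simp only [Fin.val_zero, Fin.val_one] at e0 e1
    simp [heavyDot_neg, e0, e1]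
    ring
  rw [flowRHS, h1, h2, hI]
  have ha : Finset.HasAntidiagonal.antidiagonal (1 + 1) = {(0, 2), (1, 1), (2, 0)} := rfl
  have hb : Finset.HasAntidiagonal.antidiagonal 0 = {(0, 0)} := rfl
  have hc : Finset.HasAntidiagonal.antidiagonal 1 = {(0, 1), (1, 0)} := rfl
  simp [ha, hb, hc, symmetrize, h3, Fintype.card_perm]
  ring

theorem light_free_eq_zero (hK : IsCutoffProfile K) (hΛ : Λ ∈ Icc 0 t.Λ₀) : t.L 0 1 0 Λ = 0 := by
  obtain ⟨e, he, hxe⟩ := exists_unit_orthogonal 0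
  obtain ⟨ρ, hρ⟩ := t.sol.bare
  obtain ⟨B, hB⟩ := exists_bound_propagator (c := lightSwitch K) hK t.m_pos
  obtain ⟨A, hA⟩ := exists_bound_propagatorDot_of_pos hK (isSwitch_light hK) t.m_pos
  have hconst : ContDiff ℝ ∞ fun v : Momentum => (fun _ => v : Config 1 0) :=
    contDiff_pi.2 fun _ => contDiff_id
  have hflow : ∀ p : Momentum, ∀ l ∈ Icc 0 t.Λ₀, HasDerivWithinAt (fun l => t.L 0 1 0 l fun _ => p)
      (2 * lightDot K t.m l p * t.L 0 1 0 l (fun _ => p) ^ 2) (Icc 0 t.Λ₀) l := fun p l hl =>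
    (t.sol.flow 0 1 0 (by norm_num) l hl fun _ => p).congr_deriv (t.flowRHS_free_light hl p)
  have hsm := t.smooth 0 (n₁ := 1) (n₂ := 0) (by norm_num) le_rfl t.Λ₀_pos.le
  have key := eq_zero_of_riccati (u := fun l p => t.L 0 1 0 l fun _ => p)
    (D := fun l p => propagatorDot K (lightSwitch K) t.m l p)
    (P := fun l p => propagator K (lightSwitch K) t.m l p) (α := ρ 0 0 / 2) (β := ρ 0 1 / 2)
    t.Λ₀_pos (fun p l hl => (hflow p l hl).continuousWithinAt)
    (fun p l hl => by
      rw [← lightDot_eq hK t.m_pos hl.1]; exact hflow p l (Ioc_subset_Icc_self hl))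
    (continuousOn_propagator hK (isSwitch_light hK) t.m_pos _)
    (propagator_zero (isSwitch_light hK))
    (fun p l hl => hasDerivAt_propagator hK (isSwitch_light hK) hl.1 p) (fun p => hB _ p)
    (fun p => ⟨A, fun l hl => hA l hl.1 p⟩)
    (fun p => by simp [hρ 0 1 0 (by norm_num), bareVertex, leg])
    (hsm.comp hconst) he hxe (t.sol.renormalized.light_two 0) ?_
  · funext k
    have := key Λ hΛ (k 0)
    rwa [show (fun _ => k 0) = k from
      funext fun i => congrArg k (Subsingleton.elim (α := Fin 1) 0 i)] at this
  · let T : Momentum →L[ℝ] Config 1 0 := ContinuousLinearMap.pi fun _ => ContinuousLinearMap.id ℝ _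
    have h := congrArg (fun F => F fun _ => e)
      (T.iteratedFDeriv_comp_right hsm 0 (natCast_le_infty 2))
    refine h.trans ?_
    rw [ContinuousMultilinearMap.compContinuousLinearMap_apply]
    have h2 := t.sol.renormalized.light_two_deriv 0 e e
    rw [map_zero]
    convert h2 using 2
    funext i
    fin_cases i <;> rfl

/-- The Hessian condition covers only directions orthogonal to the renormalization point; one such
unit direction is enough. -/
theorem heavy_free_eq_zero (hK : IsCutoffProfile K) (hΛ : Λ ∈ Icc 0 t.Λ₀) : t.L 0 0 1 Λ = 0 := by
  obtain ⟨e, he, hxe⟩ := exists_unit_orthogonal (t.pbar 0)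
  obtain ⟨ρ, hρ⟩ := t.sol.bare
  obtain ⟨B, hB⟩ := exists_bound_propagator (c := heavySwitch K) hK t.M_pos
  obtain ⟨A, hA⟩ := exists_bound_propagatorDot_of_pos hK (isSwitch_heavy hK) t.M_pos
  have hconst : ContDiff ℝ ∞ fun v : Momentum => (fun _ => v : Config 0 1) :=
    contDiff_pi.2 fun _ => contDiff_id
  have hflow : ∀ p : Momentum, ∀ l ∈ Icc 0 t.Λ₀, HasDerivWithinAt (fun l => t.L 0 0 1 l fun _ => p)
      (2 * heavyDot K t.M l p * t.L 0 0 1 l (fun _ => p) ^ 2) (Icc 0 t.Λ₀) l := fun p l hl =>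
    (t.sol.flow 0 0 1 (by norm_num) l hl fun _ => p).congr_deriv (t.flowRHS_free_heavy hl p)
  have hsm := t.smooth 0 (n₁ := 0) (n₂ := 1) (by norm_num) le_rfl t.Λ₀_pos.le
  have key := eq_zero_of_riccati (u := fun l p => t.L 0 0 1 l fun _ => p)
    (D := fun l p => propagatorDot K (heavySwitch K) t.M l p)
    (P := fun l p => propagator K (heavySwitch K) t.M l p) (α := ρ 0 3 / 2) (β := ρ 0 4 / 2)
    t.Λ₀_pos (fun p l hl => (hflow p l hl).continuousWithinAt)
    (fun p l hl => by
      rw [← heavyDot_eq hK t.M_pos hl.1]; exact hflow p l (Ioc_subset_Icc_self hl))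
    (continuousOn_propagator hK (isSwitch_heavy hK) t.M_pos _)
    (propagator_zero (isSwitch_heavy hK))
    (fun p l hl => hasDerivAt_propagator hK (isSwitch_heavy hK) hl.1 p) (fun p => hB _ p)
    (fun p => ⟨A, fun l hl => hA l hl.1 p⟩)
    (fun p => by simp [hρ 0 0 1 (by norm_num), bareVertex, leg])
    (hsm.comp hconst) he hxe (t.sol.renormalized.heavy_two 0) ?_
  · funext k
    have := key Λ hΛ (k 0)
    rwa [show (fun _ => k 0) = k from
      funext fun i => congrArg k (Subsingleton.elim (α := Fin 1) 0 i)] at this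
  · let T : Momentum →L[ℝ] Config 0 1 := ContinuousLinearMap.pi fun _ => ContinuousLinearMap.id ℝ _
    have h := congrArg (fun F => F fun _ => e)
      (T.iteratedFDeriv_comp_right hsm (t.pbar 0) (natCast_le_infty 2))
    refine h.trans ?_
    rw [ContinuousMultilinearMap.compContinuousLinearMap_apply]
    have h2 := t.sol.renormalized.heavy_two_deriv 0 e e (by rw [real_inner_comm]; exact hxe)
      (by rw [real_inner_comm]; exact hxe)
    rw [show T (t.pbar 0) = fun _ => t.pbar 0 from rfl]
    convert h2 using 2
    funext i
    fin_cases i <;> rfl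

/-- The vertices of order zero vanish. -/
theorem free_eq_zero (hK : IsCutoffProfile K) {l₁ l₂ : ℕ} (hl : 1 ≤ l₁ + l₂)
    (hΛ : Λ ∈ Icc 0 t.Λ₀) : t.L 0 l₁ l₂ Λ = 0 := by
  by_cases h2 : 2 ≤ l₁ + l₂
  · exact t.free_eq_zero_of_two_le h2 hΛ
  · obtain ⟨rfl, rfl⟩ | ⟨rfl, rfl⟩ : (l₁ = 1 ∧ l₂ = 0) ∨ (l₁ = 0 ∧ l₂ = 1) := by omega
    · exact t.light_free_eq_zero hK hΛ
    · exact t.heavy_free_eq_zero hK hΛ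

end Theory

/-! ### Euclidean invariance -/

/-- Induction over the flow hierarchy: the right-hand side of the flow equation contains vertices of
lower order, and vertices of the same order with two more legs. -/
theorem vertex_induction {Q : (Fin 3 → ℕ) → ℕ → ℕ → Prop}
    (base : ∀ r n₁ n₂, ∑ i, r i + 1 < n₁ + n₂ → Q r n₁ n₂)
    (step : ∀ r n₁ n₂, 1 ≤ n₁ + n₂ → (∀ s : Fin 3 → ℕ, ∑ i, s i < ∑ i, r i → ∀ l₁ l₂,
      1 ≤ l₁ + l₂ → Q s l₁ l₂) → Q r (n₁ + 1) n₂ → Q r n₁ (n₂ + 1) → Q r n₁ n₂) :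
    ∀ r n₁ n₂, 1 ≤ n₁ + n₂ → Q r n₁ n₂ := by
  have key : ∀ N, ∀ r : Fin 3 → ℕ, ∑ i, r i = N → ∀ n₁ n₂, 1 ≤ n₁ + n₂ → Q r n₁ n₂ := by
    intro N
    induction N using Nat.strong_induction_on with
    | _ N ih =>
      intro r hr
      have inner : ∀ j n₁ n₂, 1 ≤ n₁ + n₂ → N + 1 < n₁ + n₂ + j → Q r n₁ n₂ := by
        intro j
        induction j with
        | zero => exact fun n₁ n₂ _ h => base r n₁ n₂ (by omega)
        | succ j ihj =>
          exact fun n₁ n₂ hn h => step r n₁ n₂ hn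
            (fun s hs => ih _ (hr ▸ hs) s rfl)
            (ihj _ _ (by omega) (by omega)) (ihj _ _ (by omega) (by omega))
      exact fun n₁ n₂ hn => inner (N + 2) n₁ n₂ hn (by omega)
  exact fun r => key _ r rfl

/-- Invariance of a function of momenta under a linear isometry. -/
def IsInvariant (R : Momentum ≃ₗᵢ[ℝ] Momentum) {n₁ n₂ : ℕ} (F : Config n₁ n₂ → ℝ) : Prop :=
  ∀ k, F (fun i => R (k i)) = F k

section Invariance

variable {R : Momentum ≃ₗᵢ[ℝ] Momentum} {n₁ n₂ : ℕ}

theorem leg_map (k : Config n₁ n₂) (i : ℕ) : leg (n₁ := n₁) (n₂ := n₂) (fun j => R (k j)) i = R (leg k i) := by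
  unfold leg
  split_ifs
  · rfl
  · simp

theorem permute_map {N : ℕ} (σ : Equiv.Perm (Fin N)) (p : ℕ → Momentum) :
    permute σ (fun i => R (p i)) = fun i => R (permute σ p i) := by
  funext i
  unfold permute
  split_ifs <;> simp

theorem snocTwo_map (N : ℕ) (p : ℕ → Momentum) (x y : Momentum) :
    snocTwo N (fun i => R (p i)) (R x) (R y) = fun i => R (snocTwo N p x y i) := by
  funext i
  unfold snocTwo
  split_ifs <;> rfl

theorem snocFrom_map (a N : ℕ) (p : ℕ → Momentum) (x : Momentum) :
    snocFrom a N (fun i => R (p i)) (R x) = fun i => R (snocFrom a N p x i) := by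
  funext i
  unfold snocFrom
  split_ifs <;> rfl

theorem IsInvariant.atLegs_map {F : Config n₁ n₂ → ℝ} (hF : IsInvariant R F) (p q : ℕ → Momentum) :
    atLegs F (fun i => R (p i)) (fun i => R (q i)) = atLegs F p q := by
  unfold atLegs
  rw [← hF fun i => if (i : ℕ) < 2 * n₁ then p i else q (i - 2 * n₁)]
  congr 1
  funext i
  split_ifs <;> rfl

theorem lightDot_map (K : ℝ → ℝ) (m Λ : ℝ) (p : Momentum) :
    lightDot K m Λ (R p) = lightDot K m Λ p := by
  simp [lightDot, lightPropagator, lightCutoff]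

theorem heavyDot_map (K : ℝ → ℝ) (M Λ : ℝ) (p : Momentum) :
    heavyDot K M Λ (R p) = heavyDot K M Λ p := by
  simp [heavyDot, heavyPropagator, heavyCutoff]

variable {K : ℝ → ℝ} {m M Λ : ℝ} {L : VertexFamily} {r s u : Fin 3 → ℕ} {a a' b b' : ℕ}

/-- The loop momentum is rotated too; the isometry preserves Lebesgue measure. -/
theorem lightLoop_map (h : IsInvariant R (L r (n₁ + 1) n₂ Λ)) (p q : ℕ → Momentum) :
    lightLoop K m L r n₁ n₂ Λ (fun i => R (p i)) (fun i => R (q i)) =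
      lightLoop K m L r n₁ n₂ Λ p q := by
  unfold lightLoop
  congr 1
  rw [← R.measurePreserving.integral_comp R.toHomeomorph.measurableEmbedding]
  refine integral_congr_ae (Filter.Eventually.of_forall fun ℓ => ?_)
  simp only
  rw [lightDot_map, ← map_neg, snocTwo_map, h.atLegs_map]

theorem heavyLoop_map (h : IsInvariant R (L r n₁ (n₂ + 1) Λ)) (p q : ℕ → Momentum) :
    heavyLoop K M L r n₁ n₂ Λ (fun i => R (p i)) (fun i => R (q i)) =
      heavyLoop K M L r n₁ n₂ Λ p q := by
  unfold heavyLoop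
  congr 1
  rw [← R.measurePreserving.integral_comp R.toHomeomorph.measurableEmbedding]
  refine integral_congr_ae (Filter.Eventually.of_forall fun ℓ => ?_)
  simp only
  rw [heavyDot_map, ← map_neg, snocTwo_map, h.atLegs_map]

theorem lightTree_map (hs : IsInvariant R (L s a b Λ)) (hu : IsInvariant R (L u a' b' Λ))
    (p q : ℕ → Momentum) :
    lightTree K m L s u a a' b b' Λ (fun i => R (p i)) (fun i => R (q i)) =
      lightTree K m L s u a a' b b' Λ p q := by
  unfold lightTree
  simp only [← map_sum, ← map_neg, ← map_sub, snocFrom_map, lightDot_map]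
  rw [hs.atLegs_map, hu.atLegs_map _ fun i => q (2 * b + i)]

theorem heavyTree_map (hs : IsInvariant R (L s a b Λ)) (hu : IsInvariant R (L u a' b' Λ))
    (p q : ℕ → Momentum) :
    heavyTree K M L s u a a' b b' Λ (fun i => R (p i)) (fun i => R (q i)) =
      heavyTree K M L s u a a' b b' Λ p q := by
  unfold heavyTree
  simp only [← map_sum, ← map_neg, ← map_sub, snocFrom_map, heavyDot_map]
  rw [hs.atLegs_map, hu.atLegs_map fun i => p (2 * a + i)]

theorem symmetrize_map {F : (ℕ → Momentum) → (ℕ → Momentum) → ℝ}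
    (hF : ∀ p q, F (fun i => R (p i)) (fun i => R (q i)) = F p q) (p q : ℕ → Momentum) :
    symmetrize n₁ n₂ F (fun i => R (p i)) (fun i => R (q i)) = symmetrize n₁ n₂ F p q := by
  unfold symmetrize
  simp only [permute_map, hF]

theorem bareVertex_invariant (ρ : Fin 7 → ℝ) : IsInvariant R (bareVertex ρ n₁ n₂) := by
  intro k
  simp only [bareVertex, leg_map, LinearIsometryEquiv.norm_map]

end Invariance

namespace Theory

variable {K : ℝ → ℝ} (t : Theory K)

/-- The vertex functions do not change under linear isometries of the momenta. -/
theorem isInvariant (hK : IsCutoffProfile K) (R : Momentum ≃ₗᵢ[ℝ] Momentum) :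
    ∀ (r : Fin 3 → ℕ) (n₁ n₂ : ℕ), 1 ≤ n₁ + n₂ → ∀ Λ ∈ Icc 0 t.Λ₀, IsInvariant R (t.L r n₁ n₂ Λ) := by
  refine vertex_induction (fun r n₁ n₂ h Λ hΛ k => ?_) (fun r n₁ n₂ hn hlow hL hH => ?_)
  · rw [t.sol.connected r n₁ n₂ h Λ hΛ, t.sol.connected r n₁ n₂ h Λ hΛ]
  have hRHS : ∀ Λ ∈ Icc 0 t.Λ₀, ∀ p q, flowRHS K t.m t.M t.L r n₁ n₂ Λ (fun i => R (p i))
      (fun i => R (q i)) = flowRHS K t.m t.M t.L r n₁ n₂ Λ p q := by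
    intro Λ hΛ p q
    have hT : ∀ s ∈ Finset.Iic r, ∀ a ∈ Finset.HasAntidiagonal.antidiagonal (n₁ + 1),
        ∀ b : ℕ × ℕ, (a.1 : ℝ) * a.2 * symmetrize n₁ n₂
          (lightTree K t.m t.L s (r - s) a.1 a.2 b.1 b.2 Λ) (fun i => R (p i)) (fun i => R (q i)) =
        (a.1 : ℝ) * a.2 * symmetrize n₁ n₂
          (lightTree K t.m t.L s (r - s) a.1 a.2 b.1 b.2 Λ) p q := by
      intro s hs a _ b
      by_cases h1a : a.1 = 0
      · simp [h1a]
      by_cases h2a : a.2 = 0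
      · simp [h2a]
      rw [symmetrize_map (fun p q => ?_) p q]
      rcases eq_or_lt_of_mem_Iic hs with h | h | ⟨h, h'⟩
      · simp [lightTree, h, t.free_eq_zero hK (l₁ := a.1) (l₂ := b.1) (by omega) hΛ, atLegs_zero]
      · simp [lightTree, h, t.free_eq_zero hK (l₁ := a.2) (l₂ := b.2) (by omega) hΛ, atLegs_zero]
      · exact lightTree_map (hlow s h _ _ (by omega) Λ hΛ) (hlow _ h' _ _ (by omega) Λ hΛ) p q
    have hU : ∀ s ∈ Finset.Iic r, ∀ a : ℕ × ℕ,
        ∀ b ∈ Finset.HasAntidiagonal.antidiagonal (n₂ + 1), (b.1 : ℝ) * b.2 * symmetrize n₁ n₂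
          (heavyTree K t.M t.L s (r - s) a.1 a.2 b.1 b.2 Λ) (fun i => R (p i)) (fun i => R (q i)) =
        (b.1 : ℝ) * b.2 * symmetrize n₁ n₂
          (heavyTree K t.M t.L s (r - s) a.1 a.2 b.1 b.2 Λ) p q := by
      intro s hs a b _
      by_cases h1b : b.1 = 0
      · simp [h1b]
      by_cases h2b : b.2 = 0
      · simp [h2b]
      rw [symmetrize_map (fun p q => ?_) p q]
      rcases eq_or_lt_of_mem_Iic hs with h | h | ⟨h, h'⟩
      · simp [heavyTree, h, t.free_eq_zero hK (l₁ := a.1) (l₂ := b.1) (by omega) hΛ, atLegs_zero]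
      · simp [heavyTree, h, t.free_eq_zero hK (l₁ := a.2) (l₂ := b.2) (by omega) hΛ, atLegs_zero]
      · exact heavyTree_map (hlow s h _ _ (by omega) Λ hΛ) (hlow _ h' _ _ (by omega) Λ hΛ) p q
    rw [flowRHS, flowRHS, lightLoop_map (hL Λ hΛ), heavyLoop_map (hH Λ hΛ),
      Finset.sum_congr rfl fun s hs => Finset.sum_congr rfl fun a ha =>
        Finset.sum_congr rfl fun b _ => hT s hs a ha b,
      Finset.sum_congr rfl fun s hs => Finset.sum_congr rfl fun a _ =>
        Finset.sum_congr rfl fun b hb => hU s hs a b hb]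
  intro Λ hΛ k
  obtain ⟨ρ, hρ⟩ := t.sol.bare
  have hd : ∀ l ∈ Icc 0 t.Λ₀, HasDerivWithinAt
      (fun l => t.L r n₁ n₂ l (fun i => R (k i)) - t.L r n₁ n₂ l k) 0 (Icc 0 t.Λ₀) l := by
    intro l hl
    refine ((t.sol.flow r n₁ n₂ hn l hl fun i => R (k i)).sub
      (t.sol.flow r n₁ n₂ hn l hl k)).congr_deriv ?_
    have e1 : lightLegs (n₁ := n₁) (n₂ := n₂) (fun i => R (k i)) = fun i => R (lightLegs k i) :=
      funext fun i => leg_map k i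
    have e2 : heavyLegs (n₁ := n₁) (n₂ := n₂) (fun i => R (k i)) = fun i => R (heavyLegs k i) :=
      funext fun i => leg_map k _
    rw [e1, e2, hRHS l hl, sub_self]
  -- The difference of rotated and unrotated vertex is constant along the flow and vanishes at the
  -- ultraviolet cutoff, since the bare vertices depend on momenta only through norms.
  refine sub_eq_zero.1 (eq_zero_of_hasDerivWithinAt_of_right_eq_zero (y' := fun _ => 0) (B := 0)
    (fun l hl => (hd l hl).continuousWithinAt) (fun l hl => hd l (Ioc_subset_Icc_self hl))
    (fun l _ => by simp) ?_ Λ hΛ)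
  rw [hρ r n₁ n₂ hn, hρ r n₁ n₂ hn, bareVertex_invariant, sub_self]

end Theory

/-! ### Integration of the flow equation -/

namespace Theory

variable {K : ℝ → ℝ} (t : Theory K) (r : Fin 3 → ℕ) {n₁ n₂ : ℕ}

/-- The right-hand side of the flow equation as a function of the independent momenta. -/
def rhs (r : Fin 3 → ℕ) (n₁ n₂ : ℕ) (Λ : ℝ) (k : Config n₁ n₂) : ℝ :=
  flowRHS K t.m t.M t.L r n₁ n₂ Λ (lightLegs k) (heavyLegs k)

/-- By the flow equation this is the scale derivative of a smooth function, so smoothness up to both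
endpoints needs no inspection of loops and trees. -/
theorem contDiffOn_rhs (hn : 1 ≤ n₁ + n₂) : ContDiffOn ℝ ∞
    (fun y : ℝ × Config n₁ n₂ => t.rhs r n₁ n₂ y.1 y.2) (Icc 0 t.Λ₀ ×ˢ univ) := by
  have hu : UniqueDiffOn ℝ (Icc 0 t.Λ₀) := uniqueDiffOn_Icc t.Λ₀_pos
  have hs := t.sol.smooth r n₁ n₂ hn
  have h1 := (hs.fderivWithin (m := ∞) (hu.prod uniqueDiffOn_univ) (by simp)).clm_apply
    (contDiffOn_const (c := ((1 : ℝ), (0 : Config n₁ n₂))))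
  refine h1.congr ?_
  rintro ⟨l, k⟩ ⟨hl, -⟩
  have h2 := ((hs.differentiableOn (by simp)) (l, k) ⟨hl, mem_univ _⟩).hasFDerivWithinAt
  have h3 : HasDerivWithinAt (fun l : ℝ => (l, k)) ((1 : ℝ), (0 : Config n₁ n₂)) (Icc 0 t.Λ₀) l :=
    ((hasDerivAt_id l).prodMk (hasDerivAt_const l k)).hasDerivWithinAt
  have h5 : MapsTo (fun l : ℝ => (l, k)) (Icc 0 t.Λ₀) (Icc 0 t.Λ₀ ×ˢ univ) :=
    fun l' hl' => ⟨hl', mem_univ _⟩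
  have h4 := h2.comp_hasDerivWithinAt l h3 h5
  exact (hu l hl).eq_deriv _ (t.sol.flow r n₁ n₂ hn l hl k) h4

theorem iteratedFDeriv_sub_eq_integral (hn : 1 ≤ n₁ + n₂) {a b : ℝ} (ha : 0 ≤ a) (hab : a ≤ b)
    (hb : b ≤ t.Λ₀) (z : ℕ) (k : Config n₁ n₂) :
    iteratedFDeriv ℝ z (t.L r n₁ n₂ b) k - iteratedFDeriv ℝ z (t.L r n₁ n₂ a) k =
      ∫ l in a..b, iteratedFDeriv ℝ z (t.rhs r n₁ n₂ l) k := by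
  have hsub : Icc a b ⊆ Icc 0 t.Λ₀ := Icc_subset_Icc ha hb
  have hint := iteratedFDeriv_setIntegral (uniqueDiffOn_Icc t.Λ₀_pos) (isCompact_Icc (a := a) (b := b))
    hsub (μ := volume) isCompact_Icc.measure_lt_top.ne
    (f := fun l k => t.rhs r n₁ n₂ l k) (t.contDiffOn_rhs r hn)
  have hcont : ∀ k, ContinuousOn (fun l => t.rhs r n₁ n₂ l k) (Icc 0 t.Λ₀) :=
    fun k => continuousOn_slice (t.contDiffOn_rhs r hn).continuousOn k
  have hftc : t.L r n₁ n₂ b = fun k => t.L r n₁ n₂ a k + ∫ l in Icc a b, t.rhs r n₁ n₂ l k := by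
    funext k
    have hd : ∀ l ∈ Icc 0 t.Λ₀, HasDerivWithinAt (fun l => t.L r n₁ n₂ l k) (t.rhs r n₁ n₂ l k)
        (Icc 0 t.Λ₀) l := fun l hl => t.sol.flow r n₁ n₂ hn l hl k
    rw [integral_Icc_eq_integral_Ioc, ← intervalIntegral.integral_of_le hab,
      intervalIntegral.integral_eq_sub_of_hasDerivAt_of_le hab
        (fun l hl => ((hd l (hsub hl)).continuousWithinAt).mono hsub) (fun l hl => ?_)
        (((hcont k).mono hsub).intervalIntegrable_of_Icc hab)]
    · ring
    · exact (hd l (hsub (Ioo_subset_Icc_self hl))).hasDerivAt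
        (Icc_mem_nhds (ha.trans_lt hl.1) (hl.2.trans_le hb))
  rw [hftc, fun_iteratedFDeriv_add_apply (((t.smooth r hn ha (hab.trans hb))).of_le
    (natCast_le_infty z)).contDiffAt ((hint.1).of_le (natCast_le_infty z)).contDiffAt, hint.2,
    integral_Icc_eq_integral_Ioc, ← intervalIntegral.integral_of_le hab, add_sub_cancel_left]

theorem norm_iteratedFDeriv_sub_le (hn : 1 ≤ n₁ + n₂) {a b : ℝ} (ha : 0 ≤ a) (hab : a ≤ b)
    (hb : b ≤ t.Λ₀) {z : ℕ} {k : Config n₁ n₂} {h H : ℝ → ℝ}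
    (hh : ∀ l ∈ Ioc a b, ‖iteratedFDeriv ℝ z (t.rhs r n₁ n₂ l) k‖ ≤ h l)
    (hc : ContinuousOn h (Icc a b)) (hH : ∀ l ∈ Icc a b, HasDerivAt H (h l) l) :
    ‖iteratedFDeriv ℝ z (t.L r n₁ n₂ b) k - iteratedFDeriv ℝ z (t.L r n₁ n₂ a) k‖ ≤ H b - H a := by
  rw [t.iteratedFDeriv_sub_eq_integral r hn ha hab hb]
  have hi := hc.intervalIntegrable_of_Icc hab (μ := volume)
  refine (intervalIntegral.norm_integral_le_of_norm_le hab
    (Filter.Eventually.of_forall hh) hi).trans_eq ?_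
  exact intervalIntegral.integral_eq_sub_of_hasDerivAt (fun l hl => hH l (by rwa [uIcc_of_le hab] at hl)) hi

variable {t r}

/-- Because $e=j-1$ with $j\ge0$, all but one inverse power can be frozen at the upper end; the
remaining $1/(l+m)$ integrates to a logarithm. -/
theorem norm_sub_le_of_relevant (hn : 1 ≤ n₁ + n₂) {a b : ℝ} (ha : 0 ≤ a) (hab : a ≤ b)
    (hb : b ≤ t.Λ₀) {z : ℕ} {k : Config n₁ n₂} {A : ℝ} (hA : 0 ≤ A) {d j : ℕ} {e : ℤ}
    (he : e = j - 1)
    (hh : ∀ l ∈ Ioc a b, ‖iteratedFDeriv ℝ z (t.rhs r n₁ n₂ l) k‖ ≤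
      A * (l + t.m) ^ e * t.lg n₂ l ^ d) :
    ‖iteratedFDeriv ℝ z (t.L r n₁ n₂ b) k - iteratedFDeriv ℝ z (t.L r n₁ n₂ a) k‖ ≤
      A * (b + t.m) ^ j * t.lg n₂ b ^ d * Real.log ((b + t.m) / (a + t.m)) := by
  have hm := t.m_pos
  set B := A * (b + t.m) ^ j * t.lg n₂ b ^ d with hB
  have hpos : ∀ l ∈ Icc a b, 0 < l + t.m := fun l hl => by linarith [hl.1]
  have key := t.norm_iteratedFDeriv_sub_le r hn ha hab hb (z := z) (k := k)
    (h := fun l => B * (l + t.m)⁻¹) (H := fun l => B * Real.log (l + t.m)) (fun l hl => ?_) ?_ ?_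
  · refine key.trans_eq ?_
    rw [Real.log_div (hpos b ⟨hab, le_rfl⟩).ne' (hpos a ⟨le_rfl, hab⟩).ne']
    ring
  · have hl' := hpos l ⟨hl.1.le, hl.2⟩
    have hl0 : 0 ≤ l := ha.trans hl.1.le
    have h1 : 0 ≤ t.lg n₂ l := zero_le_one.trans (t.one_le_lg n₂ hl0)
    have h2 : t.lg n₂ l ≤ t.lg n₂ b := lg_mono n₂ hl0 hl.2
    have h3 : (l + t.m) ^ e = (l + t.m) ^ j * (l + t.m)⁻¹ := by
      rw [he, zpow_sub_one₀ hl'.ne', zpow_natCast]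
    refine (hh l hl).trans ?_
    rw [h3, hB]
    have h4 : l ≤ b := hl.2
    have h5 := hpos b ⟨hab, le_rfl⟩
    calc _ = A * (l + t.m) ^ j * t.lg n₂ l ^ d * (l + t.m)⁻¹ := by ring
      _ ≤ _ := by gcongr
  · exact continuousOn_const.mul ((continuousOn_id.add continuousOn_const).inv₀
      fun l hl => (hpos l hl).ne')
  · intro l hl
    have := ((hasDerivAt_id l).add_const t.m).log (hpos l hl).ne'
    simpa using this.const_mul B

/-- As `gap` is at least `m`, the ratio of the two arguments is at most `(l + m) / (a + m)`; the sum
of the logarithms is then dominated by the product because `lg` is at least one. -/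
theorem lg_le_mul (n₂ : ℕ) {a l : ℝ} (ha : 0 ≤ a) (hal : a ≤ l) :
    t.lg n₂ l ≤ t.lg n₂ a * (1 + Real.log ((l + t.m) / (a + t.m))) := by
  have hm := t.m_pos
  have hg := t.m_le_gap n₂
  have h1 := t.one_le_lg n₂ ha
  have h2 : 0 ≤ Real.log ((l + t.m) / (a + t.m)) :=
    Real.log_nonneg (by rw [one_le_div (by linarith)]; linarith)
  have h3 : Real.log ((l + t.gap n₂) / t.m) ≤
      Real.log ((a + t.gap n₂) / t.m) + Real.log ((l + t.m) / (a + t.m)) := by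
    have p1 : 0 < (a + t.gap n₂) / t.m := div_pos (by linarith) hm
    have p2 : 0 < (l + t.m) / (a + t.m) := div_pos (by linarith) (by linarith)
    rw [← Real.log_mul p1.ne' p2.ne']
    refine Real.log_le_log (div_pos (by linarith) hm) ?_
    rw [div_mul_div_comm, div_le_div_iff₀ hm (by positivity)]
    have : (l + t.gap n₂) * (a + t.m) ≤ (a + t.gap n₂) * (l + t.m) := by
      nlinarith [mul_nonneg (sub_nonneg.2 hal) (sub_nonneg.2 hg)]
    nlinarith
  unfold lg at h1 ⊢
  nlinarith

theorem one_add_log_pow_le (d : ℕ) {τ : ℝ} (hτ : 1 ≤ τ) :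
    (1 + Real.log τ) ^ d ≤ (1 + 2 * (d + 1)) ^ d * τ ^ (1 / 2 : ℝ) := by
  have h0 : 0 < τ := by linarith
  -- Chosen so that $\varepsilon d\le1/2$; the `d + 1` keeps it defined for `d = 0`.
  set ε : ℝ := 1 / (2 * (d + 1)) with hε
  have hε0 : 0 < ε := by positivity
  have h1 : 1 + Real.log τ ≤ (1 + 2 * (d + 1)) * τ ^ ε := by
    have h2 := Real.log_le_rpow_div h0.le hε0
    have h3 : 1 ≤ τ ^ ε := Real.one_le_rpow hτ hε0.le
    have h4 : τ ^ ε / ε = 2 * (d + 1) * τ ^ ε := by rw [hε]; field_simp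
    rw [h4] at h2
    linarith
  have h5 : 0 ≤ 1 + Real.log τ := by linarith [Real.log_nonneg hτ]
  calc _ ≤ ((1 + 2 * (d + 1)) * τ ^ ε) ^ d := by gcongr
    _ = (1 + 2 * (d + 1)) ^ d * τ ^ (ε * d) := by
      rw [mul_pow, ← Real.rpow_natCast (τ ^ ε), ← Real.rpow_mul h0.le]
    _ ≤ _ := by
      gcongr
      rw [hε, div_mul_eq_mul_div, div_le_div_iff₀ (by positivity) (by norm_num)]
      linarith

/-- The growth of the logarithms from `a` to `l` costs half a power of the scale, leaving an
integrand of power $-3/2$; its integral is bounded by the lower end, uniformly in `b`. -/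
theorem norm_sub_le_of_irrelevant (hn : 1 ≤ n₁ + n₂) {a b : ℝ} (ha : 0 ≤ a) (hab : a ≤ b)
    (hb : b ≤ t.Λ₀) {z : ℕ} {k : Config n₁ n₂} {A : ℝ} (hA : 0 ≤ A) {d j : ℕ} {e : ℤ}
    (he : e = -2 - j)
    (hh : ∀ l ∈ Ioc a b, ‖iteratedFDeriv ℝ z (t.rhs r n₁ n₂ l) k‖ ≤
      A * (l + t.m) ^ e * t.lg n₂ l ^ d) :
    ‖iteratedFDeriv ℝ z (t.L r n₁ n₂ b) k - iteratedFDeriv ℝ z (t.L r n₁ n₂ a) k‖ ≤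
      2 * A * (1 + 2 * (d + 1)) ^ d * (a + t.m) ^ (e + 1) * t.lg n₂ a ^ d := by
  have hm := t.m_pos
  have ham : 0 < a + t.m := by linarith
  have hlga : 0 ≤ t.lg n₂ a := zero_le_one.trans (t.one_le_lg n₂ ha)
  set B := A * (1 + 2 * (d + 1)) ^ d * t.lg n₂ a ^ d * (a + t.m)⁻¹ ^ j *
    (a + t.m) ^ (-(1 / 2) : ℝ) with hB
  have hpos : ∀ l ∈ Icc a b, 0 < l + t.m := fun l hl => by linarith [hl.1]
  have key := t.norm_iteratedFDeriv_sub_le r hn ha hab hb (z := z) (k := k)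
    (h := fun l => B * (l + t.m) ^ (-(3 / 2) : ℝ))
    (H := fun l => B * (-2 * (l + t.m) ^ (-(1 / 2) : ℝ))) (fun l hl => ?_) ?_ ?_
  · refine key.trans ?_
    have h1 : 0 ≤ B * (2 * (b + t.m) ^ (-(1 / 2) : ℝ)) := by
      have := hpos b ⟨hab, le_rfl⟩
      positivity
    have h2 : (a + t.m) ^ (-(1 / 2) : ℝ) * (a + t.m) ^ (-(1 / 2) : ℝ) = (a + t.m)⁻¹ := by
      rw [← Real.rpow_add ham, ← Real.rpow_neg_one]; norm_num
    have h3 : (a + t.m) ^ (e + 1) = (a + t.m)⁻¹ ^ j * (a + t.m)⁻¹ := by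
      rw [← pow_succ, inv_pow, ← zpow_natCast, ← zpow_neg]
      congr 1
      push_cast
      omega
    calc _ ≤ B * (2 * (a + t.m) ^ (-(1 / 2) : ℝ)) := by linarith
      _ = 2 * A * (1 + 2 * (d + 1)) ^ d * t.lg n₂ a ^ d * (a + t.m)⁻¹ ^ j *
          ((a + t.m) ^ (-(1 / 2) : ℝ) * (a + t.m) ^ (-(1 / 2) : ℝ)) := by rw [hB]; ring
      _ = _ := by rw [h2, h3]; ring
      _ ≤ _ := le_rfl
  · have hl' := hpos l ⟨hl.1.le, hl.2⟩
    have hl0 : 0 ≤ l := ha.trans hl.1.le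
    have hal := hl.1.le
    have h1 : 0 ≤ t.lg n₂ l := zero_le_one.trans (t.one_le_lg n₂ hl0)
    have hτ : 1 ≤ (l + t.m) / (a + t.m) := by rw [one_le_div ham]; linarith
    have h2 : t.lg n₂ l ^ d ≤ t.lg n₂ a ^ d * ((1 + 2 * (d + 1)) ^ d *
        ((l + t.m) / (a + t.m)) ^ (1 / 2 : ℝ)) := by
      calc _ ≤ (t.lg n₂ a * (1 + Real.log ((l + t.m) / (a + t.m)))) ^ d := by
            gcongr; exact lg_le_mul n₂ ha hal
        _ ≤ _ := by rw [mul_pow]; gcongr; exact one_add_log_pow_le d hτ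
    have h3 : (l + t.m) ^ e ≤ (a + t.m)⁻¹ ^ j * (l + t.m) ^ (-2 : ℝ) := by
      have : (l + t.m) ^ e = (l + t.m)⁻¹ ^ j * (l + t.m) ^ (-2 : ℝ) := by
        rw [he, show (-2 : ℝ) = ((-2 : ℤ) : ℝ) by norm_num, Real.rpow_intCast, inv_pow,
          ← zpow_natCast, ← zpow_neg, ← zpow_add₀ hl'.ne']
        congr 1
        omega
      rw [this]
      gcongr
    have h4 : (l + t.m) ^ (-2 : ℝ) * ((l + t.m) / (a + t.m)) ^ (1 / 2 : ℝ) =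
        (a + t.m) ^ (-(1 / 2) : ℝ) * (l + t.m) ^ (-(3 / 2) : ℝ) := by
      rw [Real.div_rpow hl'.le ham.le, Real.rpow_neg ham.le, ← mul_div_assoc, ← Real.rpow_add hl',
        div_eq_inv_mul]
      norm_num
    refine (hh l hl).trans ?_
    calc _ ≤ A * ((a + t.m)⁻¹ ^ j * (l + t.m) ^ (-2 : ℝ)) * (t.lg n₂ a ^ d *
          ((1 + 2 * (d + 1)) ^ d * ((l + t.m) / (a + t.m)) ^ (1 / 2 : ℝ))) := by gcongr
      _ = A * (1 + 2 * (d + 1)) ^ d * t.lg n₂ a ^ d * (a + t.m)⁻¹ ^ j *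
          ((l + t.m) ^ (-2 : ℝ) * ((l + t.m) / (a + t.m)) ^ (1 / 2 : ℝ)) := by ring
      _ = _ := by rw [h4, hB]; ring
  · refine continuousOn_const.mul ?_
    exact (continuousOn_id.add continuousOn_const).rpow_const fun l hl => Or.inl (hpos l hl).ne'
  · intro l hl
    have h1 := (((hasDerivAt_id l).add_const t.m).rpow_const (p := -(1 / 2))
      (Or.inl (hpos l hl).ne')).const_mul (-2)
    refine (h1.const_mul B).congr_deriv ?_
    rw [show (-(1 / 2) - 1 : ℝ) = -(3 / 2) by norm_num]
    simp only [id]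
    ring

end Theory

/-! ### Bounds for the right-hand side of the flow equation -/

section Region

variable {K : ℝ → ℝ} {t : Theory K} {n₁ n₂ : ℕ} {C C' Λ Λ' : ℝ}

theorem Theory.region_mono (hC : C ≤ C') (hC' : 0 ≤ C') (hΛ : 0 ≤ Λ) (h : Λ ≤ Λ') :
    t.region C Λ n₁ n₂ ⊆ t.region C' Λ' n₁ n₂ := by
  intro k hk i
  have hX : 0 ≤ if (i : ℕ) < 2 * n₁ then t.m else t.M := by
    split_ifs
    exacts [t.m_pos.le, t.M_pos.le]
  refine (hk i).trans ?_
  gcongr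

theorem Theory.convex_region : Convex ℝ (t.region C Λ n₁ n₂) := by
  have : t.region C Λ n₁ n₂ = ⋂ i, (fun k : Config n₁ n₂ => k i) ⁻¹'
      Metric.closedBall 0 (C * (Λ + if (i : ℕ) < 2 * n₁ then t.m else t.M)) := by
    ext k
    simp [Theory.region]
  rw [this]
  exact convex_iInter fun i => (convex_closedBall _ _).is_linear_preimage
    ⟨fun _ _ => rfl, fun _ _ => rfl⟩

/-- Without heavy legs, or above `M`, the region has size comparable to `Λ + m`; this is what the
mean value step needs. -/
theorem Theory.norm_le_of_mem_region (hC : 0 ≤ C) (hΛ : 0 ≤ Λ) (h : n₂ = 0 ∨ t.M ≤ Λ)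
    {k : Config n₁ n₂} (hk : k ∈ t.region C Λ n₁ n₂) : ‖k‖ ≤ 2 * C * (Λ + t.m) := by
  have hm := t.m_pos
  refine (pi_norm_le_iff_of_nonneg (by positivity)).2 fun i => (hk i).trans ?_
  rw [mul_comm 2 C, mul_assoc]
  gcongr
  split_ifs with hi
  · linarith
  · rcases h with rfl | h
    · have := i.2; omega
    · linarith

end Region

/-- The estimate of the derivatives of order `z` of the right-hand side of the flow equation. -/
def FlowBound (K : ℝ → ℝ) (r : Fin 3 → ℕ) (n₁ n₂ z : ℕ) : Prop :=
  ∀ C : ℝ, 0 ≤ C → ∃ (A : ℝ) (d : ℕ), 0 ≤ A ∧ ∀ (t : Theory K) (Λ : ℝ), 0 < Λ → Λ ≤ t.Λ₀ →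
    ∀ k ∈ t.region C Λ n₁ n₂, ‖iteratedFDeriv ℝ z (t.rhs r n₁ n₂ Λ) k‖ ≤
      A * (Λ + t.m) ^ (3 - 2 * ((n₁ : ℤ) + n₂) - z) * t.lg n₂ Λ ^ d

variable {K : ℝ → ℝ} {r : Fin 3 → ℕ} {n₁ n₂ z : ℕ}

theorem FlowBound.of_vertexBound (hK : IsCutoffProfile K)
    (hlow : ∀ s : Fin 3 → ℕ, ∑ i, s i < ∑ i, r i → ∀ l₁ l₂, 1 ≤ l₁ + l₂ →
      ∀ z, VertexBound K s l₁ l₂ z)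
    (hL : ∀ z, VertexBound K r (n₁ + 1) n₂ z) (hH : ∀ z, VertexBound K r n₁ (n₂ + 1) z) (z : ℕ) :
    FlowBound K r n₁ n₂ z := by
  intro C hC
  obtain ⟨A, d, hA, h⟩ := (isSymbol_flowRHS
    (ι := {y : Theory K × ℝ × Config n₁ n₂ //
      0 < y.2.1 ∧ y.2.1 ≤ y.1.Λ₀ ∧ y.2.2 ∈ y.1.region C y.2.1 n₁ n₂})
    (t := fun y => y.1.1) (Λ := fun y => y.1.2.1) hK (fun y => y.2.1) (fun y => y.2.2.1)
    (fun t l₁ l₂ hl Λ h0 h1 k => by rw [t.free_eq_zero hK hl ⟨h0, h1⟩]; rfl) hlow hL hH hC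
    (x := fun y => y.1.2.2) (fun y => y.2.2.2)).bound z
  exact ⟨A, d, hA, fun t Λ h0 h1 k hk => h ⟨(t, Λ, k), h0, h1, hk⟩⟩

/-! ### Irrelevant terms -/

theorem iteratedFDeriv_add_mul_norm_sq (a b : ℝ) {z : ℕ} (hz : 3 ≤ z) (x : Momentum) :
    iteratedFDeriv ℝ z (fun x : Momentum => a + b * ‖x‖ ^ 2) x = 0 := by
  obtain ⟨j, rfl⟩ : ∃ j, z = j + 1 + 1 + 1 := ⟨z - 3, by omega⟩
  set B : Momentum →L[ℝ] Momentum →L[ℝ] ℝ :=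
    (isBoundedBilinearMap_inner (𝕜 := ℝ) (E := Momentum)).toContinuousLinearMap
  have h1 : fderiv ℝ (fun x : Momentum => a + b * ‖x‖ ^ 2) = ⇑((b * 2) • B) := by
    funext x
    have h := ((hasStrictFDerivAt_norm_sq x).hasFDerivAt.const_mul b).const_add a
    rw [h.fderiv]
    ext y
    have hB : B x y = inner ℝ x y := rfl
    simp [hB, mul_assoc]
  have h2 : fderiv ℝ ⇑((b * 2) • B) = fun _ => (b * 2) • B :=
    funext fun x => ((b * 2) • B).fderiv
  rw [← norm_eq_zero, ← norm_iteratedFDeriv_fderiv, h1, ← norm_iteratedFDeriv_fderiv, h2,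
    iteratedFDeriv_succ_const]
  simp

/-- The bare action contains only terms of dimension at most four, so this many derivatives kill
each bare vertex. -/
theorem iteratedFDeriv_bareVertex (ρ : Fin 7 → ℝ) (hz : 4 < 2 * (n₁ + n₂) + z)
    (k : Config n₁ n₂) : iteratedFDeriv ℝ z (bareVertex ρ n₁ n₂) k = 0 := by
  have hquad : ∀ a b : ℝ, 3 ≤ z → ∀ (i : Fin (2 * n₁ + 2 * n₂ - 1)) (k : Config n₁ n₂),
      iteratedFDeriv ℝ z (fun k : Config n₁ n₂ => a + b * ‖k i‖ ^ 2) k = 0 := by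
    intro a b hz i k
    have h := norm_iteratedFDeriv_comp_clm_add_le (f := fun x : Momentum => a + b * ‖x‖ ^ 2)
      (contDiff_const.add (contDiff_const.mul (contDiff_norm_sq ℝ)))
      (ContinuousLinearMap.proj (R := ℝ) (φ := fun _ => Momentum) i) 0 z k
    rw [iteratedFDeriv_add_mul_norm_sq a b hz, norm_zero, zero_mul] at h
    simpa using h
  have hconst : ∀ a : ℝ, 1 ≤ z → iteratedFDeriv ℝ z (fun _ : Config n₁ n₂ => a) k = 0 :=
    fun a hz => by rw [iteratedFDeriv_const_of_ne (by omega)]; rfl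
  unfold bareVertex
  split_ifs with h1 h2 h3 h4 h5
  · obtain ⟨rfl, rfl⟩ := h1
    exact hquad _ _ (by omega) ⟨0, by norm_num⟩ k
  · exact hconst _ (by omega)
  · obtain ⟨rfl, rfl⟩ := h3
    exact hquad _ _ (by omega) ⟨0, by norm_num⟩ k
  · exact hconst _ (by omega)
  · exact hconst _ (by omega)
  · rw [iteratedFDeriv_fun_zero]
    rfl

/-- Integration runs down from `Λ₀`, where the derivative is zero. The regions grow with the scale,
so a fixed configuration remains admissible throughout. -/
theorem VertexBound.of_irrelevant (hn : 1 ≤ n₁ + n₂) (hz : 4 < 2 * (n₁ + n₂) + z)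
    (hF : FlowBound K r n₁ n₂ z) : VertexBound K r n₁ n₂ z := by
  intro C hC
  obtain ⟨A, d, hA, h⟩ := hF C hC
  refine ⟨2 * A * (1 + 2 * (d + 1)) ^ d, d, by positivity, fun t Λ h0 h1 k hk => ?_⟩
  obtain ⟨ρ, hρ⟩ := t.sol.bare
  have hb : iteratedFDeriv ℝ z (t.L r n₁ n₂ t.Λ₀) k = 0 := by
    rw [show t.L r n₁ n₂ t.Λ₀ = bareVertex (ρ r) n₁ n₂ from funext (hρ r n₁ n₂ hn)]
    exact iteratedFDeriv_bareVertex _ hz k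
  have key := Theory.norm_sub_le_of_irrelevant (k := k) (z := z) hn h0 h1 le_rfl hA
    (d := d) (j := 2 * (n₁ + n₂) + z - 5) (e := 3 - 2 * ((n₁ : ℤ) + n₂) - z) (by omega)
    (fun l hl => h t l (h0.trans_lt hl.1) hl.2 k (Theory.region_mono le_rfl hC h0 hl.1.le hk))
  rw [hb, zero_sub, norm_neg] at key
  refine key.trans_eq ?_
  rw [Theory.weight, if_pos (Or.inr hz)]
  congr 3
  ring

/-! ### Relevant terms -/

/-- The estimate of the derivatives of order `z` of a vertex function, for `Λ ≥ M` if the vertex has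
heavy legs. -/
def HighVertexBound (K : ℝ → ℝ) (r : Fin 3 → ℕ) (n₁ n₂ z : ℕ) : Prop :=
  ∀ C : ℝ, 0 ≤ C → ∃ (A : ℝ) (d : ℕ), 0 ≤ A ∧ ∀ (t : Theory K) (Λ : ℝ), 0 ≤ Λ → Λ ≤ t.Λ₀ →
    (n₂ = 0 ∨ t.M ≤ Λ) → ∀ k ∈ t.region C Λ n₁ n₂, ‖iteratedFDeriv ℝ z (t.L r n₁ n₂ Λ) k‖ ≤
      A * (Λ + t.m) ^ (4 - 2 * ((n₁ : ℤ) + n₂) - z) * t.lg n₂ Λ ^ d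

/-- The estimate of the derivatives of order `z` at some point, for `Λ ≥ M` if the vertex has heavy
legs. -/
def PointBound (K : ℝ → ℝ) (r : Fin 3 → ℕ) (n₁ n₂ z : ℕ) : Prop :=
  ∃ (A : ℝ) (d : ℕ), 0 ≤ A ∧ ∀ (t : Theory K) (Λ : ℝ), 0 ≤ Λ → Λ ≤ t.Λ₀ →
    (n₂ = 0 ∨ t.M ≤ Λ) → ∃ k ∈ t.region 1 Λ n₁ n₂, ‖iteratedFDeriv ℝ z (t.L r n₁ n₂ Λ) k‖ ≤
      A * (Λ + t.m) ^ (4 - 2 * ((n₁ : ℤ) + n₂) - z) * t.lg n₂ Λ ^ d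

/-- Mean value theorem on the convex region: its size restores the power of the scale lost in one
further derivative. -/
theorem VertexBound.exists_norm_sub_le (hn : 1 ≤ n₁ + n₂) (h : VertexBound K r n₁ n₂ (z + 1))
    {C : ℝ} (hC : 0 ≤ C) : ∃ (A : ℝ) (d : ℕ), 0 ≤ A ∧ ∀ (t : Theory K) (Λ : ℝ), 0 ≤ Λ → Λ ≤ t.Λ₀ →
      (n₂ = 0 ∨ t.M ≤ Λ) → ∀ k ∈ t.region C Λ n₁ n₂, ∀ k' ∈ t.region C Λ n₁ n₂,
        ‖iteratedFDeriv ℝ z (t.L r n₁ n₂ Λ) k - iteratedFDeriv ℝ z (t.L r n₁ n₂ Λ) k'‖ ≤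
          A * (Λ + t.m) ^ (4 - 2 * ((n₁ : ℤ) + n₂) - z) * t.lg n₂ Λ ^ d := by
  obtain ⟨A, d, hA, hb⟩ := h C hC
  refine ⟨A * 2 ^ 4 * (4 * C), d, by positivity, fun t Λ h0 h1 hΛ k hk k' hk' => ?_⟩
  have hm := t.m_pos
  have hlg : 0 ≤ t.lg n₂ Λ := zero_le_one.trans (t.one_le_lg n₂ h0)
  have hs := t.smooth r hn h0 h1
  have key := Theory.convex_region.norm_image_sub_le_of_norm_fderiv_le (𝕜 := ℝ)
    (f := iteratedFDeriv ℝ z (t.L r n₁ n₂ Λ))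
    (C := A * (2 ^ 4 * (Λ + t.m) ^ (4 - 2 * ((n₁ : ℤ) + n₂) - (z + 1 : ℕ))) * t.lg n₂ Λ ^ d)
    (fun x _ => (hs.differentiable_iteratedFDeriv (by exact_mod_cast ENat.natCast_lt_top z)) x)
    (fun x hx => by
      rw [norm_fderiv_iteratedFDeriv]
      refine (hb t Λ h0 h1 x hx).trans ?_
      gcongr
      exact Theory.weight_le h0 hΛ) hk' hk
  have h2 : ‖k - k'‖ ≤ 4 * C * (Λ + t.m) := by
    refine (norm_sub_le _ _).trans ?_
    linarith [Theory.norm_le_of_mem_region hC h0 hΛ hk, Theory.norm_le_of_mem_region hC h0 hΛ hk']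
  have h3 : (Λ + t.m) ^ (4 - 2 * ((n₁ : ℤ) + n₂) - z) =
      (Λ + t.m) ^ (4 - 2 * ((n₁ : ℤ) + n₂) - (z + 1 : ℕ)) * (Λ + t.m) := by
    rw [← zpow_add_one₀ (by positivity)]
    congr 1
    push_cast
    ring
  calc _ ≤ _ := key
    _ ≤ A * (2 ^ 4 * (Λ + t.m) ^ (4 - 2 * ((n₁ : ℤ) + n₂) - (z + 1 : ℕ))) * t.lg n₂ Λ ^ d *
        (4 * C * (Λ + t.m)) := by gcongr
    _ = _ := by rw [h3]; ring

theorem PointBound.highVertexBound (hn : 1 ≤ n₁ + n₂) (hp : PointBound K r n₁ n₂ z)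
    (h : VertexBound K r n₁ n₂ (z + 1)) : HighVertexBound K r n₁ n₂ z := by
  intro C hC
  obtain ⟨A, d, hA, ha⟩ := hp
  obtain ⟨A', d', hA', ha'⟩ := h.exists_norm_sub_le hn (C := max C 1) (by positivity)
  refine ⟨A + A', max d d', by positivity, fun t Λ h0 h1 hΛ k hk => ?_⟩
  obtain ⟨k', hk', hb⟩ := ha t Λ h0 h1 hΛ
  have hm := t.m_pos
  have hlg := t.one_le_lg n₂ h0
  have hlg0 : 0 ≤ t.lg n₂ Λ := zero_le_one.trans hlg
  have hsub := ha' t Λ h0 h1 hΛ k (Theory.region_mono (le_max_left _ _) (by positivity) h0 le_rfl hk)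
    k' (Theory.region_mono (le_max_right _ _) (by positivity) h0 le_rfl hk')
  set e := 4 - 2 * ((n₁ : ℤ) + n₂) - z
  calc _ = ‖iteratedFDeriv ℝ z (t.L r n₁ n₂ Λ) k' + (iteratedFDeriv ℝ z (t.L r n₁ n₂ Λ) k -
        iteratedFDeriv ℝ z (t.L r n₁ n₂ Λ) k')‖ := by rw [add_sub_cancel]
    _ ≤ A * (Λ + t.m) ^ e * t.lg n₂ Λ ^ d + A' * (Λ + t.m) ^ e * t.lg n₂ Λ ^ d' :=
        (norm_add_le _ _).trans (add_le_add hb hsub)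
    _ ≤ A * (Λ + t.m) ^ e * t.lg n₂ Λ ^ max d d' +
        A' * (Λ + t.m) ^ e * t.lg n₂ Λ ^ max d d' := by
        gcongr
        exacts [le_max_left _ _, le_max_right _ _]
    _ = _ := by ring

/-- Only heavy vertices below `M` need an argument. The flow is integrated from `M` down to `Λ` at
the same momenta; since `M + m ≤ 2 * (Λ + M)` and the logarithm at `M` is at most twice that at `Λ`,
the result is governed by `Λ + M`. -/
theorem HighVertexBound.vertexBound (hn : 1 ≤ n₁ + n₂) (hz : 2 * (n₁ + n₂) + z ≤ 4)
    (h : HighVertexBound K r n₁ n₂ z) (hF : FlowBound K r n₁ n₂ z) : VertexBound K r n₁ n₂ z := by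
  intro C hC
  obtain ⟨A, d, hA, ha⟩ := h C hC
  obtain ⟨A', d', hA', ha'⟩ := hF C hC
  obtain ⟨j, hj⟩ : ∃ j : ℕ, 4 - 2 * ((n₁ : ℤ) + n₂) - z = j :=
    ⟨4 - 2 * (n₁ + n₂) - z, by omega⟩
  refine ⟨A * 2 ^ j * 2 ^ d + A' * 2 ^ j * 2 ^ (d' + 1), max d (d' + 1), by positivity,
    fun t Λ h0 h1 k hk => ?_⟩
  have hm := t.m_pos
  have hM := t.M_pos
  have hmM := t.m_le
  have hlg := t.one_le_lg n₂ h0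
  have hlg0 : 0 ≤ t.lg n₂ Λ := zero_le_one.trans hlg
  by_cases hΛ : n₂ = 0 ∨ t.M ≤ Λ
  · have hw : (Λ + t.m) ^ (4 - 2 * ((n₁ : ℤ) + n₂) - z) ≤ t.weight n₁ n₂ z Λ := by
      unfold Theory.weight
      split_ifs
      · rfl
      · rw [hj, zpow_natCast, zpow_natCast]
        gcongr
    refine (ha t Λ h0 h1 hΛ k hk).trans ?_
    have hw0 : 0 < (Λ + t.m) ^ (4 - 2 * ((n₁ : ℤ) + n₂) - z) := by positivity
    have h2 : (1 : ℝ) ≤ 2 ^ j * 2 ^ d := by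
      rw [← pow_add]; exact one_le_pow₀ one_le_two
    have h3 : A ≤ A * 2 ^ j * 2 ^ d + A' * 2 ^ j * 2 ^ (d' + 1) := by
      have : 0 ≤ A' * 2 ^ j * 2 ^ (d' + 1) := by positivity
      nlinarith
    have h4 : 0 ≤ t.weight n₁ n₂ z Λ := hw0.le.trans hw
    gcongr
    exact le_max_left _ _
  · push Not at hΛ
    obtain ⟨hn₂, hΛM⟩ := hΛ
    have hw : t.weight n₁ n₂ z Λ = (Λ + t.M) ^ j := by
      rw [Theory.weight, if_neg (by omega), hj, zpow_natCast]
    have h2 := ha t t.M hM.le t.M_le (Or.inr le_rfl) k (Theory.region_mono le_rfl hC h0 hΛM.le hk)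
    have h3 := Theory.norm_sub_le_of_relevant (k := k) (z := z) hn h0 hΛM.le t.M_le hA'
      (d := d') (j := j) (e := 3 - 2 * ((n₁ : ℤ) + n₂) - z) (by omega)
      (fun l hl => ha' t l (h0.trans_lt hl.1) (hl.2.trans t.M_le) k
        (Theory.region_mono le_rfl hC h0 hl.1.le hk))
    have hlgM : t.lg n₂ t.M ≤ 2 * t.lg n₂ Λ := by
      have e1 : t.lg n₂ t.M ≤ 1 + Real.log (2 * ((Λ + t.gap n₂) / t.m)) := by
        have : 0 < (t.M + t.gap n₂) / t.m := div_pos (by linarith [t.m_le_gap n₂]) hm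
        unfold Theory.lg
        gcongr
        rw [← mul_div_assoc]
        gcongr
        simp only [Theory.gap, if_neg hn₂]
        linarith
      have e2 : 1 ≤ (Λ + t.gap n₂) / t.m := by
        rw [one_le_div hm]; linarith [t.m_le_gap n₂]
      rw [Real.log_mul two_ne_zero (by positivity)] at e1
      have e3 := Real.log_nonneg e2
      have e4 : Real.log 2 ≤ 1 := by linarith [Real.log_two_lt_d9]
      have e5 : t.lg n₂ Λ = 1 + Real.log ((Λ + t.gap n₂) / t.m) := rfl
      linarith
    have hlgM0 : 0 ≤ t.lg n₂ t.M := zero_le_one.trans (t.one_le_lg n₂ hM.le)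
    have hlog : Real.log ((t.M + t.m) / (Λ + t.m)) ≤ t.lg n₂ t.M := by
      have e1 : Real.log ((t.M + t.m) / (Λ + t.m)) ≤ Real.log ((t.M + t.gap n₂) / t.m) := by
        refine Real.log_le_log (by positivity) ?_
        have := t.m_le_gap n₂
        have : 0 ≤ t.M + t.gap n₂ := by linarith
        gcongr
        exact le_add_of_nonneg_left h0
      unfold Theory.lg
      linarith
    have hlog0 : 0 ≤ Real.log ((t.M + t.m) / (Λ + t.m)) :=
      Real.log_nonneg (by rw [one_le_div (by positivity)]; linarith)
    have hMm : t.M + t.m ≤ 2 * (Λ + t.M) := by linarith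
    rw [hj, zpow_natCast] at h2
    rw [hw]
    calc _ = ‖iteratedFDeriv ℝ z (t.L r n₁ n₂ t.M) k - (iteratedFDeriv ℝ z (t.L r n₁ n₂ t.M) k -
          iteratedFDeriv ℝ z (t.L r n₁ n₂ Λ) k)‖ := by rw [sub_sub_cancel]
      _ ≤ A * (t.M + t.m) ^ j * t.lg n₂ t.M ^ d + A' * (t.M + t.m) ^ j * t.lg n₂ t.M ^ d' *
          Real.log ((t.M + t.m) / (Λ + t.m)) := (norm_sub_le _ _).trans (add_le_add h2 h3)
      _ ≤ A * (2 * (Λ + t.M)) ^ j * (2 * t.lg n₂ Λ) ^ d + A' * (2 * (Λ + t.M)) ^ j *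
          (2 * t.lg n₂ Λ) ^ d' * (2 * t.lg n₂ Λ) := by
          gcongr
          exact hlog.trans hlgM
      _ = A * 2 ^ j * 2 ^ d * (Λ + t.M) ^ j * t.lg n₂ Λ ^ d +
          A' * 2 ^ j * 2 ^ (d' + 1) * (Λ + t.M) ^ j * t.lg n₂ Λ ^ (d' + 1) := by
          simp only [mul_pow, pow_succ]; ring
      _ ≤ A * 2 ^ j * 2 ^ d * (Λ + t.M) ^ j * t.lg n₂ Λ ^ max d (d' + 1) +
          A' * 2 ^ j * 2 ^ (d' + 1) * (Λ + t.M) ^ j * t.lg n₂ Λ ^ max d (d' + 1) := by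
          gcongr
          exacts [le_max_left _ _, le_max_right _ _]
      _ = _ := by ring

/-! ### Renormalization conditions -/

section Invariant

variable {R : Momentum ≃ₗᵢ[ℝ] Momentum} {n₁ n₂ : ℕ} {F : Config n₁ n₂ → ℝ}

/-- The chain rule at the origin, which the isometry fixes. -/
theorem IsInvariant.iteratedFDeriv_zero (h : IsInvariant R F) (hF : ContDiff ℝ ∞ F) (z : ℕ)
    (v : Fin z → Config n₁ n₂) :
    iteratedFDeriv ℝ z F 0 (fun s i => R (v s i)) = iteratedFDeriv ℝ z F 0 v := by
  let T : Config n₁ n₂ →L[ℝ] Config n₁ n₂ :=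
    ContinuousLinearMap.pi fun i => (R : Momentum →L[ℝ] Momentum).comp (ContinuousLinearMap.proj i)
  have hT : F ∘ T = F := funext h
  have h1 := T.iteratedFDeriv_comp_right hF 0 (natCast_le_infty z)
  rw [hT, map_zero] at h1
  conv_rhs => rw [h1]
  rfl

theorem IsInvariant.fderiv_zero (h : IsInvariant (LinearIsometryEquiv.neg ℝ) F)
    (hF : ContDiff ℝ ∞ F) : iteratedFDeriv ℝ 1 F 0 = 0 := by
  ext v
  have h1 := h.iteratedFDeriv_zero hF 1 v
  simp only [iteratedFDeriv_one_apply, LinearIsometryEquiv.coe_neg] at h1 ⊢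
  have h2 : (fun i => -v 0 i) = -v 0 := rfl
  rw [h2, map_neg] at h1
  simp only [_root_.zero_apply]
  linarith

/-- The Hessian at zero of an invariant function of one momentum is a multiple of the identity. -/
theorem norm_iteratedFDeriv_two_zero_le (F : Config 0 1 → ℝ) (hF : ContDiff ℝ ∞ F)
    (h : ∀ R, IsInvariant R F) {e : Momentum} (he : ‖e‖ = 1) :
    ‖iteratedFDeriv ℝ 2 F 0‖ ≤ |iteratedFDeriv ℝ 2 F 0 ![fun _ => e, fun _ => e]| := by
  set B : Momentum → Momentum → ℝ := fun u v =>
    fderiv ℝ (fderiv ℝ F) 0 (fun _ => u) (fun _ => v) with hB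
  have hB' : ∀ u v, iteratedFDeriv ℝ 2 F 0 ![fun _ => u, fun _ => v] = B u v := fun u v => by
    simp [iteratedFDeriv_two_apply, hB]
  have hadd : ∀ u v w, B (u + v) w = B u w + B v w := fun u v w => by
    have : (fun _ => u + v : Config 0 1) = (fun _ => u) + fun _ => v := rfl
    simp [hB, this]
  have hadd' : ∀ u v w, B u (v + w) = B u v + B u w := fun u v w => by
    have : (fun _ => v + w : Config 0 1) = (fun _ => v) + fun _ => w := rfl
    simp [hB, this]
  have hsmul : ∀ (s : ℝ) u, B (s • u) (s • u) = s ^ 2 * B u u := fun s u => by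
    have : (fun _ => s • u : Config 0 1) = s • fun _ => u := rfl
    simp only [hB, this, map_smul, _root_.smul_apply, smul_eq_mul]
    ring
  have hsymm : ∀ u v, B u v = B v u := fun u v =>
    ((hF.contDiffAt (x := 0)).isSymmSndFDerivAt
      (by simpa using natCast_le_infty 2)) _ _
  have hinv : ∀ (R : Momentum ≃ₗᵢ[ℝ] Momentum) u, B (R u) (R u) = B u u := fun R u => by
    rw [← hB', ← hB' u, ← (h R).iteratedFDeriv_zero hF 2 ![fun _ => u, fun _ => u]]
    congr 1
    funext s
    fin_cases s <;> rfl
  -- A reflection carries `‖u‖ • e` to `u`, so the quadratic form is known on all vectors;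
  -- polarization then gives the bilinear form.
  have hdiag : ∀ u, B u u = ‖u‖ ^ 2 * B e e := fun u => by
    have h1 : ‖‖u‖ • e‖ = ‖u‖ := by simp [norm_smul, he]
    have h2 := hinv (Submodule.reflection (Submodule.span ℝ {‖u‖ • e - u})ᗮ) (‖u‖ • e)
    rw [Submodule.reflection_sub h1, hsmul] at h2
    exact h2
  have hall : ∀ u v, B u v = inner ℝ u v * B e e := fun u v => by
    have h1 := hdiag (u + v)
    rw [hadd, hadd', hadd', hdiag u, hdiag v, hsymm v u, norm_add_sq_real] at h1
    linarith
  refine ContinuousMultilinearMap.opNorm_le_bound (abs_nonneg _) fun v => ?_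
  have hv : v = ![fun _ => v 0 ⟨0, by norm_num⟩, fun _ => v 1 ⟨0, by norm_num⟩] := by
    funext s i
    obtain rfl : i = ⟨0, by norm_num⟩ := Subsingleton.elim (α := Fin 1) _ _
    fin_cases s <;> rfl
  rw [hB', Fin.prod_univ_two]
  conv_lhs => rw [hv, hB', hall]
  rw [Real.norm_eq_abs, abs_mul, mul_comm]
  refine mul_le_mul_of_nonneg_left ((abs_real_inner_le_norm _ _).trans ?_) (abs_nonneg _)
  exact mul_le_mul (norm_le_pi_norm _ _) (norm_le_pi_norm _ _) (norm_nonneg _) (norm_nonneg _)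

end Invariant

/-! ### Starting values at the renormalization points -/

variable {K : ℝ → ℝ} {r : Fin 3 → ℕ} {n₁ n₂ z : ℕ}

/-- Configurations admissible at scale zero remain so at every higher scale, hence the flow can be
integrated from `0` at fixed momenta. The logarithm produced is absorbed by one more power of `lg`.
-/
theorem FlowBound.exists_norm_sub_zero_le (hn : 1 ≤ n₁ + n₂) (hz : 2 * (n₁ + n₂) + z ≤ 4)
    (hF : FlowBound K r n₁ n₂ z) : ∃ (A : ℝ) (d : ℕ), 0 ≤ A ∧ ∀ (t : Theory K) (Λ : ℝ),
      0 ≤ Λ → Λ ≤ t.Λ₀ → ∀ k ∈ t.region 1 0 n₁ n₂,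
        ‖iteratedFDeriv ℝ z (t.L r n₁ n₂ Λ) k - iteratedFDeriv ℝ z (t.L r n₁ n₂ 0) k‖ ≤
          A * (Λ + t.m) ^ (4 - 2 * ((n₁ : ℤ) + n₂) - z) * t.lg n₂ Λ ^ d := by
  obtain ⟨A, d, hA, h⟩ := hF 1 zero_le_one
  obtain ⟨j, hj⟩ : ∃ j : ℕ, 4 - 2 * ((n₁ : ℤ) + n₂) - z = j :=
    ⟨4 - 2 * (n₁ + n₂) - z, by omega⟩
  refine ⟨A, d + 1, hA, fun t Λ h0 h1 k hk => ?_⟩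
  have hm := t.m_pos
  have hlg0 : 0 ≤ t.lg n₂ Λ := zero_le_one.trans (t.one_le_lg n₂ h0)
  refine (Theory.norm_sub_le_of_relevant (k := k) (z := z) hn le_rfl h0 h1 hA
    (d := d) (j := j) (e := 3 - 2 * ((n₁ : ℤ) + n₂) - z) (by omega)
    (fun l hl => h t l hl.1 (hl.2.trans h1) k
      (Theory.region_mono le_rfl zero_le_one le_rfl hl.1.le hk))).trans ?_
  rw [hj, zpow_natCast, zero_add, pow_succ, ← mul_assoc]
  gcongr
  have : Real.log ((Λ + t.m) / t.m) ≤ Real.log ((Λ + t.gap n₂) / t.m) := by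
    refine Real.log_le_log (by positivity) ?_
    have := t.m_le_gap n₂
    gcongr
  unfold Theory.lg
  linarith

/-- The condition at scale zero is bounded by a nonnegative power of `m`, which is below the same
power of `Λ + m`. Nonzero renormalized couplings occur only for dimension zero, where this power is
one. -/
theorem FlowBound.pointBound (hn : 1 ≤ n₁ + n₂) (hz : 2 * (n₁ + n₂) + z ≤ 4)
    (hF : FlowBound K r n₁ n₂ z) (h : ∀ t : Theory K, ∃ k ∈ t.region 1 0 n₁ n₂,
      ‖iteratedFDeriv ℝ z (t.L r n₁ n₂ 0) k‖ ≤ t.m ^ (4 - 2 * ((n₁ : ℤ) + n₂) - z)) :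
    PointBound K r n₁ n₂ z := by
  obtain ⟨A, d, hA, ha⟩ := hF.exists_norm_sub_zero_le hn hz
  refine ⟨A + 1, d, by positivity, fun t Λ h0 h1 _ => ?_⟩
  obtain ⟨k, hk, hb⟩ := h t
  obtain ⟨j, hj⟩ : ∃ j : ℕ, 4 - 2 * ((n₁ : ℤ) + n₂) - z = j :=
    ⟨4 - 2 * (n₁ + n₂) - z, by omega⟩
  have hd := ha t Λ h0 h1 k hk
  have hm := t.m_pos
  refine ⟨k, Theory.region_mono le_rfl zero_le_one le_rfl h0 hk, ?_⟩
  rw [hj, zpow_natCast] at hb hd ⊢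
  have h2 : t.m ^ j * 1 ≤ (Λ + t.m) ^ j * t.lg n₂ Λ ^ d := by
    have := one_le_pow₀ (t.one_le_lg n₂ h0) (n := d)
    gcongr
    linarith
  have h3 := norm_add_le (iteratedFDeriv ℝ z (t.L r n₁ n₂ Λ) k -
    iteratedFDeriv ℝ z (t.L r n₁ n₂ 0) k) (iteratedFDeriv ℝ z (t.L r n₁ n₂ 0) k)
  rw [sub_add_cancel] at h3
  linarith

theorem Theory.mem_region_one {t : Theory K} {Λ : ℝ} {k : Config n₁ n₂} (hΛ : 0 ≤ Λ)
    (h : ∀ i, k i = 0 ∨ 2 * n₁ ≤ (i : ℕ) ∧ ∃ j, k i = t.pbar j) : k ∈ t.region 1 Λ n₁ n₂ := by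
  intro i
  have hm := t.m_pos
  have hM := t.M_pos
  rcases h i with h | ⟨hi, j, h⟩
  · rw [h, norm_zero]
    split_ifs <;> positivity
  · rw [h, t.norm_pbar, if_neg (by omega)]
    linarith

theorem pointBound_deriv_one (hK : IsCutoffProfile K) (hn : 1 ≤ n₁ + n₂) :
    PointBound K r n₁ n₂ 1 := by
  refine ⟨0, 0, le_rfl, fun t Λ h0 h1 _ => ⟨0, Theory.mem_region_one h0 fun i => Or.inl rfl, ?_⟩⟩
  rw [(t.isInvariant hK _ r n₁ n₂ hn Λ ⟨h0, h1⟩).fderiv_zero (t.smooth r hn h0 h1)]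
  simp

theorem pointBound_light_two (hF : FlowBound K r 1 0 0) : PointBound K r 1 0 0 := by
  refine hF.pointBound (by norm_num) (by norm_num) fun t =>
    ⟨0, Theory.mem_region_one le_rfl fun i => Or.inl rfl, ?_⟩
  have := t.m_pos
  rw [norm_iteratedFDeriv_zero, t.sol.renormalized.light_two, norm_zero]
  positivity

theorem pointBound_light_two_deriv (hF : FlowBound K r 1 0 2) : PointBound K r 1 0 2 := by
  refine hF.pointBound (by norm_num) (by norm_num) fun t =>
    ⟨0, Theory.mem_region_one le_rfl fun i => Or.inl rfl, ?_⟩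
  have hm := t.m_pos
  have h : iteratedFDeriv ℝ 2 (t.L r 1 0 0) 0 = 0 := by
    ext v
    have hv : v = ![fun _ => v 0 ⟨0, by norm_num⟩, fun _ => v 1 ⟨0, by norm_num⟩] := by
      funext s i
      obtain rfl : i = ⟨0, by norm_num⟩ := Subsingleton.elim (α := Fin 1) _ _
      fin_cases s <;> rfl
    rw [hv, t.sol.renormalized.light_two_deriv]
    rfl
  rw [h, norm_zero]
  positivity

theorem pointBound_light_four (hF : FlowBound K r 2 0 0) : PointBound K r 2 0 0 := by
  refine hF.pointBound (by norm_num) (by norm_num) fun t =>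
    ⟨0, Theory.mem_region_one le_rfl fun i => Or.inl rfl, ?_⟩
  rw [norm_iteratedFDeriv_zero, t.sol.renormalized.light_four]
  split_ifs <;> norm_num

theorem pointBound_heavy_two (hF : FlowBound K r 0 1 0) : PointBound K r 0 1 0 := by
  refine hF.pointBound (by norm_num) (by norm_num) fun t =>
    ⟨fun _ => t.pbar 0, Theory.mem_region_one le_rfl fun i => Or.inr ⟨by omega, 0, rfl⟩, ?_⟩
  have := t.m_pos
  rw [norm_iteratedFDeriv_zero, t.sol.renormalized.heavy_two, norm_zero]
  positivity

theorem pointBound_heavy_four (hF : FlowBound K r 0 2 0) : PointBound K r 0 2 0 := by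
  refine hF.pointBound (by norm_num) (by norm_num) fun t =>
    ⟨![t.pbar 1, t.pbar 2, t.pbar 3], Theory.mem_region_one le_rfl fun i => Or.inr ⟨by omega, ?_⟩, ?_⟩
  · fin_cases i
    exacts [⟨1, rfl⟩, ⟨2, rfl⟩, ⟨3, rfl⟩]
  · rw [norm_iteratedFDeriv_zero, t.sol.renormalized.heavy_four]
    split_ifs <;> norm_num

theorem pointBound_mixed_four (hF : FlowBound K r 1 1 0) : PointBound K r 1 1 0 := by
  refine hF.pointBound (by norm_num) (by norm_num) fun t =>
    ⟨![0, 0, t.pbar 4], Theory.mem_region_one le_rfl fun i => ?_, ?_⟩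
  · fin_cases i
    exacts [Or.inl rfl, Or.inl rfl, Or.inr ⟨le_rfl, 4, rfl⟩]
  · rw [norm_iteratedFDeriv_zero, t.sol.renormalized.mixed_four]
    split_ifs <;> norm_num

/-- The Hessian at zero momentum is determined by its value in one direction `e` orthogonal to the
renormalization point. At that point the value vanishes at scale zero and is followed along the flow
to `Λ`; the third-derivative bound then moves it to zero momentum, a displacement of length `M`,
hence the restriction to `Λ ≥ M`. -/
theorem pointBound_heavy_two_deriv (hK : IsCutoffProfile K) (hF : FlowBound K r 0 1 2)
    (hV : VertexBound K r 0 1 3) : PointBound K r 0 1 2 := by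
  obtain ⟨A, d, hA, ha⟩ := hF.exists_norm_sub_zero_le (by norm_num) (by norm_num)
  obtain ⟨A', d', hA', ha'⟩ := hV.exists_norm_sub_le (by norm_num) zero_le_one
  refine ⟨A + A', max d d', by positivity, fun t Λ h0 h1 hΛ =>
    ⟨0, Theory.mem_region_one h0 fun i => Or.inl rfl, ?_⟩⟩
  obtain ⟨e, he, hpe⟩ := exists_unit_orthogonal (t.pbar 0)
  rw [real_inner_comm] at hpe
  set p : Config 0 1 := fun _ => t.pbar 0 with hp
  have hmem : ∀ {l : ℝ}, 0 ≤ l → p ∈ t.region 1 l 0 1 := fun hl =>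
    Theory.mem_region_one hl fun i => Or.inr ⟨by omega, 0, rfl⟩
  have hlg := t.one_le_lg 1 h0
  have hd := ha t Λ h0 h1 p (hmem le_rfl)
  have hd' := ha' t Λ h0 h1 hΛ 0 (Theory.mem_region_one h0 fun i => Or.inl rfl) p (hmem h0)
  have hs := norm_iteratedFDeriv_two_zero_le (t.L r 0 1 Λ) (t.smooth r (by norm_num) h0 h1)
    (fun R => t.isInvariant hK R r 0 1 (by norm_num) Λ ⟨h0, h1⟩) he
  set u : Fin 2 → Config 0 1 := ![fun _ => e, fun _ => e] with hu
  have hu1 : ∏ i, ‖u i‖ ≤ 1 := by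
    have : ‖(fun _ => e : Config 0 1)‖ ≤ 1 :=
      (pi_norm_le_iff_of_nonneg zero_le_one).2 fun _ => he.le
    simp only [hu, Fin.prod_univ_two, Matrix.cons_val_zero, Matrix.cons_val_one]
    exact mul_le_one₀ this (norm_nonneg _) this
  have happ : ∀ G : ContinuousMultilinearMap ℝ (fun _ : Fin 2 => Config 0 1) ℝ, |G u| ≤ ‖G‖ :=
    fun G => (G.le_opNorm u).trans (mul_le_of_le_one_right (norm_nonneg _) hu1)
  have hzero : iteratedFDeriv ℝ 2 (t.L r 0 1 0) p u = 0 :=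
    t.sol.renormalized.heavy_two_deriv r e e hpe hpe
  have e1 := (happ _).trans hd
  have e2 := (happ _).trans hd'
  rw [_root_.sub_apply] at e1 e2
  rw [hzero, sub_zero] at e1
  have e3 := abs_add_le (iteratedFDeriv ℝ 2 (t.L r 0 1 Λ) 0 u - iteratedFDeriv ℝ 2 (t.L r 0 1 Λ) p u)
    (iteratedFDeriv ℝ 2 (t.L r 0 1 Λ) p u)
  rw [sub_add_cancel] at e3
  have hm := t.m_pos
  have p1 : t.lg 1 Λ ^ d ≤ t.lg 1 Λ ^ max d d' := pow_le_pow_right₀ hlg (le_max_left _ _)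
  have p2 : t.lg 1 Λ ^ d' ≤ t.lg 1 Λ ^ max d d' := pow_le_pow_right₀ hlg (le_max_right _ _)
  have hw : 0 < (Λ + t.m) ^ (4 - 2 * (((0 : ℕ) : ℤ) + (1 : ℕ)) - (2 : ℕ)) := by positivity
  calc _ ≤ _ := hs.trans (e3.trans (add_le_add e2 e1))
    _ ≤ A' * (Λ + t.m) ^ (4 - 2 * (((0 : ℕ) : ℤ) + (1 : ℕ)) - (2 : ℕ)) * t.lg 1 Λ ^ max d d' +
        A * (Λ + t.m) ^ (4 - 2 * (((0 : ℕ) : ℤ) + (1 : ℕ)) - (2 : ℕ)) * t.lg 1 Λ ^ max d d' := by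
        gcongr
    _ = _ := by ring

/-! ### Bounds for all vertex functions -/

theorem vertexBound (hK : IsCutoffProfile K) : ∀ (r : Fin 3 → ℕ) (n₁ n₂ : ℕ), 1 ≤ n₁ + n₂ →
    ∀ z, VertexBound K r n₁ n₂ z := by
  refine vertex_induction (fun r n₁ n₂ h z C hC => ⟨0, 0, le_rfl, fun t Λ h0 h1 k _ => ?_⟩)
    fun r n₁ n₂ hn hlow hL hH => ?_
  · rw [show t.L r n₁ n₂ Λ = fun _ => 0 from funext (t.sol.connected r n₁ n₂ h Λ ⟨h0, h1⟩),
      iteratedFDeriv_fun_zero]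
    simp
  have hF : ∀ z, FlowBound K r n₁ n₂ z := FlowBound.of_vertexBound hK hlow hL hH
  have hirr : ∀ z, 4 < 2 * (n₁ + n₂) + z → VertexBound K r n₁ n₂ z :=
    fun z hz => VertexBound.of_irrelevant hn hz (hF z)
  have hrel : ∀ z, 2 * (n₁ + n₂) + z ≤ 4 → PointBound K r n₁ n₂ z →
      VertexBound K r n₁ n₂ (z + 1) → VertexBound K r n₁ n₂ z := fun z hz hp h =>
    (hp.highVertexBound hn h).vertexBound hn hz (hF z)
  have hpt : VertexBound K r n₁ n₂ 3 → ∀ z, 2 * (n₁ + n₂) + z ≤ 4 → PointBound K r n₁ n₂ z := by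
    intro h3 z hz
    by_cases hz1 : z = 1
    · subst hz1; exact pointBound_deriv_one hK hn
    obtain ⟨rfl, rfl, rfl⟩ | ⟨rfl, rfl, rfl⟩ | ⟨rfl, rfl, rfl⟩ | ⟨rfl, rfl, rfl⟩ | ⟨rfl, rfl, rfl⟩ |
      ⟨rfl, rfl, rfl⟩ | ⟨rfl, rfl, rfl⟩ : n₁ = 1 ∧ n₂ = 0 ∧ z = 0 ∨ n₁ = 1 ∧ n₂ = 0 ∧ z = 2 ∨
        n₁ = 2 ∧ n₂ = 0 ∧ z = 0 ∨ n₁ = 0 ∧ n₂ = 1 ∧ z = 0 ∨ n₁ = 0 ∧ n₂ = 1 ∧ z = 2 ∨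
        n₁ = 0 ∧ n₂ = 2 ∧ z = 0 ∨ n₁ = 1 ∧ n₂ = 1 ∧ z = 0 := by omega
    · exact pointBound_light_two (hF 0)
    · exact pointBound_light_two_deriv (hF 2)
    · exact pointBound_light_four (hF 0)
    · exact pointBound_heavy_two (hF 0)
    · exact pointBound_heavy_two_deriv hK (hF 2) h3
    · exact pointBound_heavy_four (hF 0)
    · exact pointBound_mixed_four (hF 0)
  -- Third derivatives are irrelevant for every vertex with legs, so the descent in `z` starts here.
  have h3 := hirr 3 (by omega)
  have hstep : ∀ z, VertexBound K r n₁ n₂ (z + 1) → VertexBound K r n₁ n₂ z := fun z h =>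
    if hz : 4 < 2 * (n₁ + n₂) + z then hirr z hz
    else hrel z (not_lt.1 hz) (hpt h3 z (not_lt.1 hz)) h
  have h2 := hstep 2 h3
  have h1 := hstep 1 h2
  intro z
  match z with
  | 0 => exact hstep 0 h1
  | 1 => exact h1
  | 2 => exact h2
  | z + 3 => exact hirr _ (by omega)

/-! ### Norms of vertex functions -/

theorem abs_partialDeriv_le (F : Config n₁ n₂ → ℝ)
    (j : Fin z → Fin (2 * n₁ + 2 * n₂ - 1) × Fin 4) (k : Config n₁ n₂) :
    |partialDeriv F j k| ≤ ‖iteratedFDeriv ℝ z F k‖ := by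
  refine ((iteratedFDeriv ℝ z F k).le_opNorm _).trans_eq ?_
  rw [Finset.prod_eq_one fun s _ => by rw [Pi.norm_single]; simp, mul_one]

theorem vertexNorm_le {a b b' B : ℝ} {F : Config n₁ n₂ → ℝ} (h : ∀ k : Config n₁ n₂,
    (∀ i, ‖k i‖ ≤ if (i : ℕ) < 2 * n₁ then max a b else max a b') →
      ‖iteratedFDeriv ℝ z F k‖ ≤ B) : vertexNorm a b b' z F ≤ ENNReal.ofReal B :=
  iSup_le fun k => iSup_le fun hk => iSup_le fun j =>
    ENNReal.ofReal_le_ofReal ((abs_partialDeriv_le F j k).trans (h k hk))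

end TwoScalar

end

theorem theorem1 (K : ℝ → ℝ) (hK : TwoScalar.IsCutoffProfile K) (κ : ℝ) (hκ : 0 < κ)
    (r : Fin 3 → ℕ) (n₁ n₂ : ℕ) (hn : 1 ≤ n₁ + n₂) (z : ℕ) :
    ∃ Plog : Polynomial ℝ, ∀ (m μ M Λ₀ : ℝ) (pbar : Fin 5 → TwoScalar.Momentum)
      (L : TwoScalar.VertexFamily),
      0 < m → 0 < μ → μ ≤ κ * m → m ≤ M → M ≤ Λ₀ → (∀ i, ‖pbar i‖ = M) →
      TwoScalar.IsPerturbativeSolution K m M Λ₀ pbar L →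
      ∀ Λ : ℝ, 0 ≤ Λ → Λ ≤ Λ₀ →
        (n₂ = 0 →
          TwoScalar.vertexNorm (2 * Λ) μ M z (L r n₁ n₂ Λ) ≤
            ENNReal.ofReal ((Λ + m) ^ (4 - 2 * (n₁ : ℤ) - z) *
              Plog.eval (Real.log ((Λ + m) / m)))) ∧
        (n₂ ≠ 0 → 4 < 2 * (n₁ + n₂) + z →
          TwoScalar.vertexNorm (2 * Λ) μ M z (L r n₁ n₂ Λ) ≤
            ENNReal.ofReal ((Λ + m) ^ (4 - 2 * ((n₁ : ℤ) + n₂) - z) *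
              Plog.eval (Real.log ((Λ + M) / m)))) ∧
        (n₂ ≠ 0 → 2 * (n₁ + n₂) + z ≤ 4 →
          TwoScalar.vertexNorm (2 * Λ) μ M z (L r n₁ n₂ Λ) ≤
            ENNReal.ofReal ((Λ + M) ^ (4 - 2 * ((n₁ : ℤ) + n₂) - z) *
              Plog.eval (Real.log ((Λ + M) / m)))) := by
  -- The 2 covers the momenta up to `2 * Λ` and the heavy ones up to `M`; `κ` covers `μ ≤ κ * m`.
  obtain ⟨A, d, hA, h⟩ := TwoScalar.vertexBound hK r n₁ n₂ hn z (max 2 κ) (by positivity)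
  -- `lg` is one plus the logarithm in the claim.
  refine ⟨Polynomial.C A * (1 + Polynomial.X) ^ d, ?_⟩
  intro m μ M Λ₀ pbar L hm hμ hμκ hmM hM hpbar hL Λ h0 h1
  let t : TwoScalar.Theory K := ⟨m, M, Λ₀, pbar, L, hm, hmM, hM, hpbar, hL⟩
  have key : TwoScalar.vertexNorm (2 * Λ) μ M z (L r n₁ n₂ Λ) ≤
      ENNReal.ofReal (A * t.weight n₁ n₂ z Λ * t.lg n₂ Λ ^ d) := by
    refine TwoScalar.vertexNorm_le fun k hk => h t Λ h0 h1 k fun i => (hk i).trans ?_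
    have c1 : 2 * Λ ≤ max 2 κ * Λ := by gcongr; exact le_max_left _ _
    have c2 : κ * m ≤ max 2 κ * m := by gcongr; exact le_max_right _ _
    have c3 : 2 * M ≤ max 2 κ * M := by gcongr; exacts [hm.le.trans hmM, le_max_left _ _]
    have c4 : 0 ≤ κ * m := by positivity
    split_ifs
    · rw [mul_add]
      exact max_le (by change _ ≤ _ + _ * m; linarith) (by change _ ≤ _ + _ * m; linarith)
    · rw [mul_add]
      exact max_le (by change _ ≤ _ + _ * M; linarith) (by change _ ≤ _ + _ * M; linarith)
  refine ⟨fun h2 => ?_, fun h2 h3 => ?_, fun h2 h3 => ?_⟩ <;> refine key.trans_eq ?_ <;> congr 1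
  · subst h2
    simp [TwoScalar.Theory.weight, TwoScalar.Theory.lg, TwoScalar.Theory.gap, t]
    ring
  · simp [TwoScalar.Theory.weight, TwoScalar.Theory.lg, TwoScalar.Theory.gap, t, h2, h3]
    ring
  · simp [TwoScalar.Theory.weight, TwoScalar.Theory.lg, TwoScalar.Theory.gap, t, h2, not_lt.2 h3]
    ring
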